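/- Let $n\ge 1$, $I_{n|n}=\{-n,\dots,-1,1,\dots,n\}$, $|i|=\bar 0$ for $i>0$ and $|i|=\bar 1$ for $i<0$. Work over $\mathbb{C}(q)$, put $\xi=q-q^{-1}$, $\varphi(i,j)=(-1)^{|j|}(\delta_{i,j}+\delta_{i,-j})$ and $$S=\sum_{i,j\in I_{n|n}}q^{\varphi(i,j)}E_{ii}\otimes E_{jj}+\xi\sum_{i<j}(-1)^{|i|}(E_{ji}+E_{-j,-i})\otimes E_{ij}$$ (and likewise with $r$ in place of $n$). Tensor products of superalgebras and of matrices over them carry the usual super signs; superscripts indicate tensor positions, those of algebra elements being in square brackets. Let $\mathrm{U}_q(\mathfrak q_n)$ be the unital superalgebra generated by $L_{ij}$ ($i\le j$ in $I_{n|n}$) of parity $|i|+|j|$ with relations $L_{ii}L_{-i,-i}=1=L_{-i,-i}L_{ii}$ and $L^{[1]2}L^{[1]3}S^{23}=S^{23}L^{[1]3}L^{[1]2}$, where $L=\sum_{i\le j}L_{ij}\otimes E_{ij}$. It has a unique comultiplication $\Delta$ and counit $\varepsilon$ (superalgebra homomorphisms) with $\Delta(L)=L\otimes L$, i.e. $\Delta(L_{ij})=\sum_k(-1)^{(|i|+|k|)(|k|+|j|)}L_{ik}\otimes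 L_{kj}$, and $\varepsilon(L_{ij})=\delta_{ij}$. A $\mathrm{U}_q(\mathfrak q_n)$-supermodule superalgebra is a unital associative superalgebra $B$ that is a $\mathrm{U}_q(\mathfrak q_n)$-supermodule with $u.(ab)=\sum(-1)^{|u_{(2)}||a|}(u_{(1)}.a)(u_{(2)}.b)$ for homogeneous $a$ and $u.1=\varepsilon(u)1$. For $r\ge 0$ let $\mathsf A_{r,n}$ be the unital superalgebra generated by $t_{ia}$ ($i\in I_{r|r}$, $a\in I_{n|n}$) of parity $|i|+|a|$ with relations $t_{ia}=t_{-i,-a}$ and $S^{12}T^{1[3]}T^{2[3]}=T^{2[3]}T^{1[3]}S^{12}$, where $T=\sum E_{ia}\otimes t_{ia}$. It is a $\mathrm{U}_q(\mathfrak q_n)$-supermodule superalgebra for a unique action $\Phi$ with $L^{[2]3}\cdot_\Phi T^{1[2]}=T^{1[2]}S^{13}$. For all $k,r$ there is a unique homomorphism of $\mathrm{U}_q(\mathfrak q_n)$-supermodules $\Theta_{k,r}:\mathsf A_{k,n}\otimes\mathsf A_{r,n}\to\mathsf A_{r,n}\otimes\mathsf A_{k,n}$ such that $\Theta(1\otimes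 x)=x\otimes 1$, $\Theta(y\otimes 1)=1\otimes y$, $\Theta(1\otimes\mathrm{mul})=(\mathrm{mul}\otimes1)(1\otimes\Theta)(\Theta\otimes1)$, $\Theta(\mathrm{mul}\otimes1)=(1\otimes\mathrm{mul})(\Theta\otimes1)(1\otimes\Theta)$ and $\Theta(T_k^{1[3]}T_r^{2[4]})=T_r^{2[3]}T_k^{1[4]}S^{12}$, where $T_r=\sum_{i=1}^r\sum_a E_{ia}\otimes t_{ia}$ and $T_k$ is defined likewise. The braided tensor product of $B_1,B_2$ with respect to $\vartheta:B_2\otimes B_1\to B_1\otimes B_2$ is $B_1\otimes B_2$ with multiplication $(\mathrm{mul}\otimes\mathrm{mul})(1\otimes\vartheta\otimes1)$ and the action through $\Delta$. Iterated braided tensor products are formed with the composite braiding operators, which move one tensor factor past the others one at a time by means of the maps $\Theta$; this agrees with transporting $\Theta$ along the isomorphisms in (b) and (c). Then: (a) $\mathsf A_{1,n}$ is isomorphic to the quantum supersymmetric algebra $\mathrm S_q(V)$, i.e. the unital superalgebra generated by $v_a$ ($a\in I_{n|n}$) of parity $|a|$ with relations $q\,v_av_b=q^{\varphi(a,b)}(-1)^{|a||b|}v_bv_a+\delta_{a<b}\xi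 v_av_b+\delta_{-a<b}\xi(-1)^{|b|}v_{-a}v_{-b}$, by $v_a\mapsto t_{1a}$. (b) For every $r\ge1$ the braided tensor product $\mathsf A_{1,n}^{\otimes r}$ of $r$ copies of $\mathsf A_{1,n}$ is a $\mathrm{U}_q(\mathfrak q_n)$-supermodule superalgebra, isomorphic to $\mathsf A_{r,n}$ as a $\mathrm{U}_q(\mathfrak q_n)$-supermodule superalgebra. The isomorphism can be chosen to intertwine the composite operator $\mathsf A_{1,n}\otimes\mathsf A_{1,n}^{\otimes r}\to\mathsf A_{1,n}^{\otimes r}\otimes\mathsf A_{1,n}$ with $\Theta_{1,r}$. (c) For all $r,k$ the braided tensor product $\mathsf A_{r,n}\otimes\mathsf A_{k,n}$ is a $\mathrm{U}_q(\mathfrak q_n)$-supermodule superalgebra, isomorphic to $\mathsf A_{r+k,n}$ as such. The isomorphism can be chosen to intertwine, for every $p$, the composite braiding operators of $\mathsf A_{r,n}\otimes\mathsf A_{k,n}$ with $\mathsf A_{p,n}$ (on either side) with $\Theta_{p,r+k}$ and $\Theta_{r+k,p}$. (d) For all $r,k,p$ the braided tensor product $(\mathsf A_{r,n}\otimes\mathsf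 A_{k,n})\otimes\mathsf A_{p,n}$ is a $\mathrm{U}_q(\mathfrak q_n)$-supermodule superalgebra, and there is an isomorphism of $\mathrm{U}_q(\mathfrak q_n)$-supermodule superalgebras $(\mathsf A_{r,n}\otimes\mathsf A_{k,n})\otimes\mathsf A_{p,n}\cong\mathsf A_{r,n}\otimes(\mathsf A_{k,n}\otimes\mathsf A_{p,n})$. -/

import Mathlib

open scoped TensorProduct

noncomputable section

namespace QueerBraid

/-! ### Base field, index sets, the matrix `S` -/

/-- The base field `ℂ(q)` of rational functions in an indeterminate. -/
abbrev K : Type := RatFunc ℂ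

/-- The indeterminate `q`. -/
def q : K := RatFunc.X

/-- `ξ = q - q⁻¹`. -/
def xi : K := q - q⁻¹

/-- The index set `I_{n|n} = {-n, …, -1, 1, …, n}`, with the order of the integers. -/
abbrev Idx (n : ℕ) : Type := {a : ℤ // a ∈ (Finset.Icc (-(n : ℤ)) n).erase 0}

instance Idx.instNeg (n : ℕ) : Neg (Idx n) :=
  ⟨fun a => ⟨-a.1, by
    have h := a.2
    simp only [Finset.mem_erase, Finset.mem_Icc, ne_eq] at h ⊢
    omega⟩⟩

/-- The parity `|i|` of an index: `0` if `i > 0` and `1` if `i < 0`. -/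
def pr {n : ℕ} (i : Idx n) : ℕ := if 0 < i.1 then 0 else 1

/-- `(-1)^m` in `ℂ(q)`. -/
def sg (m : ℕ) : K := (-1) ^ m

/-- `φ(i,j) = (-1)^{|j|} (δ_{i,j} + δ_{i,-j})`. -/
def phi {n : ℕ} (i j : Idx n) : ℤ :=
  (-1) ^ pr j * ((if i = j then 1 else 0) + (if i = -j then 1 else 0))

/-- `S i k j l` is the coefficient of `E_{ik} ⊗ E_{jl}` in
`S = ∑_{i,j} q^{φ(i,j)} E_{ii} ⊗ E_{jj} + ξ ∑_{i<j} (-1)^{|i|} (E_{ji} + E_{-j,-i}) ⊗ E_{ij}`. -/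
def S {n : ℕ} (i k j l : Idx n) : K :=
  (if i = k ∧ j = l then q ^ phi i j else 0) +
  (if j < l then
    xi * sg (pr j) * ((if i = l ∧ k = j then 1 else 0) + (if i = -l ∧ k = -j then 1 else 0))
   else 0)

/-! ### Homogeneity of `S`, needed for the parities below -/

theorem sg_add (a b : ℕ) : sg (a + b) = sg a * sg b := pow_add _ _ _

theorem sg_mul_self (a : ℕ) : sg a * sg a = 1 := by
  unfold sg; rw [← mul_pow]; simp

theorem sg_pr_neg {n : ℕ} (i : Idx n) : sg (pr (-i)) = -sg (pr i) := by
  have h := i.2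
  have h1 : (-i).1 = -i.1 := rfl
  simp only [Finset.mem_erase, Finset.mem_Icc, ne_eq] at h
  unfold sg pr
  rw [h1]
  rcases lt_or_gt_of_ne h.1 with h2 | h2
  · rw [if_pos (by omega), if_neg (by omega)]; simp
  · rw [if_neg (by omega), if_pos (by omega)]; simp

theorem S_even {n : ℕ} (i k j l : Idx n) :
    sg (pr k + pr l) * S i k j l = sg (pr i + pr j) * S i k j l := by
  by_cases h1 : i = k ∧ j = l
  · obtain ⟨rfl, rfl⟩ := h1; rfl
  by_cases h2 : i = l ∧ k = j
  · obtain ⟨rfl, rfl⟩ := h2; rw [add_comm]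
  by_cases h3 : i = -l ∧ k = -j
  · obtain ⟨rfl, rfl⟩ := h3
    simp only [sg_add, sg_pr_neg]; ring
  · simp [S, h1, h2, h3]

/-! ### Superalgebras given by generators and relations

Over a field of characteristic different from two, a superspace is the same thing as a vector
space with an involution `par`; an element `x` is homogeneous of parity `p` exactly when
`par x = (-1)^p x`.  For an algebra presented by homogeneous generators and relations, `par` is
the algebra homomorphism that multiplies a generator of parity `p` by `(-1)^p`. -/

/-- The parity involution of the free superalgebra on generators `x` of parity `p x`. -/
def freePar {X : Type} (p : X → ℕ) : FreeAlgebra K X →ₐ[K] FreeAlgebra K X :=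
  FreeAlgebra.lift K fun x => sg (p x) • FreeAlgebra.ι K x

theorem freePar_mul_ι {X : Type} (p : X → ℕ) (x y : X) :
    freePar p (FreeAlgebra.ι K x * FreeAlgebra.ι K y) =
      (sg (p x) * sg (p y)) • (FreeAlgebra.ι K x * FreeAlgebra.ι K y) := by
  simp [freePar, smul_smul, mul_comm]

/-- The parity involution of a superalgebra presented by homogeneous relations. -/
def quotPar {X : Type} (p : X → ℕ) (rel : FreeAlgebra K X → FreeAlgebra K X → Prop)
    (h : ∀ a b, rel a b → ∃ c : K, freePar p a = c • a ∧ freePar p b = c • b) :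
    RingQuot rel →ₐ[K] RingQuot rel :=
  RingQuot.liftAlgHom K ⟨(RingQuot.mkAlgHom K rel).comp (freePar p), by
    intro a b hab
    obtain ⟨c, ha, hb⟩ := h a b hab
    simp only [AlgHom.comp_apply, ha, hb, map_smul, RingQuot.mkAlgHom_rel K hab]⟩

/-! ### The quantum queer superalgebra -/

/-- The generators `L_{ij}`, `i ≤ j`, of `U_q(𝔮_n)`. -/
abbrev UGen (n : ℕ) : Type := {p : Idx n × Idx n // p.1 ≤ p.2}

/-- The parity `|i| + |j|` of the generator `L_{ij}`. -/
def uPar {n : ℕ} (x : UGen n) : ℕ := pr x.1.1 + pr x.1.2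

/-- `L_{ij}` in the free algebra, read as `0` if `i > j`. -/
def freeL {n : ℕ} (i j : Idx n) : FreeAlgebra K (UGen n) :=
  if h : i ≤ j then FreeAlgebra.ι K ⟨(i, j), h⟩ else 0

/-- The defining relations of `U_q(𝔮_n)`.  The third family is the coefficient of
`E_{ij} ⊗ E_{kl}` in `L^{[1]2} L^{[1]3} S^{23} = S^{23} L^{[1]3} L^{[1]2}`, an equation in the super
tensor product `U ⊗ End V ⊗ End V`, where
`L^{[1]2} L^{[1]3} = ∑ (-1)^{|E_{ia}| |L_{kb}|} L_{ia} L_{kb} ⊗ E_{ia} ⊗ E_{kb}`,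
`L^{[1]3} L^{[1]2} = ∑ L_{bl} L_{aj} ⊗ E_{aj} ⊗ E_{bl}` and
`(E ⊗ F) (E' ⊗ F') = (-1)^{|F| |E'|} E E' ⊗ F F'`. -/
inductive URel (n : ℕ) : FreeAlgebra K (UGen n) → FreeAlgebra K (UGen n) → Prop
  | inv (i : Idx n) : URel n (freeL i i * freeL (-i) (-i)) 1
  | inv' (i : Idx n) : URel n (freeL (-i) (-i) * freeL i i) 1
  | rll (i j k l : Idx n) : URel n
      (∑ a : Idx n, ∑ b : Idx n,
        (sg ((pr i + pr a) * (pr k + pr b)) * sg ((pr k + pr b) * (pr a + pr j)) * S a j b l) •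
          (freeL i a * freeL k b))
      (∑ a : Idx n, ∑ b : Idx n,
        (sg ((pr k + pr b) * (pr a + pr j)) * S i a k b) • (freeL b l * freeL a j))

/-- The quantum queer superalgebra `U_q(𝔮_n)`. -/
def U (n : ℕ) : Type := RingQuot (URel n)

instance U.instRing (n : ℕ) : Ring (U n) := inferInstanceAs (Ring (RingQuot (URel n)))

instance U.instAlgebra (n : ℕ) : Algebra K (U n) :=
  inferInstanceAs (Algebra K (RingQuot (URel n)))

/-- The element `L_{ij}` of `U_q(𝔮_n)` (zero if `i > j`). -/
def L {n : ℕ} (i j : Idx n) : U n := RingQuot.mkAlgHom K (URel n) (freeL i j)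

theorem freePar_freeL {n : ℕ} (i j : Idx n) :
    freePar uPar (freeL i j) = sg (pr i + pr j) • freeL i j := by
  unfold freeL
  split_ifs <;> simp [freePar, uPar]

theorem URel_homogeneous (n : ℕ) (x y : FreeAlgebra K (UGen n)) (h : URel n x y) :
    ∃ c : K, freePar uPar x = c • x ∧ freePar uPar y = c • y := by
  cases h with
  | inv i =>
    refine ⟨1, ?_, by simp⟩
    rw [map_mul, freePar_freeL, freePar_freeL, smul_mul_smul_comm, sg_add, sg_add, sg_mul_self,
      sg_mul_self, one_mul]
  | inv' i =>
    refine ⟨1, ?_, by simp⟩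
    rw [map_mul, freePar_freeL, freePar_freeL, smul_mul_smul_comm, sg_add, sg_add, sg_mul_self,
      sg_mul_self, one_mul]
  | rll i j k l =>
    refine ⟨sg (pr i + pr k) * sg (pr j + pr l), ?_, ?_⟩
    · simp only [map_sum, map_smul, map_mul, freePar_freeL, smul_mul_smul_comm, Finset.smul_sum,
        smul_smul]
      refine Finset.sum_congr rfl fun a _ => Finset.sum_congr rfl fun b _ => ?_
      congr 1
      have := S_even a j b l
      simp only [sg_add] at this ⊢
      linear_combination (-sg (pr i) * sg (pr k) * sg ((pr i + pr a) * (pr k + pr b)) *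
        sg ((pr k + pr b) * (pr a + pr j))) * this
    · simp only [map_sum, map_smul, map_mul, freePar_freeL, smul_mul_smul_comm, Finset.smul_sum,
        smul_smul]
      refine Finset.sum_congr rfl fun a _ => Finset.sum_congr rfl fun b _ => ?_
      congr 1
      have := S_even i a k b
      simp only [sg_add] at this ⊢
      linear_combination (sg (pr j) * sg (pr l) * sg ((pr k + pr b) * (pr a + pr j))) * this

/-- The parity involution of `U_q(𝔮_n)`: `L_{ij} ↦ (-1)^{|i|+|j|} L_{ij}`. -/
def parU (n : ℕ) : U n →ₐ[K] U n := quotPar uPar (URel n) (URel_homogeneous n)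

/-! ### Quantum coordinate superalgebras -/

/-- The parity `|i| + |a|` of the generator `t_{ia}`. -/
def tPar {r n : ℕ} (x : Idx r × Idx n) : ℕ := pr x.1 + pr x.2

/-- The defining relations of `A_{r,n}`: `t_{ia} = t_{-i,-a}`, and the coefficient of
`E_{ia} ⊗ E_{jb}` in `S^{12} T^{1[3]} T^{2[3]} = T^{2[3]} T^{1[3]} S^{12}`, where
`T^{1[3]} T^{2[3]} = ∑ (-1)^{|t_{ka}| |E_{lb}|} E_{ka} ⊗ E_{lb} ⊗ t_{ka} t_{lb}` and
`T^{2[3]} T^{1[3]} = ∑ E_{ic} ⊗ E_{jd} ⊗ t_{jd} t_{ic}`. -/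
inductive ARel (r n : ℕ) :
    FreeAlgebra K (Idx r × Idx n) → FreeAlgebra K (Idx r × Idx n) → Prop
  | neg (i : Idx r) (a : Idx n) :
      ARel r n (FreeAlgebra.ι K (i, a)) (FreeAlgebra.ι K (-i, -a))
  | rtt (i j : Idx r) (a b : Idx n) : ARel r n
      (∑ k : Idx r, ∑ l : Idx r,
        (sg ((pr j + pr l) * (pr k + pr a)) * sg ((pr k + pr a) * (pr l + pr b)) * S i k j l) •
          (FreeAlgebra.ι K (k, a) * FreeAlgebra.ι K (l, b)))
      (∑ c : Idx n, ∑ d : Idx n,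
        (sg ((pr j + pr d) * (pr c + pr a)) * S c a d b) •
          (FreeAlgebra.ι K (j, d) * FreeAlgebra.ι K (i, c)))

/-- The quantum coordinate superalgebra `A_{r,n}`. -/
def A (r n : ℕ) : Type := RingQuot (ARel r n)

instance A.instRing (r n : ℕ) : Ring (A r n) := inferInstanceAs (Ring (RingQuot (ARel r n)))

instance A.instAlgebra (r n : ℕ) : Algebra K (A r n) :=
  inferInstanceAs (Algebra K (RingQuot (ARel r n)))

/-- The generator `t_{ia}` of `A_{r,n}`. -/
def t {r n : ℕ} (i : Idx r) (a : Idx n) : A r n :=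
  RingQuot.mkAlgHom K (ARel r n) (FreeAlgebra.ι K (i, a))

theorem ARel_homogeneous (r n : ℕ) (x y : FreeAlgebra K (Idx r × Idx n)) (h : ARel r n x y) :
    ∃ c : K, freePar tPar x = c • x ∧ freePar tPar y = c • y := by
  cases h with
  | neg i a =>
    refine ⟨sg (pr i + pr a), ?_, ?_⟩
    · simp [freePar, tPar]
    · simp [freePar, tPar, sg_add, sg_pr_neg]
  | rtt i j a b =>
    refine ⟨sg (pr i + pr j) * sg (pr a + pr b), ?_, ?_⟩
    · simp only [map_sum, map_smul, freePar_mul_ι, Finset.smul_sum, smul_smul, tPar]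
      refine Finset.sum_congr rfl fun k _ => Finset.sum_congr rfl fun l _ => ?_
      congr 1
      have := S_even i k j l
      simp only [sg_add] at this ⊢
      linear_combination (sg (pr a) * sg (pr b) * sg ((pr j + pr l) * (pr k + pr a)) *
        sg ((pr k + pr a) * (pr l + pr b))) * this
    · simp only [map_sum, map_smul, freePar_mul_ι, Finset.smul_sum, smul_smul, tPar]
      refine Finset.sum_congr rfl fun c _ => Finset.sum_congr rfl fun d _ => ?_
      congr 1
      have := S_even c a d b
      simp only [sg_add] at this ⊢
      linear_combination (-sg (pr i) * sg (pr j) * sg ((pr j + pr d) * (pr c + pr a))) * this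

/-- The parity involution of `A_{r,n}`: `t_{ia} ↦ (-1)^{|i|+|a|} t_{ia}`. -/
def parA (r n : ℕ) : A r n →ₐ[K] A r n := quotPar tPar (ARel r n) (ARel_homogeneous r n)

/-! ### The quantum supersymmetric algebra -/

/-- The defining relations of `S_q(V)`:
`q v_a v_b = (-1)^{|a||b|} q^{φ(a,b)} v_b v_a + δ_{a<b} ξ v_a v_b
  + δ_{-a<b} (-1)^{|b|} ξ v_{-a} v_{-b}`. -/
inductive SqRel (n : ℕ) : FreeAlgebra K (Idx n) → FreeAlgebra K (Idx n) → Prop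
  | mk (a b : Idx n) : SqRel n
      (q • (FreeAlgebra.ι K a * FreeAlgebra.ι K b))
      ((q ^ phi a b * sg (pr a * pr b)) • (FreeAlgebra.ι K b * FreeAlgebra.ι K a)
        + (if a < b then xi else 0) • (FreeAlgebra.ι K a * FreeAlgebra.ι K b)
        + (if -a < b then xi * sg (pr b) else 0) •
            (FreeAlgebra.ι K (-a) * FreeAlgebra.ι K (-b)))

/-- The quantum supersymmetric algebra `S_q(V)`. -/
def Sq (n : ℕ) : Type := RingQuot (SqRel n)

instance Sq.instRing (n : ℕ) : Ring (Sq n) := inferInstanceAs (Ring (RingQuot (SqRel n)))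

instance Sq.instAlgebra (n : ℕ) : Algebra K (Sq n) :=
  inferInstanceAs (Algebra K (RingQuot (SqRel n)))

/-- The generator `v_a` of `S_q(V)`, of parity `|a|`. -/
def Sq.v {n : ℕ} (a : Idx n) : Sq n := RingQuot.mkAlgHom K (SqRel n) (FreeAlgebra.ι K a)

/-! ### Tensor products: super flip, middle exchange, hexagon composites -/

section Tensor

variable {V W X Y : Type} [AddCommGroup V] [AddCommGroup W] [AddCommGroup X] [AddCommGroup Y]
  [Module K V] [Module K W] [Module K X] [Module K Y]

/-- The super flip `v ⊗ w ↦ (-1)^{|v||w|} w ⊗ v`, where `pV` and `pW` are the parity involutions: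
the even part `(v + pV v)/2` passes `w` unchanged, the odd part `(v - pV v)/2` passes it with the
sign `(-1)^{|w|}`. -/
def superFlip (pV : V →ₗ[K] V) (pW : W →ₗ[K] W) : V ⊗[K] W →ₗ[K] W ⊗[K] V :=
  (TensorProduct.comm K V W).toLinearMap ∘ₗ
    (TensorProduct.map ((2⁻¹ : K) • (LinearMap.id + pV)) LinearMap.id +
      TensorProduct.map ((2⁻¹ : K) • (LinearMap.id - pV)) pW)

/-- `1 ⊗ θ ⊗ 1 : V ⊗ W ⊗ X ⊗ Y → V ⊗ X ⊗ W ⊗ Y`. -/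
def midMap (θ : W ⊗[K] X →ₗ[K] X ⊗[K] W) :
    (V ⊗[K] W) ⊗[K] (X ⊗[K] Y) →ₗ[K] (V ⊗[K] X) ⊗[K] (W ⊗[K] Y) :=
  (TensorProduct.assoc K V X (W ⊗[K] Y)).symm.toLinearMap ∘ₗ
    LinearMap.lTensor V
      ((TensorProduct.assoc K X W Y).toLinearMap ∘ₗ LinearMap.rTensor Y θ ∘ₗ
        (TensorProduct.assoc K W X Y).symm.toLinearMap) ∘ₗ
    (TensorProduct.assoc K V W (X ⊗[K] Y)).toLinearMap

/-- `(1 ⊗ θ') ∘ (θ ⊗ 1) : V ⊗ W ⊗ X → W ⊗ V ⊗ X → W ⊗ X ⊗ V`. -/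
def hexL (θ : V ⊗[K] W →ₗ[K] W ⊗[K] V) (θ' : V ⊗[K] X →ₗ[K] X ⊗[K] V) :
    V ⊗[K] (W ⊗[K] X) →ₗ[K] (W ⊗[K] X) ⊗[K] V :=
  (TensorProduct.assoc K W X V).symm.toLinearMap ∘ₗ LinearMap.lTensor W θ' ∘ₗ
    (TensorProduct.assoc K W V X).toLinearMap ∘ₗ LinearMap.rTensor X θ ∘ₗ
    (TensorProduct.assoc K V W X).symm.toLinearMap

/-- `(θ ⊗ 1) ∘ (1 ⊗ θ') : V ⊗ W ⊗ X → V ⊗ X ⊗ W → X ⊗ V ⊗ W`. -/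
def hexR (θ : V ⊗[K] X →ₗ[K] X ⊗[K] V) (θ' : W ⊗[K] X →ₗ[K] X ⊗[K] W) :
    (V ⊗[K] W) ⊗[K] X →ₗ[K] X ⊗[K] (V ⊗[K] W) :=
  (TensorProduct.assoc K X V W).toLinearMap ∘ₗ LinearMap.rTensor W θ ∘ₗ
    (TensorProduct.assoc K V X W).symm.toLinearMap ∘ₗ LinearMap.lTensor V θ' ∘ₗ
    (TensorProduct.assoc K V W X).toLinearMap

end Tensor

/-! ### Comultiplication and counit -/

/-- `Δ` is the comultiplication of `U_q(𝔮_n)`: a unital homomorphism into the super tensor product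
`U ⊗ U`, with `Δ(L) = L ⊗ L`, i.e.
`Δ(L_{ij}) = ∑_k (-1)^{(|i|+|k|)(|k|+|j|)} L_{ik} ⊗ L_{kj}`. -/
def IsComul (n : ℕ) (Δ : U n →ₗ[K] U n ⊗[K] U n) : Prop :=
  Δ 1 = 1 ⊗ₜ 1 ∧
  (∀ u v : U n, Δ (u * v) =
    TensorProduct.map (LinearMap.mul' K (U n)) (LinearMap.mul' K (U n))
      (midMap (superFlip (parU n).toLinearMap (parU n).toLinearMap) (Δ u ⊗ₜ Δ v))) ∧
  ∀ i j : Idx n, Δ (L i j) =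
    ∑ k : Idx n, sg ((pr i + pr k) * (pr k + pr j)) • (L i k ⊗ₜ[K] L k j)

/-- `ε` is the counit of `U_q(𝔮_n)`: `ε(L_{ij}) = δ_{ij}`. -/
def IsCounit (n : ℕ) (ε : U n →ₐ[K] K) : Prop :=
  ∀ i j : Idx n, ε (L i j) = if i = j then 1 else 0

/-! ### Supermodule superalgebras -/

/-- The data of a `U_q(𝔮_n)`-supermodule superalgebra: a vector space with a parity involution,
a unit, a multiplication and an action of `U_q(𝔮_n)`.  The axioms are in
`SMAlg.IsSupermoduleSuperalgebra`. -/
structure SMAlg (n : ℕ) where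
  carrier : Type
  [addCommGroup : AddCommGroup carrier]
  [module : Module K carrier]
  par : carrier →ₗ[K] carrier
  one : carrier
  mul : carrier ⊗[K] carrier →ₗ[K] carrier
  act : U n ⊗[K] carrier →ₗ[K] carrier

instance SMAlg.instCoeSort (n : ℕ) : CoeSort (SMAlg n) Type := ⟨SMAlg.carrier⟩

attribute [instance] SMAlg.addCommGroup SMAlg.module

variable {n : ℕ}

/-- The action on `B₁ ⊗ B₂` through `Δ`:
`u ⊗ (x ⊗ y) ↦ ∑ (-1)^{|u₂||x|} (u₁.x) ⊗ (u₂.y)`. -/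
def tensorAct (Δ : U n →ₗ[K] U n ⊗[K] U n) (B₁ B₂ : SMAlg n) :
    U n ⊗[K] (B₁ ⊗[K] B₂) →ₗ[K] B₁ ⊗[K] B₂ :=
  TensorProduct.map B₁.act B₂.act ∘ₗ midMap (superFlip (parU n).toLinearMap B₁.par) ∘ₗ
    LinearMap.rTensor (B₁ ⊗[K] B₂) Δ

/-- `B` is a unital associative superalgebra and a `U_q(𝔮_n)`-supermodule such that
`u.(ab) = ∑ (-1)^{|u₂||a|} (u₁.a)(u₂.b)` and `u.1 = ε(u) 1`. -/
structure SMAlg.IsSupermoduleSuperalgebra (Δ : U n →ₗ[K] U n ⊗[K] U n) (ε : U n →ₐ[K] K)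
    (B : SMAlg n) : Prop where
  par_par : ∀ a : B, B.par (B.par a) = a
  mul_assoc : ∀ a b c : B,
    B.mul (B.mul (a ⊗ₜ b) ⊗ₜ c) = B.mul (a ⊗ₜ B.mul (b ⊗ₜ c))
  one_mul : ∀ a : B, B.mul (B.one ⊗ₜ a) = a
  mul_one : ∀ a : B, B.mul (a ⊗ₜ B.one) = a
  par_one : B.par B.one = B.one
  par_mul : ∀ a b : B, B.par (B.mul (a ⊗ₜ b)) = B.mul (B.par a ⊗ₜ B.par b)
  one_act : ∀ a : B, B.act (1 ⊗ₜ a) = a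
  mul_act : ∀ (u v : U n) (a : B), B.act ((u * v) ⊗ₜ a) = B.act (u ⊗ₜ B.act (v ⊗ₜ a))
  par_act : ∀ (u : U n) (a : B), B.par (B.act (u ⊗ₜ a)) = B.act (parU n u ⊗ₜ B.par a)
  act_mul : ∀ (u : U n) (a b : B),
    B.act (u ⊗ₜ B.mul (a ⊗ₜ b)) = B.mul (tensorAct Δ B B (u ⊗ₜ (a ⊗ₜ b)))
  act_one : ∀ u : U n, B.act (u ⊗ₜ B.one) = ε u • B.one

/-- A linear map is a homomorphism of `U_q(𝔮_n)`-supermodule superalgebras. -/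
structure SMAlg.IsHom {B C : SMAlg n} (f : B →ₗ[K] C) : Prop where
  map_one : f B.one = C.one
  map_mul : ∀ a b : B, f (B.mul (a ⊗ₜ b)) = C.mul (f a ⊗ₜ f b)
  map_par : ∀ a : B, f (B.par a) = C.par (f a)
  map_act : ∀ (u : U n) (a : B), f (B.act (u ⊗ₜ a)) = C.act (u ⊗ₜ f a)

/-- A braiding operator `θ : B₂ ⊗ B₁ → B₁ ⊗ B₂`: a homomorphism of `U_q(𝔮_n)`-supermodules that
is compatible with the two multiplications (the two commutative diagrams) and with the units. -/
structure IsBraidingOp (Δ : U n →ₗ[K] U n ⊗[K] U n) (B₁ B₂ : SMAlg n)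
    (θ : B₂ ⊗[K] B₁ →ₗ[K] B₁ ⊗[K] B₂) : Prop where
  par_comm : θ ∘ₗ TensorProduct.map B₂.par B₁.par = TensorProduct.map B₁.par B₂.par ∘ₗ θ
  act_comm : θ ∘ₗ tensorAct Δ B₂ B₁ = tensorAct Δ B₁ B₂ ∘ₗ LinearMap.lTensor (U n) θ
  mul_left : θ ∘ₗ LinearMap.lTensor B₂ B₁.mul = LinearMap.rTensor B₂ B₁.mul ∘ₗ hexL θ θ
  mul_right : θ ∘ₗ LinearMap.rTensor B₁ B₂.mul = LinearMap.lTensor B₁ B₂.mul ∘ₗ hexR θ θ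
  one_left : ∀ x : B₁, θ (B₂.one ⊗ₜ x) = x ⊗ₜ B₂.one
  one_right : ∀ y : B₂, θ (y ⊗ₜ B₁.one) = B₁.one ⊗ₜ y

/-- The braided tensor product `B₁ ⊗ B₂` with respect to `θ : B₂ ⊗ B₁ → B₁ ⊗ B₂`; its
multiplication is `(mul ⊗ mul) ∘ (1 ⊗ θ ⊗ 1)`. -/
abbrev braided (Δ : U n →ₗ[K] U n ⊗[K] U n) (B₁ B₂ : SMAlg n)
    (θ : B₂ ⊗[K] B₁ →ₗ[K] B₁ ⊗[K] B₂) : SMAlg n where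
  carrier := B₁ ⊗[K] B₂
  par := TensorProduct.map B₁.par B₂.par
  one := B₁.one ⊗ₜ B₂.one
  mul := TensorProduct.map B₁.mul B₂.mul ∘ₗ midMap θ
  act := tensorAct Δ B₁ B₂

/-- The iterated braided tensor product `((B ⊗ B) ⊗ ⋯) ⊗ B` of `m + 1` copies of `B`, together
with the braiding operator that moves a further copy of `B` from its left to its right, one tensor
factor at a time. -/
def braidedPow (Δ : U n →ₗ[K] U n ⊗[K] U n) (B : SMAlg n) (θ : B ⊗[K] B →ₗ[K] B ⊗[K] B) :
    ℕ → (C : SMAlg n) × (B ⊗[K] C →ₗ[K] C ⊗[K] B)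
  | 0 => ⟨B, θ⟩
  | m + 1 =>
    ⟨braided Δ (braidedPow Δ B θ m).1 B (braidedPow Δ B θ m).2,
      hexL (braidedPow Δ B θ m).2 θ⟩

/-! ### The action on `A_{r,n}` and the operators `Θ` -/

/-- `A_{r,n}` with a given action map. -/
abbrev coord (r : ℕ) (Φ : U n ⊗[K] A r n →ₗ[K] A r n) : SMAlg n where
  carrier := A r n
  par := (parA r n).toLinearMap
  one := 1
  mul := LinearMap.mul' K (A r n)
  act := Φ

/-- `Φ` is the action of `U_q(𝔮_n)` on `A_{r,n}`: it makes `A_{r,n}` a supermodule superalgebra, and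
`L^{[2]3} · T^{1[2]} = T^{1[2]} S^{13}`; the coefficients of `E_{ic} ⊗ - ⊗ E_{ab}` are compared,
where the left side is `∑ (-1)^{(|a|+|b|)(|i|+|c|)} E_{ic} ⊗ Φ_{L_{ab}}(t_{ic}) ⊗ E_{ab}`. -/
def IsCoordAction (Δ : U n →ₗ[K] U n ⊗[K] U n) (ε : U n →ₐ[K] K) (r : ℕ)
    (Φ : U n ⊗[K] A r n →ₗ[K] A r n) : Prop :=
  (coord r Φ).IsSupermoduleSuperalgebra Δ ε ∧
  ∀ (i : Idx r) (a b c : Idx n),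
    sg ((pr a + pr b) * (pr i + pr c)) • Φ (L a b ⊗ₜ t i c) =
      ∑ d : Idx n, (sg ((pr i + pr d) * (pr d + pr c)) * S d c a b) • (t i d : A r n)

/-- `θ : A_{k,n} ⊗ A_{r,n} → A_{r,n} ⊗ A_{k,n}` is the braiding operator `Θ`, normalised by
`Θ(T_k^{1[3]} T_r^{2[4]}) = T_r^{2[3]} T_k^{1[4]} S^{12}`; the coefficients of
`E_{jb} ⊗ E_{ia}` are compared, `j = 1, …, k` and `i = 1, …, r`, where
`T_k^{1[3]} T_r^{2[4]} = ∑ (-1)^{|t_{jb}| |E_{ia}|} E_{jb} ⊗ E_{ia} ⊗ t_{jb} ⊗ t_{ia}` and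
`T_r^{2[3]} T_k^{1[4]} = ∑ E_{jc} ⊗ E_{id} ⊗ t_{id} ⊗ t_{jc}`. -/
def IsTheta (Δ : U n →ₗ[K] U n ⊗[K] U n) (Φ : ∀ r : ℕ, U n ⊗[K] A r n →ₗ[K] A r n) (k r : ℕ)
    (θ : A k n ⊗[K] A r n →ₗ[K] A r n ⊗[K] A k n) : Prop :=
  IsBraidingOp Δ (coord r (Φ r)) (coord k (Φ k)) θ ∧
  ∀ (j : Idx k) (i : Idx r), 0 < j.1 → 0 < i.1 → ∀ b a : Idx n,
    sg ((pr j + pr b) * (pr i + pr a)) • θ (t j b ⊗ₜ t i a) =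
      ∑ c : Idx n, ∑ d : Idx n,
        (sg ((pr i + pr d) * (pr c + pr b)) * S c b d a) • (t i d ⊗ₜ[K] t j c)

/-- The index `1` of `I_{1|1}`. -/
def idxOne : Idx 1 := ⟨1, by decide⟩

end QueerBraid

end

open QueerBraid

open scoped TensorProduct

namespace QueerBraid

noncomputable section

/-! ### Signs, indices and the braid operator attached to `S` -/

section

/-! The super signs can be absorbed once and for all. The matrix `S`, composed with a suitable
signed flip, becomes an operator `R` on pairs of indices. It satisfies the braid relation
(`R_braid`) and the Hecke relation R² = ξR + 1 (`sum_R_smul_hecke`), both finite checks over signs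
and relative orders of the indices.

In terms of `R`, the algebra A_{r,n} is generated by its positive rows. Taken in decreasing order,
they satisfy c t_{ja} t_{ib} = ∑ R t_{id} t_{jc} for row positions i ≤ j, with c = q if i = j and c
= 1 otherwise (`tp_relation`, `exists_lift`). For r = 1 this is the presentation of S_q(V). On the
other side, a supermodule with parity operator P is the same as a triangular matrix Λ_{ab} = P^{|b|}
L_{ab} satisfying a sign-free relation RΛΛ = ΛΛR (`IsFRT`), and the comultiplication becomes the
ordinary matrix product (`IsFRT.tensor`).

Existence statements then reduce to giving algebra homomorphisms on generators. The action on
A_{r,n} is a homomorphism into matrices over A_{r,n}, and the relation to check is the braid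
relation. The operator Θ is defined for every module M in the first factor: moving y past t_{ia}
produces ∑ t_{id} ⊗ Λ_{da} y (`IsTransport`). This is a homomorphism into A ⊗ End(M)^op, and the
relation to check is RΛΛ = ΛΛR. The recursion determines Θ, so its uniqueness, the hexagons,
equivariance and naturality follow by induction on words.

For the factorization, split the rows of A_{r+k,n} into the first r and the last k. The relations
between the two blocks say exactly that g(y) f(x) is the product of the two factors of Θ(y ⊗ x)
(`natAdd_mul_castAdd`), so multiplication A_{r,n} ⊗ A_{k,n} → A_{r+k,n} is a homomorphism from the
braided tensor product. Conversely the braided product satisfies the defining relations of A_{r+k,n}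
(`braided_relation`), which yields the inverse without any basis theorem (`exists_mulMap_inverse`).
Iterated powers follow by induction, and the ordinary associativity isomorphism is checked to be a
homomorphism (`SMAlg.isHom_assoc`). -/

theorem q_ne_zero : q ≠ 0 := RatFunc.X_ne_zero

theorem Idx.ext_iff' {n : ℕ} (a b : Idx n) : a = b ↔ a.1 = b.1 := Subtype.ext_iff

theorem Idx.coe_neg {n : ℕ} (a : Idx n) : (-a).1 = -a.1 := rfl

theorem Idx.neg_neg {n : ℕ} (a : Idx n) : -(-a) = a := by
  rw [Idx.ext_iff', Idx.coe_neg, Idx.coe_neg, _root_.neg_neg]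

theorem Idx.ne_zero {n : ℕ} (a : Idx n) : a.1 ≠ 0 := (Finset.mem_erase.1 a.2).1

theorem Idx.neg_inj {n : ℕ} (a b : Idx n) : -a = -b ↔ a = b := by
  rw [Idx.ext_iff', Idx.ext_iff', Idx.coe_neg, Idx.coe_neg, _root_.neg_inj]

theorem Idx.eq_neg_comm {n : ℕ} (a b : Idx n) : a = -b ↔ -a = b := by
  rw [← Idx.neg_inj a, Idx.neg_neg]

/-- The involution `a ↦ -a` of the index set. -/
def Idx.negEquiv (n : ℕ) : Idx n ≃ Idx n := ⟨fun a => -a, fun a => -a, Idx.neg_neg, Idx.neg_neg⟩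

theorem sum_neg {n : ℕ} {M : Type*} [AddCommMonoid M] (f : Idx n → M) :
    ∑ a, f (-a) = ∑ a, f a := (Idx.negEquiv n).sum_comp f

/-- The coefficient of `e_d ⊗ e_c` in the image of `e_a ⊗ e_b` under the braid operator
attached to `S`. -/
def R {n : ℕ} (a b d c : Idx n) : K :=
  sg (pr a * pr b) * sg (pr d * (pr c + pr a)) * S c a d b

theorem pr_of_pos {n : ℕ} {a : Idx n} (h : 0 < a.1) : pr a = 0 := if_pos h

theorem pr_neg_of_pos {n : ℕ} {a : Idx n} (h : 0 < a.1) : pr (-a) = 1 :=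
  if_neg (by rw [Idx.coe_neg]; omega)

theorem Idx.pos_or {n : ℕ} (a : Idx n) : 0 < a.1 ∨ ∃ b : Idx n, 0 < b.1 ∧ a = -b := by
  have := a.ne_zero
  rcases lt_or_gt_of_ne this with h | h
  · exact Or.inr ⟨-a, by rw [Idx.coe_neg]; omega, (Idx.neg_neg a).symm⟩
  · exact Or.inl h

theorem sg_zero : sg 0 = 1 := pow_zero _
theorem sg_one : sg 1 = -1 := pow_one _

theorem sg_cases (m : ℕ) : sg m = 1 ∨ sg m = -1 := neg_one_pow_eq_or K m

theorem pr_cases {n : ℕ} (a : Idx n) : pr a = 0 ∨ pr a = 1 := by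
  unfold pr; split_ifs <;> simp

/-- The three kinds of terms of `S` give a swap, an identity and a double negation. The signs in `R`
are such that the identity term carries none. -/
theorem R_eq {n : ℕ} (a b d c : Idx n) : R a b d c =
    (if d = b ∧ c = a then sg (pr a * pr b) * q ^ phi a b else 0) +
    (if d = a ∧ c = b then if a < b then xi else 0 else 0) +
    (if d = -a ∧ c = -b then if -a < b then xi * sg (pr b) else 0 else 0) := by
  have c1 : (c = a ∧ d = b) ↔ (d = b ∧ c = a) := and_comm
  have c2 : (c = b ∧ a = d) ↔ (d = a ∧ c = b) := by rw [and_comm, eq_comm (a := a)]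
  have c3 : (c = -b ∧ a = -d) ↔ (d = -a ∧ c = -b) := by
    rw [and_comm, Idx.eq_neg_comm a d, eq_comm (a := -a)]
  have e1 : (if d = b ∧ c = a then sg (pr a * pr b) * q ^ phi a b else 0) =
      sg (pr a * pr b) * sg (pr d * (pr c + pr a)) *
        if d = b ∧ c = a then q ^ phi c d else 0 := by
    split_ifs with h
    · obtain ⟨h1, h2⟩ := h
      subst h1 h2
      rcases pr_cases c with h | h <;> rcases pr_cases d with h' | h' <;> simp [h, h', sg]
    · simp
  have e2 : (if d = a ∧ c = b then if a < b then xi else 0 else 0) =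
      sg (pr a * pr b) * sg (pr d * (pr c + pr a)) *
        if d < b then xi * sg (pr d) * if d = a ∧ c = b then 1 else 0 else 0 := by
    split_ifs with h h1 h2 h2
    · obtain ⟨h1, h2⟩ := h
      subst h1 h2
      rcases pr_cases c with h | h <;> rcases pr_cases d with h' | h' <;> simp [h, h', sg]
    · exact absurd (h.1 ▸ h1) h2
    · exact absurd (h.1 ▸ h2) h1
    all_goals simp
  have e3 : (if d = -a ∧ c = -b then if -a < b then xi * sg (pr b) else 0 else 0) =
      sg (pr a * pr b) * sg (pr d * (pr c + pr a)) *
        if d < b then xi * sg (pr d) * if d = -a ∧ c = -b then 1 else 0 else 0 := by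
    split_ifs with h h1 h2 h2
    · obtain ⟨g1, g2⟩ := h
      subst g1 g2
      rcases a.pos_or with ha | ⟨a, ha, rfl⟩ <;> rcases b.pos_or with hb | ⟨b, hb, rfl⟩ <;>
        simp [pr_of_pos, pr_neg_of_pos, ha, hb, Idx.neg_neg, sg]
    · exact absurd (h.1 ▸ h1) h2
    · exact absurd (h.1 ▸ h2) h1
    all_goals simp
  rw [e1, e2, e3]
  unfold R S
  simp only [c1, c2, c3]
  split_ifs <;> ring

/-- With `F d c` equal to v_d v_c, this is the right side of the relation of S_q(V). -/
theorem sum_R_smul {n : ℕ} {M : Type*} [AddCommGroup M] [Module K M] (a b : Idx n)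
    (F : Idx n → Idx n → M) :
    ∑ d, ∑ c, R a b d c • F d c = (sg (pr a * pr b) * q ^ phi a b) • F b a +
      (if a < b then xi else 0) • F a b +
      (if -a < b then xi * sg (pr b) else 0) • F (-a) (-b) := by
  simp only [R_eq, add_smul, Finset.sum_add_distrib, ite_and, ite_smul, zero_smul,
    Finset.sum_ite_eq', Finset.mem_univ, if_true, Finset.sum_ite_irrel, Finset.sum_const_zero]

end

/-! ### The Hecke and braid relations -/

section

theorem q_zpow_phi {n : ℕ} (a b : Idx n) : q ^ phi a b =
    if a = b ∨ a = -b then (if pr b = 0 then q else q⁻¹) else 1 := by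
  have h : ¬ (a = b ∧ a = -b) := by
    rintro ⟨rfl, h⟩
    have := a.ne_zero
    rw [Idx.ext_iff', Idx.coe_neg] at h
    omega
  unfold phi
  rcases pr_cases b with hb | hb <;> by_cases h1 : a = b <;> by_cases h2 : a = -b <;>
    simp_all

/-! ### The braid operator on pairs of signed indices over a commutative ring. -/

section
variable {k : Type*} [CommRing k] (q u : k)

/-- The value of a function of two indices on the image of `e_a ⊗ e_b` under the braid
operator, over any ring with a pair of mutually inverse elements `q` and `u`. -/
def braidApply {n : ℕ} (F : Idx n → Idx n → k) (a b : Idx n) : k :=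
  (-1) ^ (pr a * pr b) * (if a = b ∨ a = -b then (if pr b = 0 then q else u) else 1) * F b a +
    (if a < b then q - u else 0) * F a b +
    (if -a < b then (q - u) * (-1) ^ pr b else 0) * F (-a) (-b)

theorem Idx.lt_iff' {n : ℕ} {a b : Idx n} : a < b ↔ a.1 < b.1 := Iff.rfl

theorem Idx.neg_lt_neg' {n : ℕ} {a b : Idx n} : -a < -b ↔ b < a := by
  rw [Idx.lt_iff', Idx.lt_iff', Idx.coe_neg, Idx.coe_neg]; omega

variable {n : ℕ} {a b : Idx n} (F : Idx n → Idx n → k)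

/-- Once each index is written as plus or minus a positive one, every comparison in `braidApply` is
either decided by the signs or is a comparison of absolute values. The four sign patterns are
recorded separately. -/
theorem braidApply_pos_pos (ha : 0 < a.1) (hb : 0 < b.1) : braidApply q u F a b =
    (if a = b then q else 1) * F b a + (if a < b then q - u else 0) * F a b +
      (q - u) * F (-a) (-b) := by
  have h1 : -a < b := by rw [Idx.lt_iff', Idx.coe_neg]; omega
  have h2 : a ≠ -b := by rw [Ne, Idx.ext_iff', Idx.coe_neg]; omega
  simp [braidApply, pr_of_pos ha, pr_of_pos hb, h1, h2]

theorem braidApply_neg_pos (ha : 0 < a.1) (hb : 0 < b.1) : braidApply q u F (-a) b =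
    (if a = b then q else 1) * F b (-a) + (q - u) * F (-a) b +
      (if a < b then q - u else 0) * F a (-b) := by
  have h1 : -a < b := by rw [Idx.lt_iff', Idx.coe_neg]; omega
  have h2 : -a ≠ b := by rw [Ne, Idx.ext_iff', Idx.coe_neg]; omega
  simp [braidApply, pr_neg_of_pos ha, pr_of_pos hb, h1, h2, Idx.neg_neg, Idx.neg_inj]

theorem braidApply_pos_neg (ha : 0 < a.1) (hb : 0 < b.1) : braidApply q u F a (-b) =
    (if a = b then u else 1) * F (-b) a - (if b < a then q - u else 0) * F (-a) b := by
  have h1 : ¬ a < -b := by rw [Idx.lt_iff', Idx.coe_neg]; omega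
  have h2 : a ≠ -b := by rw [Ne, Idx.ext_iff', Idx.coe_neg]; omega
  simp only [braidApply, pr_neg_of_pos hb, pr_of_pos ha, h1, h2, one_ne_zero, if_false,
    Idx.neg_neg, Idx.neg_lt_neg', false_or]
  split_ifs <;> ring

theorem braidApply_neg_neg (ha : 0 < a.1) (hb : 0 < b.1) : braidApply q u F (-a) (-b) =
    -(if a = b then u else 1) * F (-b) (-a) + (if b < a then q - u else 0) * F (-a) (-b) := by
  have h1 : ¬ a < -b := by rw [Idx.lt_iff', Idx.coe_neg]; omega
  have h2 : -a ≠ b := by rw [Ne, Idx.ext_iff', Idx.coe_neg]; omega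
  simp only [braidApply, pr_neg_of_pos hb, pr_neg_of_pos ha, h1, h2, one_ne_zero, if_false,
    Idx.neg_neg, Idx.neg_lt_neg', Idx.neg_inj, or_false]
  split_ifs <;> ring

end

/-- Each branch lists every order fact about the pair, so that simplification decides all
conditionals. The final `True` only keeps the three branches of equal shape. -/
theorem order_cases {α : Type*} [LinearOrder α] (x y : α) :
    (x < y ∧ ¬ y < x ∧ x ≠ y ∧ y ≠ x) ∨ (y < x ∧ ¬ x < y ∧ x ≠ y ∧ y ≠ x) ∨
      (x = y ∧ ¬ x < y ∧ ¬ y < x ∧ True) := by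
  rcases lt_trichotomy x y with h | h | h
  · exact Or.inl ⟨h, h.not_gt, h.ne, h.ne'⟩
  · exact Or.inr (Or.inr ⟨h, h.not_lt, h.not_gt, trivial⟩)
  · exact Or.inr (Or.inl ⟨h, h.not_gt, h.ne', h.ne⟩)

theorem Idx.exists_pos {n : ℕ} (a : Idx n) : ∃ b : Idx n, 0 < b.1 ∧ (a = b ∨ a = -b) := by
  rcases a.pos_or with h | ⟨b, h, rfl⟩
  · exact ⟨a, h, Or.inl rfl⟩
  · exact ⟨b, h, Or.inr rfl⟩

-- Only the relative order of the three absolute values and the three signs matter. In each of the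
-- finitely many configurations the claim is a polynomial identity in q and u modulo qu = 1. Working
-- with an indeterminate inverse `u` avoids field arithmetic.
set_option maxHeartbeats 4000000 in
theorem braidApply_braid {k : Type*} [CommRing k] {q u : k} (hq : q * u = 1) {n : ℕ}
    (F : Idx n → Idx n → Idx n → k) (a b c : Idx n) :
    braidApply q u (fun a b => braidApply q u (fun b c => braidApply q u
        (fun a b => F a b c) a b) b c) a b =
      braidApply q u (fun b c => braidApply q u (fun a b => braidApply q u
        (fun b c => F a b c) b c) a b) b c := by
  obtain ⟨a', ha, ea⟩ := a.exists_pos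
  obtain ⟨b', hb, eb⟩ := b.exists_pos
  obtain ⟨c', hc, ec⟩ := c.exists_pos
  rcases order_cases a' b' with ⟨h1, h2, h3, h4⟩ | ⟨h1, h2, h3, h4⟩ | ⟨h1, h2, h3, h4⟩ <;>
  rcases order_cases b' c' with ⟨k1, k2, k3, k4⟩ | ⟨k1, k2, k3, k4⟩ | ⟨k1, k2, k3, k4⟩ <;>
  rcases order_cases a' c' with ⟨l1, l2, l3, l4⟩ | ⟨l1, l2, l3, l4⟩ | ⟨l1, l2, l3, l4⟩ <;>
  first
  -- The three pairwise comparisons are chosen independently, so intransitive combinations have to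
  -- be discarded.
  | (exfalso; clear ha hb hc ea eb ec; order)
  | (rcases ea with rfl | rfl <;> rcases eb with rfl | rfl <;> rcases ec with rfl | rfl <;>
      simp only [braidApply_pos_pos, braidApply_pos_neg, braidApply_neg_pos, braidApply_neg_neg,
        ha, hb, hc, h1, h2, h3, h4, k1, k2, k3, k4, l1, l2, l3, l4, lt_irrefl, if_true,
        if_false] <;>
      first
      | ring1
      | (clear h1 h2 h3 h4 k1 k2 k3 k4 l1 l2 l3 l4 ha hb hc
         grind))

theorem braidApply_hecke {k : Type*} [CommRing k] {q u : k} (hq : q * u = 1) {n : ℕ}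
    (F : Idx n → Idx n → k) (a b : Idx n) :
    braidApply q u (braidApply q u F) a b = (q - u) * braidApply q u F a b + F a b := by
  rcases a.pos_or with ha | ⟨a, ha, rfl⟩ <;> rcases b.pos_or with hb | ⟨b, hb, rfl⟩ <;>
  rcases order_cases a b with ⟨h1, h2, h3, h4⟩ | ⟨h1, h2, h3, h4⟩ | ⟨h1, h2, h3, h4⟩ <;>
  (simp only [braidApply_pos_pos, braidApply_pos_neg, braidApply_neg_pos, braidApply_neg_neg,
      ha, hb, h1, h2, h3, h4, lt_irrefl, if_true, if_false]
   first | ring1 | (clear h1 h2 h3 h4 ha hb; grind))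

theorem sum_R_mul {n : ℕ} (a b : Idx n) (F : Idx n → Idx n → K) :
    ∑ d, ∑ c, R a b d c * F d c = braidApply q q⁻¹ F a b := by
  rw [braidApply, ← q_zpow_phi]
  exact sum_R_smul a b F

end

/-! ### The braid relation in coordinates -/

section

/-- Matrix entries are extracted from `braidApply_braid` by taking for F the indicator function of
one triple of indices. -/
theorem R_braid {n : ℕ} (a b s p g f : Idx n) :
    ∑ d, ∑ c, ∑ m, R a b d c * R c s m f * R d m p g =
      ∑ m, ∑ y, ∑ x, R b s m y * R a m p x * R x y g f := by
  have h := braidApply_braid (mul_inv_cancel₀ q_ne_zero)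
    (fun p' g' f' => if p' = p then if g' = g then if f' = f then (1 : K) else 0 else 0 else 0) a b s
  simp only [← sum_R_mul] at h
  simp only [mul_ite, mul_one, mul_zero, Finset.sum_ite_eq', Finset.sum_ite_irrel,
    Finset.mem_univ, if_true, Finset.sum_const_zero, Finset.mul_sum] at h
  simp only [← mul_assoc] at h
  exact h

theorem R_even {n : ℕ} (a b d c : Idx n) :
    sg (pr d + pr c) * R a b d c = sg (pr a + pr b) * R a b d c := by
  have := S_even c a d b
  unfold R
  rw [add_comm (pr d)]
  linear_combination -(sg (pr a * pr b) * sg (pr d * (pr c + pr a))) * this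

/-- The second tensor factor of `S` is upper triangular; this is what makes L_{ij} with i > j act by
zero. -/
theorem R_eq_zero_of_lt {n : ℕ} {e j i f : Idx n} (h : j < i) : R e j i f = 0 := by
  unfold R S
  rw [if_neg h.not_gt, if_neg fun h' => h.ne' h'.2]
  simp

theorem R_diag {n : ℕ} (e i f : Idx n) :
    R e i i f = if f = e then sg (pr e * pr i) * q ^ phi e i else 0 := by
  unfold R S
  rw [if_neg (lt_irrefl i), add_zero]
  by_cases h : f = e
  · subst h
    rw [if_pos ⟨rfl, rfl⟩, if_pos rfl]
    rcases pr_cases f with h | h <;> rcases pr_cases i with h' | h' <;> simp [h, h', sg]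
  · rw [if_neg fun h' => h h'.1, if_neg h, mul_zero]

theorem phi_neg_right {n : ℕ} (e i : Idx n) : phi e (-i) = -phi e i := by
  unfold phi
  rw [Idx.neg_neg, add_comm (if e = -i then (1 : ℤ) else 0)]
  rcases i.pos_or with h | ⟨i, h, rfl⟩
  · rw [pr_neg_of_pos h, pr_of_pos h]; ring
  · rw [Idx.neg_neg, pr_neg_of_pos h, pr_of_pos h]; ring

/-- Replacing i by -i inverts the power of q and leaves only the parity sign of e. Hence, in the
sign-free form, L_{ii} L_{-i,-i} = 1 becomes the condition that the diagonal entries multiply to the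
parity operator. -/
theorem R_diag_mul_R_diag_neg {n : ℕ} (e i : Idx n) :
    (sg (pr e * pr i) * q ^ phi e i) * (sg (pr e * pr (-i)) * q ^ phi e (-i)) = sg (pr e) := by
  rw [phi_neg_right, zpow_neg, mul_mul_mul_comm, mul_inv_cancel₀ (zpow_ne_zero _ q_ne_zero),
    mul_one]
  rcases i.pos_or with h | ⟨i, h, rfl⟩
  · rw [pr_neg_of_pos h, pr_of_pos h]; simp [sg]
  · rw [Idx.neg_neg, pr_neg_of_pos h, pr_of_pos h]; simp [sg]

/-- The transpose of `sum_R_smul`: here the input pair of `R` is summed. This is how `S` acts on the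
row indices in S T T = T T S. -/
theorem sum_R_smul_left {n : ℕ} {M : Type*} [AddCommGroup M] [Module K M] (i j : Idx n)
    (F : Idx n → Idx n → M) :
    ∑ k, ∑ l, R k l j i • F k l = (sg (pr i * pr j) * q ^ phi i j) • F i j +
      (if j < i then xi else 0) • F j i +
      (if j < -i then xi * sg (pr (-i)) else 0) • F (-j) (-i) := by
  have c2 : ∀ k l : Idx n, (j = l ∧ i = k) ↔ (k = i ∧ l = j) := fun k l => by
    rw [and_comm, eq_comm, eq_comm (a := j)]
  have c4 : ∀ k l : Idx n, (j = -k ∧ i = -l) ↔ (k = -j ∧ l = -i) := fun k l => by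
    rw [Idx.eq_neg_comm, Idx.eq_neg_comm i, eq_comm, eq_comm (a := -i)]
  simp only [R_eq, c4]
  simp only [c2, add_smul, Finset.sum_add_distrib, ite_and, ite_smul, zero_smul,
    Finset.sum_ite_eq', Finset.mem_univ, if_true, Finset.sum_ite_irrel, Finset.sum_const_zero,
    Idx.neg_neg]

theorem sum_comm_pairs {α β γ δ M : Type*} [Fintype α] [Fintype β] [Fintype γ] [Fintype δ]
    [AddCommMonoid M] (f : α → β → γ → δ → M) :
    ∑ a, ∑ b, ∑ c, ∑ d, f a b c d = ∑ c, ∑ d, ∑ a, ∑ b, f a b c d := by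
  have h : ∀ a, ∑ b, ∑ c, ∑ d, f a b c d = ∑ c, ∑ d, ∑ b, f a b c d := fun a => by
    rw [Finset.sum_comm]
    exact Finset.sum_congr rfl fun c _ => Finset.sum_comm
  rw [Finset.sum_congr rfl fun a _ => h a, Finset.sum_comm]
  exact Finset.sum_congr rfl fun c _ => Finset.sum_comm

theorem sum_R_smul_hecke {n : ℕ} {M : Type*} [AddCommGroup M] [Module K M] (a b : Idx n)
    (F : Idx n → Idx n → M) :
    ∑ d, ∑ c, R a b d c • ∑ d', ∑ c', R d c d' c' • F d' c' =
      xi • ∑ d, ∑ c, R a b d c • F d c + F a b := by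
  -- The Hecke relation, evaluated on an indicator function, gives the entries of R². Linearity then
  -- gives the statement for vectors of any module.
  have key : ∀ d' c' : Idx n, ∑ d, ∑ c, R a b d c * R d c d' c' =
      xi * R a b d' c' + if d' = a then if c' = b then 1 else 0 else 0 := by
    intro d' c'
    have h := braidApply_hecke (mul_inv_cancel₀ q_ne_zero)
      (fun d c => if d = d' then if c = c' then (1 : K) else 0 else 0) a b
    rw [← sum_R_mul] at h
    simp only [← sum_R_mul] at h
    simp only [mul_ite, mul_one, mul_zero, Finset.sum_ite_eq', Finset.sum_ite_irrel,
      Finset.mem_univ, if_true, Finset.sum_const_zero] at h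
    rw [h]
    simp only [xi, eq_comm (a := a), eq_comm (a := b)]
  have h2 : ∑ d, ∑ c, R a b d c • ∑ d', ∑ c', R d c d' c' • F d' c' =
      ∑ d', ∑ c', (∑ d, ∑ c, R a b d c * R d c d' c') • F d' c' := by
    simp only [Finset.smul_sum, smul_smul, Finset.sum_smul]
    exact sum_comm_pairs _
  rw [h2]
  simp only [key, add_smul, Finset.sum_add_distrib, ite_smul, one_smul, zero_smul,
    Finset.sum_ite_eq', Finset.sum_ite_irrel, Finset.sum_const_zero, Finset.mem_univ, if_true,
    Finset.smul_sum, smul_smul]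

end

/-! ### Presentation of `A_{r,n}` by the generators with positive row index -/

section

/-- The positive indices of `I_{r|r}` in decreasing order. -/
def posIdx {r : ℕ} (i : Fin r) : Idx r :=
  ⟨(r : ℤ) - (i.1 : ℤ), by
    have := i.2
    simp only [Finset.mem_erase, Finset.mem_Icc, ne_eq]
    omega⟩

theorem posIdx_pos {r : ℕ} (i : Fin r) : 0 < (posIdx i).1 := by
  have := i.2
  simp only [posIdx]
  omega

theorem exists_posIdx {r : ℕ} {a : Idx r} (h : 0 < a.1) : ∃ i : Fin r, posIdx i = a := by
  have := a.2
  simp only [Finset.mem_erase, Finset.mem_Icc, ne_eq] at this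
  refine ⟨⟨((r : ℤ) - a.1).toNat, by omega⟩, Subtype.ext ?_⟩
  simp only [posIdx]
  omega

theorem posIdx_le_iff {r : ℕ} (i j : Fin r) : posIdx i ≤ posIdx j ↔ j ≤ i := by
  rw [← Subtype.coe_le_coe]
  simp only [posIdx, Fin.le_def]
  omega

theorem posIdx_injective {r : ℕ} : Function.Injective (posIdx (r := r)) := fun i j h =>
  le_antisymm ((posIdx_le_iff j i).1 h.ge) ((posIdx_le_iff i j).1 h.le)

/-- The coefficient relation of `E_{ia} ⊗ E_{jb}` in `S T T = T T S`, written with the braid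
operator on both sides. -/
def RTT {r n : ℕ} {B : Type*} [Ring B] [Algebra K B] (x : Idx r → Idx n → B) (i j : Idx r)
    (a b : Idx n) : Prop :=
  ∑ k, ∑ l, R k l j i • (sg (pr k * (pr b + pr l) + pr i * pr j) • (x k a * x l b)) =
    ∑ d, ∑ c, R a b d c • (sg (pr j * pr c) • (x j d * x i c))

section
variable {r n : ℕ} {B : Type*} [Ring B] [Algebra K B]

/-- The two sides of the coefficient relation differ from those of `RTT` by one common sign, which
does not depend on the summation indices and can be cancelled. -/
theorem RTT_iff (x : Idx r → Idx n → B) (i j : Idx r) (a b : Idx n) :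
    RTT x i j a b ↔
      ∑ k : Idx r, ∑ l : Idx r,
        (sg ((pr j + pr l) * (pr k + pr a)) * sg ((pr k + pr a) * (pr l + pr b)) * S i k j l) •
          (x k a * x l b) =
      ∑ c : Idx n, ∑ d : Idx n,
        (sg ((pr j + pr d) * (pr c + pr a)) * S c a d b) • (x j d * x i c) := by
  have h1 : ∀ k l : Idx r,
      (sg ((pr j + pr l) * (pr k + pr a)) * sg ((pr k + pr a) * (pr l + pr b)) * S i k j l) •
          (x k a * x l b) = sg (pr a * pr b + pr a * pr j) •
        (R k l j i • (sg (pr k * (pr b + pr l) + pr i * pr j) • (x k a * x l b))) := by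
    intro k l
    rw [smul_smul, smul_smul]
    congr 1
    unfold R
    rcases pr_cases i with hi | hi <;> rcases pr_cases j with hj | hj <;>
    rcases pr_cases k with hk | hk <;> rcases pr_cases l with hl | hl <;>
    rcases pr_cases a with ha | ha <;> rcases pr_cases b with hb | hb <;>
    simp [hi, hj, hk, hl, ha, hb, sg] <;> ring
  have h2 : ∀ c d : Idx n, (sg ((pr j + pr d) * (pr c + pr a)) * S c a d b) • (x j d * x i c) =
      sg (pr a * pr b + pr a * pr j) • (R a b d c • (sg (pr j * pr c) • (x j d * x i c))) := by
    intro c d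
    rw [smul_smul, smul_smul]
    congr 1
    unfold R
    rcases pr_cases j with hj | hj <;> rcases pr_cases c with hk | hk <;>
    rcases pr_cases d with hl | hl <;>
    rcases pr_cases a with ha | ha <;> rcases pr_cases b with hb | hb <;>
    simp [hj, hk, hl, ha, hb, sg] <;> ring
  have h3 : sg (pr a * pr b + pr a * pr j) ≠ 0 := fun h => by
    have := sg_mul_self (pr a * pr b + pr a * pr j)
    rw [h, mul_zero] at this
    exact zero_ne_one this
  simp only [h1, h2, ← Finset.smul_sum]
  rw [(smul_right_injective B h3).eq_iff, RTT]
  rw [Finset.sum_comm (f := fun c d => R a b d c • (sg (pr j * pr c) • (x j d * x i c)))]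

theorem pr_neg (a : Idx n) : pr (-a) = 1 - pr a := by
  rcases a.pos_or with h | ⟨a, h, rfl⟩
  · rw [pr_neg_of_pos h, pr_of_pos h]
  · rw [Idx.neg_neg, pr_neg_of_pos h, pr_of_pos h]

/-- Negating both indices of the first factor exchanges E_{ji} with E_{-j,-i} and preserves φ. This
symmetry is what makes the identification t_{ia} = t_{-i,-a} consistent with the other relations. -/
theorem S_neg_left (c a d b : Idx n) : S (-c) (-a) d b = S c a d b := by
  have e1 : ∀ x y : Idx n, (-x = y) = (x = -y) := fun x y => propext (Idx.eq_neg_comm x y).symm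
  unfold S phi
  simp only [e1, Idx.neg_neg, add_comm]

theorem R_neg_left (a b d c : Idx n) : R (-a) b d (-c) = sg (pr b) * R a b d c := by
  unfold R
  rw [S_neg_left, pr_neg, pr_neg]
  rcases pr_cases c with hk | hk <;> rcases pr_cases d with hl | hl <;>
  rcases pr_cases a with ha | ha <;> rcases pr_cases b with hb | hb <;>
  simp [hk, hl, ha, hb, sg]

/-- By `R_neg_left`, negating the row i and the column a multiplies both sides by the same sign. -/
theorem RTT_neg_left {x : Idx r → Idx n → B} (hx : ∀ i a, x (-i) (-a) = x i a) {i j : Idx r}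
    {a b : Idx n} (h : RTT x i j a b) : RTT x (-i) j (-a) b := by
  have h1 : ∀ k l : Idx r,
      R (-k) l j (-i) • (sg (pr (-k) * (pr b + pr l) + pr (-i) * pr j) • (x (-k) (-a) * x l b)) =
      sg (pr b + pr j) • (R k l j i • (sg (pr k * (pr b + pr l) + pr i * pr j) •
        (x k a * x l b))) := by
    intro k l
    simp only [smul_smul]
    rw [R_neg_left, pr_neg, pr_neg, hx]
    congr 1
    rcases pr_cases i with hi | hi <;> rcases pr_cases j with hj | hj <;>
    rcases pr_cases k with hk | hk <;> rcases pr_cases l with hl | hl <;>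
    rcases pr_cases b with hb | hb <;> simp [hi, hj, hk, hl, hb, sg] <;> ring
  have h2 : ∀ c d : Idx n, R (-a) b d (-c) • (sg (pr j * pr (-c)) • (x j d * x (-i) (-c))) =
      sg (pr b + pr j) • (R a b d c • (sg (pr j * pr c) • (x j d * x i c))) := by
    intro c d
    simp only [smul_smul]
    rw [R_neg_left, pr_neg, hx]
    congr 1
    rcases pr_cases j with hj | hj <;> rcases pr_cases c with hk | hk <;>
    rcases pr_cases b with hb | hb <;> simp [hj, hk, hb, sg]
  unfold RTT at h ⊢
  rw [← sum_neg]
  simp only [h1, ← Finset.smul_sum]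
  rw [h, Finset.smul_sum]
  refine Finset.sum_congr rfl fun d _ => ?_
  rw [← sum_neg fun c => R (-a) b d c • (sg (pr j * pr c) • (x j d * x (-i) c))]
  simp only [h2, Finset.smul_sum]

/-- For positive rows the double negation term disappears, because j < -i is impossible, and all row
signs are trivial. -/
theorem RTT_pos_iff {x : Idx r → Idx n → B} {i j : Idx r} (hi : 0 < i.1) (hj : 0 < j.1)
    {a b : Idx n} : RTT x i j a b ↔
      (if i = j then q else 1) • (x i a * x j b) + (if j < i then xi else 0) • (x j a * x i b) =
      ∑ d, ∑ c, R a b d c • (x j d * x i c) := by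
  have h1 : ¬ j < -i := by rw [Idx.lt_iff', Idx.coe_neg]; omega
  have h2 : ¬ i = -j := by rw [Idx.ext_iff', Idx.coe_neg]; omega
  unfold RTT
  rw [sum_R_smul_left]
  simp [q_zpow_phi, pr_of_pos hi, pr_of_pos hj, h1, h2, sg]

/-- `S` has no such symmetry in its second factor, since negation reverses the order. Nevertheless,
in every configuration of signs and orders the relation for (-j, -b) is the one for (j, b) with
terms rearranged, once ξ is expanded as q - q⁻¹. -/
theorem RTT_neg_right {x : Idx r → Idx n → B} (hx : ∀ i a, x (-i) (-a) = x i a) {i j : Idx r}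
    {a b : Idx n} (hi : 0 < i.1) (hj : 0 < j.1) (h : RTT x i j a b) :
    RTT x i (-j) a (-b) := by
  rw [RTT_pos_iff hi hj, sum_R_smul] at h
  have m1 : -j < i := by rw [Idx.lt_iff', Idx.coe_neg]; omega
  have m3 : -j < j := by rw [Idx.lt_iff', Idx.coe_neg]; omega
  have m4 : ¬ j = -j := by rw [Idx.ext_iff', Idx.coe_neg]; omega
  have m2 : ¬ i = -j := by rw [Idx.ext_iff', Idx.coe_neg]; omega
  have hx' : ∀ i a, x (-i) a = x i (-a) := fun i a => by rw [← hx i (-a), Idx.neg_neg]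
  have hn' : ∀ a b : Idx n, 0 < a.1 → 0 < b.1 → -a < b ∧ ¬ a < -b ∧ a ≠ -b ∧ -a ≠ b :=
    fun a b ha hb => by
      rw [Ne, Ne, Idx.ext_iff', Idx.ext_iff', Idx.lt_iff', Idx.lt_iff', Idx.coe_neg, Idx.coe_neg]
      omega
  unfold RTT
  rw [sum_R_smul_left, sum_R_smul]
  obtain ⟨a', ha, ea⟩ := a.exists_pos
  obtain ⟨b', hb, eb⟩ := b.exists_pos
  obtain ⟨g1, g2, g3, g4⟩ := hn' a' b' ha hb
  obtain ⟨f1, f2, f3, f4⟩ := hn' b' b' hb hb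
  rcases order_cases a' b' with ⟨h1, h2, h3, h4⟩ | ⟨h1, h2, h3, h4⟩ | ⟨h1, h2, h3, h4⟩ <;>
  rcases order_cases i j with ⟨k1, k2, k3, k4⟩ | ⟨k1, k2, k3, k4⟩ | ⟨k1, k2, k3, k4⟩ <;>
  rcases ea with rfl | rfl <;> rcases eb with rfl | rfl <;>
  simp only [Idx.neg_neg, h1, Idx.neg_lt_neg', if_true, hx', pr_of_pos hi, pr_of_pos hj,
    pr_neg_of_pos hi, pr_neg_of_pos hj, pr_of_pos ha, pr_of_pos hb, pr_neg_of_pos ha,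
    pr_neg_of_pos hb, q_zpow_phi, zero_mul, mul_zero, one_mul, mul_one, zero_add, add_zero,
    sg_zero, sg_one, h2, h3, k1, k2, k3, g1, g2, g3, g4, f1, f2, f3, f4, m1, m2, m3, m4, one_ne_zero, if_false,
    Idx.neg_inj, or_false, or_true, lt_irrefl, zero_smul] at h ⊢ <;>
  linear_combination (norm := skip) h <;>
  simp only [xi, neg_smul, smul_neg, sub_smul, one_smul, mul_neg, mul_one, neg_sub, neg_neg, neg_mul,
    one_mul] <;>
  abel

theorem RTT_of_pos {x : Idx r → Idx n → B} (hx : ∀ i a, x (-i) (-a) = x i a)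
    (h : ∀ i j, 0 < i.1 → 0 < j.1 → ∀ a b, RTT x i j a b) (i j : Idx r) (a b : Idx n) :
    RTT x i j a b := by
  have h1 : ∀ i j, 0 < i.1 → ∀ a b, RTT x i j a b := by
    intro i j hi a b
    rcases j.pos_or with hj | ⟨j, hj, rfl⟩
    · exact h i j hi hj a b
    · have := RTT_neg_right hx hi hj (h i j hi hj a (-b))
      rwa [Idx.neg_neg] at this
  rcases i.pos_or with hi | ⟨i, hi, rfl⟩
  · exact h1 i j hi a b
  · have := RTT_neg_left hx (h1 i j hi (-a) b)
    rwa [Idx.neg_neg] at this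

/-- For j < i the relation is obtained by applying `R` to the one for the opposite order: R² = ξR +
1 then produces the additional ξ term. -/
theorem RTT_of_le {x : Idx r → Idx n → B}
    (h : ∀ i j, 0 < i.1 → i ≤ j → ∀ a b, (if i = j then q else 1) • (x i a * x j b) =
      ∑ d, ∑ c, R a b d c • (x j d * x i c))
    (i j : Idx r) (hi : 0 < i.1) (hj : 0 < j.1) (a b : Idx n) : RTT x i j a b := by
  rw [RTT_pos_iff hi hj]
  rcases le_or_gt i j with hij | hij
  · rw [if_neg hij.not_gt, zero_smul, add_zero, h i j hi hij]
  · have h1 : ∀ d c, x j d * x i c = ∑ d', ∑ c', R d c d' c' • (x i d' * x j c') := by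
      intro d c
      rw [← h j i hj hij.le, if_neg hij.ne, one_smul]
    have h2 : ∑ d, ∑ c, R a b d c • (x j d * x i c) =
        ∑ d, ∑ c, R a b d c • ∑ d', ∑ c', R d c d' c' • (x i d' * x j c') :=
      Finset.sum_congr rfl fun d _ => Finset.sum_congr rfl fun c _ => by rw [h1]
    rw [h2, sum_R_smul_hecke, if_neg hij.ne', if_pos hij, one_smul, add_comm, h1 a b]

end

/-! ### The universal property of A_{r,n} in terms of its positive rows. -/

section
variable {r n : ℕ} {B : Type*} [Ring B] [Algebra K B]

/-- The generators `t_{ia}` with `i > 0`, in decreasing order of `i`. -/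
def tp (i : Fin r) (a : Idx n) : A r n := t (posIdx i) a

theorem t_neg (i : Idx r) (a : Idx n) : (t (-i) (-a) : A r n) = t i a :=
  (RingQuot.mkAlgHom_rel K (ARel.neg i a)).symm

theorem t_RTT (i j : Idx r) (a b : Idx n) : RTT (B := A r n) t i j a b := by
  rw [RTT_iff]
  have := RingQuot.mkAlgHom_rel K (ARel.rtt i j a b)
  simp only [map_sum, map_smul, map_mul] at this
  exact this

/-- `posIdx` reverses the order, so i ≤ j in `Fin r` is the case in which the ξ term on the rows is
absent. -/
theorem tp_relation {i j : Fin r} (hij : i ≤ j) (a b : Idx n) :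
    (if i = j then q else 1) • (tp j a * tp i b : A r n) =
      ∑ d, ∑ c, R a b d c • (tp i d * tp j c) := by
  have h := (RTT_pos_iff (posIdx_pos j) (posIdx_pos i)).1
    (t_RTT (posIdx j) (posIdx i) a b)
  rw [if_neg ((posIdx_le_iff j i).2 hij).not_gt, zero_smul, add_zero] at h
  simp only [posIdx_injective.eq_iff, eq_comm (a := j)] at h
  exact h

/-- The images of the negative rows are forced by t_{-i,-a} = t_{ia}. `RTT_of_le` and `RTT_of_pos`
show that the remaining relations are consequences of the ordered positive ones. -/
theorem exists_lift (y : Fin r → Idx n → B)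
    (h : ∀ i j, i ≤ j → ∀ a b, (if i = j then q else 1) • (y j a * y i b) =
      ∑ d, ∑ c, R a b d c • (y i d * y j c)) :
    ∃ f : A r n →ₐ[K] B, ∀ i a, f (tp i a) = y i a := by
  have hneg : ∀ i : Idx r, ¬ 0 < i.1 → 0 < (-i).1 := fun i hi => by
    have := i.ne_zero
    rw [Idx.coe_neg]; omega
  let x : Idx r → Idx n → B := fun i a =>
    if hi : 0 < i.1 then y (exists_posIdx hi).choose a
    else y (exists_posIdx (hneg i hi)).choose (-a)
  have x_pos : ∀ i a, x (posIdx i) a = y i a := fun i a => by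
    have hi := posIdx_pos i
    simp only [x, dif_pos hi]
    rw [posIdx_injective (exists_posIdx hi).choose_spec]
  have hx : ∀ i a, x (-i) (-a) = x i a := by
    have key : ∀ (i : Fin r) a, x (-posIdx i) (-a) = y i a := fun i a => by
      have hi : ¬ 0 < (-posIdx i).1 := by
        have := posIdx_pos i
        rw [Idx.coe_neg]; omega
      simp only [x, dif_neg hi]
      have := (exists_posIdx (hneg _ hi)).choose_spec.trans (Idx.neg_neg _)
      rw [posIdx_injective this, Idx.neg_neg]
    intro i a
    rcases i.pos_or with hi | ⟨i, hi, rfl⟩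
    · obtain ⟨i, rfl⟩ := exists_posIdx hi
      rw [key, x_pos]
    · obtain ⟨i, rfl⟩ := exists_posIdx hi
      rw [Idx.neg_neg, x_pos, ← Idx.neg_neg a, key, Idx.neg_neg]
  have hle : ∀ i j, 0 < i.1 → i ≤ j → ∀ a b, (if i = j then q else 1) • (x i a * x j b) =
      ∑ d, ∑ c, R a b d c • (x j d * x i c) := by
    intro i j hi hij a b
    have hj : 0 < j.1 := lt_of_lt_of_le hi hij
    obtain ⟨i, rfl⟩ := exists_posIdx hi
    obtain ⟨j, rfl⟩ := exists_posIdx hj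
    simp only [x_pos]
    rw [← h j i ((posIdx_le_iff i j).1 hij)]
    simp only [posIdx_injective.eq_iff, eq_comm (a := j)]
  have hR := RTT_of_pos hx (RTT_of_le hle)
  let g : FreeAlgebra K (Idx r × Idx n) →ₐ[K] B := FreeAlgebra.lift K fun p => x p.1 p.2
  have hg : ∀ i a, g (FreeAlgebra.ι K (i, a)) = x i a := fun i a => FreeAlgebra.lift_ι_apply _ _
  have hrel : ∀ u v, ARel r n u v → g u = g v := by
    intro u v huv
    cases huv with
    | neg i a => rw [hg, hg, hx]
    | rtt i j a b =>
      have := (RTT_iff x i j a b).1 (hR i j a b)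
      simp only [map_sum, map_smul, map_mul, hg]
      exact this
  refine ⟨RingQuot.liftAlgHom K ⟨g, hrel⟩, fun i a => ?_⟩
  exact (RingQuot.liftAlgHom_mkAlgHom_apply K g hrel _).trans ((hg _ _).trans (x_pos i a))

end

/-! ### Induction on words in the generators. -/

section
variable {B : Type*} [Ring B] [Algebra K B]

/-- Peeling off one generator on the left matches the recursions satisfied by the actions and by Θ,
where a generator is passed before the rest of the word. -/
theorem induction_left_of_adjoin {G : Set B} (hG : Algebra.adjoin K G = ⊤) {P : B → Prop}
    (one : P 1) (add : ∀ x y, P x → P y → P (x + y)) (smul : ∀ (c : K) x, P x → P (c • x))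
    (mul : ∀ g ∈ G, ∀ x, P x → P (g * x)) (x : B) : P x := by
  have h : ∀ z ∈ Algebra.adjoin K G, ∀ x, P x → P (z * x) := by
    intro z hz
    induction hz using Algebra.adjoin_induction with
    | mem g hg => exact mul g hg
    | algebraMap c => exact fun x hx => by rw [← Algebra.smul_def]; exact smul c x hx
    | add y z _ _ hy hz => exact fun x hx => by rw [add_mul]; exact add _ _ (hy x hx) (hz x hx)
    | mul y z _ _ hy hz => exact fun x hx => by rw [mul_assoc]; exact hy _ (hz x hx)
  have := h x (hG ▸ Algebra.mem_top) 1 one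
  rwa [mul_one] at this

theorem adjoin_mkAlgHom_ι {X : Type*} (s : FreeAlgebra K X → FreeAlgebra K X → Prop) :
    Algebra.adjoin K (Set.range fun x => RingQuot.mkAlgHom K s (FreeAlgebra.ι K x)) = ⊤ := by
  rw [Set.range_comp' (RingQuot.mkAlgHom K s) (FreeAlgebra.ι K), ← AlgHom.map_adjoin,
    FreeAlgebra.adjoin_range_ι, Algebra.map_top, AlgHom.range_eq_top]
  exact RingQuot.mkAlgHom_surjective K s

end

theorem A.induction {r n : ℕ} {P : A r n → Prop} (one : P 1)
    (add : ∀ x y, P x → P y → P (x + y)) (smul : ∀ (c : K) x, P x → P (c • x))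
    (mul : ∀ i a x, P x → P (tp i a * x)) (x : A r n) : P x := by
  have hG : Algebra.adjoin K (Set.range fun p : Idx r × Idx n => (t p.1 p.2 : A r n)) = ⊤ :=
    adjoin_mkAlgHom_ι (ARel r n)
  refine induction_left_of_adjoin hG one add smul ?_ x
  rintro _ ⟨⟨i, a⟩, rfl⟩ x hx
  dsimp only
  rcases i.pos_or with hi | ⟨i, hi, rfl⟩
  · obtain ⟨i, rfl⟩ := exists_posIdx hi
    exact mul i a x hx
  · obtain ⟨i, rfl⟩ := exists_posIdx hi
    rw [← Idx.neg_neg a, t_neg]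
    exact mul i _ x hx

theorem U.induction {n : ℕ} {P : U n → Prop} (one : P 1)
    (add : ∀ x y, P x → P y → P (x + y)) (smul : ∀ (c : K) x, P x → P (c • x))
    (mul : ∀ i j x, P x → P (L i j * x)) (x : U n) : P x := by
  have hL : (fun p : UGen n => (L p.1.1 p.1.2 : U n)) =
      fun p => RingQuot.mkAlgHom K (URel n) (FreeAlgebra.ι K p) := by
    funext p
    rw [L, freeL, dif_pos p.2]
  have hG : Algebra.adjoin K (Set.range fun p : UGen n => (L p.1.1 p.1.2 : U n)) = ⊤ := by
    rw [hL]
    exact adjoin_mkAlgHom_ι (URel n)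
  refine induction_left_of_adjoin hG one add smul ?_ x
  rintro _ ⟨p, rfl⟩ x hx
  exact mul _ _ x hx

theorem A.algHom_ext {r n : ℕ} {B : Type*} [Ring B] [Algebra K B] {f g : A r n →ₐ[K] B}
    (h : ∀ i a, f (tp i a) = g (tp i a)) : f = g := by
  ext x
  induction x using A.induction with
  | one => rw [map_one, map_one]
  | add x y hx hy => rw [map_add, map_add, hx, hy]
  | smul c x hx => rw [map_smul, map_smul, hx]
  | mul i a x hx => rw [map_mul, map_mul, h, hx]

end

/-! ### Representations of `U_q(𝔮_n)` -/

section

theorem L_eq_zero {n : ℕ} {i j : Idx n} (h : j < i) : (L i j : U n) = 0 := by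
  unfold L freeL
  rw [dif_neg h.not_ge]
  exact map_zero _

theorem L_mul_L_neg {n : ℕ} (i : Idx n) : (L i i * L (-i) (-i) : U n) = 1 := by
  have := RingQuot.mkAlgHom_rel K (URel.inv i)
  rwa [map_mul, map_one] at this

theorem L_rll {n : ℕ} (i j k l : Idx n) :
    ∑ a : Idx n, ∑ b : Idx n,
        (sg ((pr i + pr a) * (pr k + pr b)) * sg ((pr k + pr b) * (pr a + pr j)) * S a j b l) •
          (L i a * L k b : U n) =
      ∑ a : Idx n, ∑ b : Idx n,
        (sg ((pr k + pr b) * (pr a + pr j)) * S i a k b) • (L b l * L a j) := by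
  have := RingQuot.mkAlgHom_rel K (URel.rll i j k l)
  simp only [map_sum, map_smul, map_mul] at this
  exact this

theorem quotPar_mk {X : Type} (p : X → ℕ) (rel : FreeAlgebra K X → FreeAlgebra K X → Prop)
    (h : ∀ a b, rel a b → ∃ c : K, freePar p a = c • a ∧ freePar p b = c • b)
    (x : FreeAlgebra K X) :
    quotPar p rel h (RingQuot.mkAlgHom K rel x) = RingQuot.mkAlgHom K rel (freePar p x) := by
  unfold quotPar
  rw [RingQuot.liftAlgHom_mkAlgHom_apply]
  rfl

theorem parU_L {n : ℕ} (i j : Idx n) : parU n (L i j) = sg (pr i + pr j) • L i j :=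
  (quotPar_mk uPar (URel n) (URel_homogeneous n) (freeL i j)).trans
    ((congrArg (RingQuot.mkAlgHom K (URel n)) (freePar_freeL i j)).trans
      (map_smul (RingQuot.mkAlgHom K (URel n)) _ _))

theorem parU_parU {n : ℕ} (u : U n) : parU n (parU n u) = u := by
  induction u using U.induction with
  | one => rw [map_one, map_one]
  | add x y hx hy => rw [map_add, map_add, hx, hy]
  | smul c x hx => rw [map_smul, map_smul, hx]
  | mul i j x hx =>
    rw [map_mul, map_mul, hx, parU_L, map_smul, parU_L, smul_smul, sg_mul_self, one_smul]

/-- `L` as a family in any algebra satisfying the defining relations of `U_q(𝔮_n)`. -/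
theorem exists_lift_U {n : ℕ} {B : Type*} [Ring B] [Algebra K B] (ℓ : Idx n → Idx n → B)
    (tri : ∀ i j, j < i → ℓ i j = 0) (inv : ∀ i, ℓ i i * ℓ (-i) (-i) = 1)
    (rll : ∀ i j k l, ∑ a : Idx n, ∑ b : Idx n,
        (sg ((pr i + pr a) * (pr k + pr b)) * sg ((pr k + pr b) * (pr a + pr j)) * S a j b l) •
          (ℓ i a * ℓ k b) =
      ∑ a : Idx n, ∑ b : Idx n,
        (sg ((pr k + pr b) * (pr a + pr j)) * S i a k b) • (ℓ b l * ℓ a j)) :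
    ∃ f : U n →ₐ[K] B, ∀ i j, f (L i j) = ℓ i j := by
  let g : FreeAlgebra K (UGen n) →ₐ[K] B := FreeAlgebra.lift K fun p => ℓ p.1.1 p.1.2
  have hg : ∀ i j, g (freeL i j) = ℓ i j := fun i j => by
    unfold freeL
    split_ifs with h
    · exact FreeAlgebra.lift_ι_apply _ _
    · rw [map_zero, tri i j (not_le.1 h)]
  have hrel : ∀ u v, URel n u v → g u = g v := by
    intro u v huv
    cases huv with
    | inv i => rw [map_mul, hg, hg, inv, map_one]
    | inv' i =>
      have := inv (-i)
      rw [Idx.neg_neg] at this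
      rw [map_mul, hg, hg, this, map_one]
    | rll i j k l =>
      simp only [map_sum, map_smul, map_mul, hg]
      exact rll i j k l
  exact ⟨RingQuot.liftAlgHom K ⟨g, hrel⟩, fun i j =>
    (RingQuot.liftAlgHom_mkAlgHom_apply K g hrel _).trans (hg i j)⟩

theorem U.algHom_ext {n : ℕ} {B : Type*} [Ring B] [Algebra K B] {f g : U n →ₐ[K] B}
    (h : ∀ i j, f (L i j) = g (L i j)) : f = g := by
  ext x
  induction x using U.induction with
  | one => rw [map_one, map_one]
  | add x y hx hy => rw [map_add, map_add, hx, hy]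
  | smul c x hx => rw [map_smul, map_smul, hx]
  | mul i a x hx => rw [map_mul, map_mul, h, hx]

/-! ### Removing the super signs from the relations of U_q(𝔮_n). -/

section
variable {n : ℕ} {E : Type*} [Ring E] [Algebra K E]

/-- The sign-free form of the relations of `U_q(𝔮_n)`: a matrix `Λ` over an algebra and an
involution `P` such that `L_{ij} ↦ P^{|j|} Λ_{ij}` satisfies the defining relations, `P`
implementing the parity. -/
structure IsFRT (P : E) (Λ : Idx n → Idx n → E) : Prop where
  par_sq : P * P = 1
  tri : ∀ i j, j < i → Λ i j = 0
  inv : ∀ i, Λ i i * Λ (-i) (-i) = P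
  par : ∀ i j, P * Λ i j = sg (pr i + pr j) • (Λ i j * P)
  rll : ∀ i j k l, ∑ a, ∑ b, R j l b a • (Λ i a * Λ k b) =
    ∑ a, ∑ b, R a b k i • (Λ b l * Λ a j)

theorem pow_pr_mul_pow_pr {n : ℕ} {E : Type*} [Ring E] {P : E} (hP : P * P = 1)
    (a : Idx n) : P ^ pr a * P ^ pr a = 1 := by
  rcases pr_cases a with h | h <;> simp [h, hP]

theorem mul_pow_pr {P : E} {Λ : Idx n → Idx n → E}
    (par : ∀ i j, P * Λ i j = sg (pr i + pr j) • (Λ i j * P)) (i a b : Idx n) :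
    Λ i a * P ^ pr b = sg (pr b * (pr i + pr a)) • (P ^ pr b * Λ i a) := by
  rcases pr_cases b with h | h <;> simp only [h, pow_zero, pow_one, mul_one, one_mul, zero_mul,
    sg_zero, one_smul, par, smul_smul, sg_mul_self]

theorem pow_mod_two {E : Type*} [Ring E] {P : E} (hP : P * P = 1) (m : ℕ) :
    P ^ m = P ^ (m % 2) := by
  conv_lhs => rw [← Nat.div_add_mod m 2, pow_add, pow_mul, pow_two, hP, one_pow, one_mul]

/-- All powers of P can be collected on the left. As `S` is even, the total power is the same for
every nonzero term, so P and the remaining signs factor out of both sides. -/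
theorem rll_iff {P : E} (hP : P * P = 1) {Λ ℓ : Idx n → Idx n → E}
    (par : ∀ i j, P * Λ i j = sg (pr i + pr j) • (Λ i j * P))
    (hℓ : ∀ i j, ℓ i j = P ^ pr j * Λ i j) (i j k l : Idx n) :
    (∑ a : Idx n, ∑ b : Idx n,
        (sg ((pr i + pr a) * (pr k + pr b)) * sg ((pr k + pr b) * (pr a + pr j)) * S a j b l) •
          (ℓ i a * ℓ k b) =
      ∑ a : Idx n, ∑ b : Idx n,
        (sg ((pr k + pr b) * (pr a + pr j)) * S i a k b) • (ℓ b l * ℓ a j)) ↔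
    ∑ a, ∑ b, R j l b a • (Λ i a * Λ k b) = ∑ a, ∑ b, R a b k i • (Λ b l * Λ a j) := by
  have mulℓ : ∀ i a k b, ℓ i a * ℓ k b =
      sg (pr b * (pr i + pr a)) • (P ^ (pr a + pr b) * (Λ i a * Λ k b)) := by
    intro i a k b
    rw [hℓ, hℓ, mul_assoc, ← mul_assoc (Λ i a), mul_pow_pr par, smul_mul_assoc, mul_smul_comm,
      pow_add, mul_assoc, mul_assoc]
  have h1 : ∀ a b, (sg ((pr i + pr a) * (pr k + pr b)) * sg ((pr k + pr b) * (pr a + pr j)) *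
      S a j b l) • (ℓ i a * ℓ k b) = sg (pr k * pr i + pr k * pr j + pr j * pr l) •
        (P ^ (pr j + pr l) * (R j l b a • (Λ i a * Λ k b))) := by
    intro a b
    rw [mulℓ, mul_smul_comm, smul_smul, smul_smul]
    have hS := S_even a j b l
    unfold R
    by_cases h0 : S a j b l = 0
    · rw [h0]; simp
    -- A nonzero entry of `S` forces equal total parity of its input and output indices.
    have hpar : (pr a + pr b) % 2 = (pr j + pr l) % 2 := by
      have := mul_right_cancel₀ h0 hS
      revert this
      rcases pr_cases a with h1 | h1 <;> rcases pr_cases b with h2 | h2 <;>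
      rcases pr_cases j with h3 | h3 <;> rcases pr_cases l with h4 | h4 <;>
      simp [h1, h2, h3, h4, sg] <;> norm_num [self_eq_neg, neg_eq_self]
    rw [pow_mod_two hP (pr a + pr b), hpar, ← pow_mod_two hP]
    congr 1
    revert hpar
    rcases pr_cases a with h1 | h1 <;> rcases pr_cases b with h2 | h2 <;>
    rcases pr_cases j with h3 | h3 <;> rcases pr_cases l with h4 | h4 <;>
    rcases pr_cases i with h5 | h5 <;> rcases pr_cases k with h6 | h6 <;>
    simp [h1, h2, h3, h4, h5, h6, sg] <;> ring
  have h2 : ∀ a b, (sg ((pr k + pr b) * (pr a + pr j)) * S i a k b) • (ℓ b l * ℓ a j) =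
      sg (pr k * pr i + pr k * pr j + pr j * pr l) •
        (P ^ (pr j + pr l) * (R a b k i • (Λ b l * Λ a j))) := by
    intro a b
    rw [mulℓ, mul_smul_comm, smul_smul, smul_smul, add_comm (pr l)]
    congr 1
    have hS := S_even i a k b
    unfold R
    by_cases h0 : S i a k b = 0
    · rw [h0]; simp
    rcases pr_cases a with h1 | h1 <;> rcases pr_cases b with h2 | h2 <;>
    rcases pr_cases j with h3 | h3 <;> rcases pr_cases l with h4 | h4 <;>
    rcases pr_cases i with h5 | h5 <;> rcases pr_cases k with h6 | h6 <;>
    simp [h1, h2, h3, h4, h5, h6, sg] <;> ring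
  simp only [h1, h2, ← Finset.smul_sum, ← Finset.mul_sum]
  have h3 : sg (pr k * pr i + pr k * pr j + pr j * pr l) ≠ 0 := fun h => by
    have := sg_mul_self (pr k * pr i + pr k * pr j + pr j * pr l)
    rw [h, mul_zero] at this
    exact zero_ne_one this
  rw [(smul_right_injective E h3).eq_iff]
  refine ⟨fun h => ?_, fun h => by rw [h]⟩
  have := congrArg (P ^ (pr j + pr l) * ·) h
  simp only [← mul_assoc, ← pow_add, ← two_mul, pow_mul, pow_two, hP, one_pow, one_mul] at this
  exact this

/-- Together with `isFRT_of_algHom` this is a dictionary: sign-free matrices correspond to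
representations of U_q(𝔮_n) in which P implements the parity. -/
theorem IsFRT.exists_lift {P : E} {Λ : Idx n → Idx n → E} (h : IsFRT P Λ) :
    ∃ f : U n →ₐ[K] E, (∀ i j, f (L i j) = P ^ pr j * Λ i j) ∧
      ∀ u, P * f u = f (parU n u) * P := by
  obtain ⟨f, hf⟩ := exists_lift_U (fun i j => P ^ pr j * Λ i j)
    (fun i j hij => by rw [h.tri i j hij, mul_zero])
    (fun i => by
      have hc := mul_pow_pr h.par i i (-i)
      have : sg (pr (-i) * (pr i + pr i)) = 1 := by
        rcases pr_cases i with h1 | h1 <;> simp [pr_neg, h1, sg]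
      rw [this, one_smul] at hc
      rw [mul_assoc, ← mul_assoc (Λ i i), hc, mul_assoc, h.inv, ← mul_assoc, ← pow_add]
      rcases pr_cases i with h1 | h1 <;> simp [pr_neg, h1, h.par_sq])
    (fun i j k l => (rll_iff h.par_sq h.par (fun _ _ => rfl) i j k l).2 (h.rll i j k l))
  refine ⟨f, hf, fun u => ?_⟩
  induction u using U.induction with
  | one => rw [map_one, map_one, map_one, one_mul, mul_one]
  | add x y hx hy => rw [map_add, map_add, map_add, mul_add, add_mul, hx, hy]
  | smul c x hx => rw [map_smul, map_smul, map_smul, mul_smul_comm, smul_mul_assoc, hx]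
  | mul i j x hx =>
    rw [map_mul, map_mul, map_mul, mul_assoc, ← hx, ← mul_assoc, ← mul_assoc, parU_L, map_smul, hf,
      ← mul_assoc, ← pow_succ', pow_succ, mul_assoc (P ^ pr j), h.par, mul_smul_comm]
    simp only [smul_mul_assoc, mul_assoc]

theorem isFRT_of_algHom {P : E} (hP : P * P = 1) (f : U n →ₐ[K] E)
    (hf : ∀ u, P * f u = f (parU n u) * P) : IsFRT P fun i j => P ^ pr j * f (L i j) := by
  have par : ∀ i j, P * (P ^ pr j * f (L i j)) =
      sg (pr i + pr j) • (P ^ pr j * f (L i j) * P) := fun i j => by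
    rw [← mul_assoc, ← pow_succ', pow_succ, mul_assoc, hf, parU_L, map_smul, smul_mul_assoc,
      mul_smul_comm, mul_assoc]
  have hℓ : ∀ i j, f (L i j) = P ^ pr j * (P ^ pr j * f (L i j)) := fun i j => by
    rw [← mul_assoc, pow_pr_mul_pow_pr hP, one_mul]
  refine ⟨hP, fun i j hij => by rw [L_eq_zero hij, map_zero, mul_zero], fun i => ?_, par,
    fun i j k l => (rll_iff hP par hℓ i j k l).1 ?_⟩
  · have h1 := congrArg f (L_mul_L_neg i)
    have hc : f (L i i) * P = P * f (L i i) := by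
      rw [hf, parU_L, sg_add, sg_mul_self, one_smul]
    have hc' : f (L i i) * P ^ pr (-i) = P ^ pr (-i) * f (L i i) :=
      ((show Commute (f (L i i)) P from hc).pow_right _).eq
    rw [map_mul, map_one] at h1
    rw [mul_assoc, ← mul_assoc (f (L i i)), hc', mul_assoc, h1, mul_one, ← pow_add]
    rcases pr_cases i with h1 | h1 <;> simp [pr_neg, h1]
  · have := congrArg f (L_rll i j k l)
    simp only [map_sum, map_smul, map_mul] at this
    exact this

end

end

/-! ### Supermodules and their tensor products -/

section

section
variable {M N : Type*} [AddCommGroup M] [Module K M] [AddCommGroup N] [Module K N]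

/-- Since 2 is invertible, every vector is the sum of its even and odd parts, so sign rules need
only be checked on homogeneous vectors. -/
theorem homogeneous_induction {P : M →ₗ[K] M} (hP : ∀ m, P (P m) = m) {p : M → Prop}
    (add : ∀ x y, p x → p y → p (x + y))
    (hom : ∀ (e : ℕ) (m : M), P m = sg e • m → p m) (m : M) : p m := by
  have h : m = (2⁻¹ : K) • (m + P m) + (2⁻¹ : K) • (m - P m) := by
    rw [← smul_add, add_add_sub_cancel, ← two_smul K, smul_smul,
      inv_mul_cancel₀ two_ne_zero, one_smul]
  rw [h]
  refine add _ _ (hom 0 _ ?_) (hom 1 _ ?_)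
  · rw [map_smul, map_add, hP, sg_zero, one_smul, add_comm]
  · rw [map_smul, map_sub, hP, sg_one, neg_one_smul, ← smul_neg, neg_sub]

theorem pow_apply_of_even {Q : Module.End K N} (hQ : ∀ w, Q (Q w) = w) {e : ℕ} (he : sg e = 1)
    (w : N) : (Q ^ e) w = w := by
  rcases Nat.even_or_odd e with h | h
  · obtain ⟨m, rfl⟩ := h
    rw [← two_mul, pow_mul, pow_two, show Q * Q = 1 from LinearMap.ext hQ, one_pow]
    rfl
  · rw [sg, h.neg_one_pow] at he
    norm_num [neg_eq_self, self_eq_neg] at he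

end

section
variable {V W : Type} [AddCommGroup V] [Module K V] [AddCommGroup W] [Module K W]

/-- Writing the sign as a power of the parity operator means that only the moved vector `v` has to
be homogeneous. -/
theorem superFlip_tmul {pV : V →ₗ[K] V} {pW : Module.End K W} (hW : ∀ w, pW (pW w) = w) {e : ℕ}
    {v : V} (hv : pV v = sg e • v) (w : W) :
    superFlip pV pW (v ⊗ₜ w) = (pW ^ e) w ⊗ₜ v := by
  have h2 : (2⁻¹ : K) • (v + v) = v := by
    rw [← two_smul K, smul_smul, inv_mul_cancel₀ two_ne_zero, one_smul]
  rcases sg_cases e with he | he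
  · rw [pow_apply_of_even hW he]
    simp [superFlip, hv, he, -smul_add, h2]
  · have : (pW ^ e) w = pW w := by
      rw [← hW ((pW ^ e) w)]
      congr 1
      have h := pow_apply_of_even hW (e := e + 1) (by rw [sg_add, he, sg_one]; norm_num) w
      rwa [pow_succ'] at h
    rw [this]
    simp [superFlip, hv, he, -smul_add, h2]

end

section
variable {V W X Y : Type} [AddCommGroup V] [AddCommGroup W] [AddCommGroup X] [AddCommGroup Y]
  [Module K V] [Module K W] [Module K X] [Module K Y]

theorem midMap_tmul (θ : W ⊗[K] X →ₗ[K] X ⊗[K] W) (v : V) (w : W) (x : X) (y : Y) :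
    midMap θ ((v ⊗ₜ w) ⊗ₜ[K] (x ⊗ₜ y)) =
      TensorProduct.map (TensorProduct.mk K V X v) ((TensorProduct.mk K W Y).flip y)
        (θ (w ⊗ₜ x)) := by
  simp only [midMap, LinearMap.comp_apply, LinearEquiv.coe_coe, TensorProduct.assoc_tmul,
    LinearMap.lTensor_tmul, TensorProduct.assoc_symm_tmul, LinearMap.rTensor_tmul]
  induction θ (w ⊗ₜ x) using TensorProduct.induction_on with
  | zero => simp
  | tmul x w => simp
  | add a b ha hb =>
    simp only [TensorProduct.add_tmul, TensorProduct.tmul_add, map_add, ha, hb]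

end

/-! ### Supermodules as solutions of the sign-free relations. -/

section
variable {n : ℕ} {M N : Type} [AddCommGroup M] [Module K M] [AddCommGroup N] [Module K N]

/-- `α` is an action of `U_q(𝔮_n)` on the superspace `M` with parity involution `P`. -/
structure IsSMod (P : M →ₗ[K] M) (α : U n ⊗[K] M →ₗ[K] M) : Prop where
  par_par : ∀ m, P (P m) = m
  one_act : ∀ m, α (1 ⊗ₜ m) = m
  mul_act : ∀ u v m, α ((u * v) ⊗ₜ m) = α (u ⊗ₜ α (v ⊗ₜ m))
  par_act : ∀ u m, P (α (u ⊗ₜ m)) = α (parU n u ⊗ₜ P m)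

/-- The operator of `L_{ab}`, followed by the parity involution if `b` is odd. -/
def Lt (P : M →ₗ[K] M) (α : U n ⊗[K] M →ₗ[K] M) (a b : Idx n) : Module.End K M :=
  (P : Module.End K M) ^ pr b * (α ∘ₗ TensorProduct.mk K (U n) M (L a b))

theorem Lt_apply (P : M →ₗ[K] M) (α : U n ⊗[K] M →ₗ[K] M) (a b : Idx n) (m : M) :
    Lt P α a b m = ((P : Module.End K M) ^ pr b) (α (L a b ⊗ₜ m)) := rfl

theorem pow_pr_pow_pr {P : Module.End K M} (h : ∀ m, P (P m) = m) (a : Idx n) (m : M) :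
    (P ^ pr a) ((P ^ pr a) m) = m := by
  rcases pr_cases a with h' | h' <;> simp [h', h]

section
variable {P : M →ₗ[K] M} {α : U n ⊗[K] M →ₗ[K] M}

theorem IsSMod.act_L (h : IsSMod P α) (a b : Idx n) (m : M) :
    α (L a b ⊗ₜ m) = ((P : Module.End K M) ^ pr b) (Lt P α a b m) := by
  rw [Lt_apply, pow_pr_pow_pr h.par_par]

theorem IsSMod.isFRT (h : IsSMod P α) : IsFRT (E := Module.End K M) P (Lt P α) := by
  let f : U n →ₐ[K] Module.End K M := AlgHom.ofLinearMap (TensorProduct.curry α)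
    (LinearMap.ext h.one_act) (fun u v => LinearMap.ext (h.mul_act u v))
  exact isFRT_of_algHom (LinearMap.ext h.par_par) f fun u => LinearMap.ext (h.par_act u)

/-- The converse of `IsSMod.isFRT`; the actions on tensor products and on A_{r,n} are produced this
way. -/
theorem IsFRT.exists_act {P : Module.End K M} {Λ : Idx n → Idx n → Module.End K M}
    (h : IsFRT P Λ) : ∃ α : U n ⊗[K] M →ₗ[K] M, IsSMod P α ∧ Lt P α = Λ := by
  obtain ⟨f, hf, hpar⟩ := h.exists_lift
  have hP : ∀ m, P (P m) = m := fun m => LinearMap.congr_fun h.par_sq m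
  refine ⟨TensorProduct.lift f.toLinearMap, ⟨hP, fun m => ?_, fun u v m => ?_, fun u m => ?_⟩, ?_⟩
  · simp
  · simp
  · exact LinearMap.congr_fun (hpar u) m
  · funext a b
    ext m
    rw [Lt_apply, TensorProduct.lift.tmul]
    change (P ^ pr b) (f (L a b) m) = _
    rw [hf]
    exact pow_pr_pow_pr hP b _

theorem IsSMod.map_act_of_L {Q : N →ₗ[K] N} {β : U n ⊗[K] N →ₗ[K] N} (h : IsSMod P α)
    (h' : IsSMod Q β) {f : M →ₗ[K] N} (hf : ∀ a b m, f (α (L a b ⊗ₜ m)) = β (L a b ⊗ₜ f m))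
    (u : U n) (m : M) : f (α (u ⊗ₜ m)) = β (u ⊗ₜ f m) := by
  induction u using U.induction generalizing m with
  | one => rw [h.one_act, h'.one_act]
  | add x y hx hy => simp only [TensorProduct.add_tmul, map_add, hx, hy]
  | smul c x hx => simp only [← TensorProduct.smul_tmul', map_smul, hx]
  | mul i j x hx => rw [h.mul_act, h'.mul_act, hf, hx]

theorem map_pow_apply {P : Module.End K M} {Q : Module.End K N} {f : M →ₗ[K] N}
    (hP : ∀ m, f (P m) = Q (f m)) (e : ℕ) (m : M) : f ((P ^ e) m) = (Q ^ e) (f m) := by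
  induction e with
  | zero => rfl
  | succ e ih => rw [pow_succ', pow_succ', Module.End.mul_apply, Module.End.mul_apply, hP, ih]

theorem IsSMod.map_act {Q : N →ₗ[K] N} {β : U n ⊗[K] N →ₗ[K] N} (h : IsSMod P α)
    (h' : IsSMod Q β) {f : M →ₗ[K] N} (hP : ∀ m, f (P m) = Q (f m))
    (hf : ∀ a b m, f (Lt P α a b m) = Lt Q β a b (f m))
    (u : U n) (m : M) : f (α (u ⊗ₜ m)) = β (u ⊗ₜ f m) := by
  refine h.map_act_of_L h' (fun a b m => ?_) u m
  rw [h.act_L, h'.act_L, map_pow_apply hP, hf]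

theorem IsSMod.par_pow_act (h : IsSMod P α) (e : ℕ) (a b : Idx n) (m : M) :
    ((P : Module.End K M) ^ e) (α (L a b ⊗ₜ m)) =
      sg (e * (pr a + pr b)) • α (L a b ⊗ₜ ((P : Module.End K M) ^ e) m) := by
  induction e with
  | zero => simp [sg]
  | succ e ih =>
    rw [pow_succ', Module.End.mul_apply, ih, map_smul, h.par_act, parU_L,
      ← TensorProduct.smul_tmul',
      map_smul, smul_smul, ← sg_add, Module.End.mul_apply, add_mul, one_mul]

end

/-- The convolution of two solutions of the relation `R L L = L L R` is a solution. -/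
theorem rll_convolution {E F G : Type*} [AddCommGroup E] [AddCommGroup F] [AddCommGroup G]
    [Module K E] [Module K F] [Module K G] (Ψ : E →ₗ[K] F →ₗ[K] G)
    {X : Idx n → Idx n → Idx n → Idx n → E} {Y : Idx n → Idx n → Idx n → Idx n → F}
    (hX : ∀ i j k l, ∑ a, ∑ b, R j l b a • X i a k b = ∑ a, ∑ b, R a b k i • X b l a j)
    (hY : ∀ i j k l, ∑ a, ∑ b, R j l b a • Y i a k b = ∑ a, ∑ b, R a b k i • Y b l a j)
    (i j k l : Idx n) :
    ∑ a, ∑ b, R j l b a • ∑ c, ∑ d, Ψ (X i c k d) (Y c a d b) =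
      ∑ a, ∑ b, R a b k i • ∑ c, ∑ d, Ψ (X b c a d) (Y c l d j) := by
  -- `R` is carried through the Y factor first; after regrouping it stands next to the X factor and
  -- is carried through that one.
  have lhs : ∑ a, ∑ b, R j l b a • ∑ c, ∑ d, Ψ (X i c k d) (Y c a d b) =
      ∑ c, ∑ d, Ψ (X i c k d) (∑ a, ∑ b, R j l b a • Y c a d b) := by
    simp only [map_sum, map_smul, Finset.smul_sum]
    rw [sum_comm_pairs]
  have mid : ∑ c, ∑ d, Ψ (X i c k d) (∑ a, ∑ b, R a b d c • Y b l a j) =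
      ∑ a, ∑ b, Ψ (∑ c, ∑ d, R a b d c • X i c k d) (Y b l a j) := by
    simp only [map_sum, map_smul, LinearMap.sum_apply, LinearMap.smul_apply]
    rw [sum_comm_pairs]
  have rhs : ∑ a, ∑ b, R a b k i • ∑ c, ∑ d, Ψ (X b c a d) (Y c l d j) =
      ∑ c, ∑ d, Ψ (∑ a, ∑ b, R a b k i • X b c a d) (Y c l d j) := by
    simp only [map_sum, map_smul, Finset.smul_sum, LinearMap.sum_apply, LinearMap.smul_apply]
    rw [sum_comm_pairs]
  rw [lhs, rhs]
  simp only [hY]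
  rw [mid, Finset.sum_comm]
  simp only [hX]

/-- This is where the sign-free form pays off: the matrix product of two solutions under an
ordinary, unsigned tensor product of algebras is again a solution. -/
theorem IsFRT.tensor {E F G : Type*} [Ring E] [Ring F] [Ring G] [Algebra K E] [Algebra K F]
    [Algebra K G] {P : E} {Q : F} {Λ : Idx n → Idx n → E} {Γ : Idx n → Idx n → F}
    (h : IsFRT P Λ) (h' : IsFRT Q Γ) (Ψ : E →ₗ[K] F →ₗ[K] G)
    (mm : ∀ f f' g g', Ψ f g * Ψ f' g' = Ψ (f * f') (g * g')) (oo : Ψ 1 1 = 1) :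
    IsFRT (Ψ P Q) fun a b => ∑ c, Ψ (Λ a c) (Γ c b) := by
  -- By triangularity only c = i contributes to a diagonal entry of the product.
  have hdiag : ∀ i : Idx n, ∑ c, Ψ (Λ i c) (Γ c i) = Ψ (Λ i i) (Γ i i) := fun i => by
    refine Finset.sum_eq_single i (fun c _ hc => ?_) (by simp)
    rcases lt_or_gt_of_ne hc with hc | hc
    · rw [h.tri i c hc, map_zero, LinearMap.zero_apply]
    · rw [h'.tri c i hc, map_zero]
  refine ⟨?_, fun i j hij => Finset.sum_eq_zero fun c _ => ?_, fun i => ?_, fun i j => ?_,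
    fun i j k l => ?_⟩
  · rw [mm, h.par_sq, h'.par_sq, oo]
  · rcases lt_or_ge c i with hc | hc
    · rw [h.tri i c hc, map_zero, LinearMap.zero_apply]
    · rw [h'.tri c j (hij.trans_le hc), map_zero]
  · rw [hdiag, hdiag, mm, h.inv, h'.inv]
  · rw [Finset.mul_sum, Finset.sum_mul, Finset.smul_sum]
    refine Finset.sum_congr rfl fun c _ => ?_
    rw [mm, mm, h.par, h'.par, map_smul, map_smul, LinearMap.smul_apply, smul_smul]
    congr 1
    rcases pr_cases c with hc | hc <;> simp [hc, sg, pow_add, mul_comm]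
  · have h2 : ∀ i a k b, (∑ c, Ψ (Λ i c) (Γ c a)) * ∑ d, Ψ (Λ k d) (Γ d b) =
        ∑ c, ∑ d, Ψ (Λ i c * Λ k d) (Γ c a * Γ d b) := fun i a k b => by
      simp only [Finset.sum_mul_sum, mm]
    simp only [h2]
    exact rll_convolution Ψ h.rll h'.rll i j k l

theorem IsFRT.tensorProduct {P : Module.End K M} {Q : Module.End K N}
    {Λ : Idx n → Idx n → Module.End K M} {Γ : Idx n → Idx n → Module.End K N}
    (h : IsFRT P Λ) (h' : IsFRT Q Γ) :
    IsFRT (E := Module.End K (M ⊗[K] N)) (TensorProduct.map P Q)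
      fun a b => ∑ c, TensorProduct.map (Λ a c) (Γ c b) :=
  IsFRT.tensor (G := Module.End K (M ⊗[K] N)) h h'
    (TensorProduct.mapBilinear (RingHom.id K) M N M N)
    (fun f f' g g' => (TensorProduct.map_mul f f' g g').symm) TensorProduct.map_one

end

end

/-! ### Comultiplication and counit -/

section

section
variable {n : ℕ} {M N : Type} [AddCommGroup M] [Module K M] [AddCommGroup N] [Module K N]
  {P : M →ₗ[K] M} {α : U n ⊗[K] M →ₗ[K] M} {Q : N →ₗ[K] N} {β : U n ⊗[K] N →ₗ[K] N}

theorem isSMod_self : IsSMod (parU n).toLinearMap (LinearMap.mul' K (U n)) :=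
  ⟨parU_parU, fun m => by simp, fun u v m => by simp [mul_assoc], fun u m => by simp⟩

/-- The action of the super tensor product `U ⊗ U` on `M ⊗ N`. -/
def superAct (P : M →ₗ[K] M) (α : U n ⊗[K] M →ₗ[K] M) (β : U n ⊗[K] N →ₗ[K] N) :
    (U n ⊗[K] U n) ⊗[K] (M ⊗[K] N) →ₗ[K] M ⊗[K] N :=
  TensorProduct.map α β ∘ₗ midMap (superFlip (parU n).toLinearMap P)

theorem superAct_tmul (hP : ∀ m, P (P m) = m) {e : ℕ} {b : U n} (hb : parU n b = sg e • b)
    (a : U n) (x : M) (y : N) : superAct P α β ((a ⊗ₜ b) ⊗ₜ (x ⊗ₜ y)) =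
      α (a ⊗ₜ ((P : Module.End K M) ^ e) x) ⊗ₜ β (b ⊗ₜ y) := by
  rw [superAct, LinearMap.comp_apply, midMap_tmul, superFlip_tmul hP hb]
  rfl

/-- Both sides pass b across a' and x. On the right this is a power of the parity operator applied
to a'.x, which distributes over the action because the action is even. -/
theorem superAct_superAct (hM : IsSMod P α) (hN : IsSMod Q β) (z z' : U n ⊗[K] U n)
    (w : M ⊗[K] N) :
    superAct P α β (superAct (parU n).toLinearMap (LinearMap.mul' K (U n))
      (LinearMap.mul' K (U n)) (z ⊗ₜ z') ⊗ₜ w) =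
      superAct P α β (z ⊗ₜ superAct P α β (z' ⊗ₜ w)) := by
  induction z using TensorProduct.induction_on with
  | zero => simp
  | add z₁ z₂ h₁ h₂ => simp only [TensorProduct.add_tmul, map_add, h₁, h₂]
  | tmul a b =>
  induction z' using TensorProduct.induction_on with
  | zero => simp
  | add z₁ z₂ h₁ h₂ => simp only [TensorProduct.add_tmul, TensorProduct.tmul_add, map_add, h₁, h₂]
  | tmul a' b' =>
  induction w using TensorProduct.induction_on with
  | zero => simp
  | add z₁ z₂ h₁ h₂ => simp only [TensorProduct.tmul_add, map_add, h₁, h₂]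
  | tmul x y =>
  induction b using homogeneous_induction (P := (parU n).toLinearMap) parU_parU with
  | add b₁ b₂ h₁ h₂ => simp only [TensorProduct.add_tmul, TensorProduct.tmul_add, map_add, h₁, h₂]
  | hom e b hb =>
  induction b' using homogeneous_induction (P := (parU n).toLinearMap) parU_parU with
  | add b₁ b₂ h₁ h₂ => simp only [TensorProduct.add_tmul, TensorProduct.tmul_add, map_add, h₁, h₂]
  | hom e' b' hb' =>
  have hb : parU n b = sg e • b := hb
  have hb' : parU n b' = sg e' • b' := hb'
  have hbb : parU n (b * b') = sg (e + e') • (b * b') := by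
    rw [map_mul, hb, hb', smul_mul_smul_comm, sg_add]
  have hP : ∀ u m, ((P : Module.End K M) ^ e) (α (u ⊗ₜ m)) =
      α ((((parU n).toLinearMap : Module.End K (U n)) ^ e) u ⊗ₜ
        ((P : Module.End K M) ^ e) m) := by
    intro u m
    generalize e = k
    induction k with
    | zero => rfl
    | succ k ih =>
      simp only [pow_succ', Module.End.mul_apply, ih, hM.par_act]
      rfl
  rw [superAct_tmul parU_parU hb, superAct_tmul hM.par_par hb', superAct_tmul hM.par_par hb,
    LinearMap.mul'_apply, LinearMap.mul'_apply, superAct_tmul hM.par_par hbb, hM.mul_act,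
    hN.mul_act, hP, pow_add, Module.End.mul_apply]

theorem superAct_one (hM : IsSMod P α) (hN : IsSMod Q β) (w : M ⊗[K] N) :
    superAct P α β ((1 ⊗ₜ 1) ⊗ₜ w) = w := by
  induction w using TensorProduct.induction_on with
  | zero => simp
  | add z₁ z₂ h₁ h₂ => simp only [TensorProduct.tmul_add, map_add, h₁, h₂]
  | tmul x y =>
    rw [superAct_tmul (e := 0) hM.par_par (by rw [map_one, sg_zero, one_smul]), hM.one_act,
      hN.one_act]
    rfl

/-- The coproduct of `L_{ij}`. -/
def coL (i j : Idx n) : U n ⊗[K] U n :=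
  ∑ k : Idx n, sg ((pr i + pr k) * (pr k + pr j)) • (L i k ⊗ₜ[K] L k j)

/-- The signs in Δ(L_{ij}) are precisely those arising when the twists P^{|b|} and P^{|c|} are moved
past L_{ac}. -/
theorem act_L_eq_superAct (hM : IsSMod P α) (hN : IsSMod Q β)
    {γ : U n ⊗[K] (M ⊗[K] N) →ₗ[K] M ⊗[K] N} (h : IsSMod (TensorProduct.map P Q) γ)
    (hγ : Lt (TensorProduct.map P Q) γ =
      fun a b => ∑ c, TensorProduct.map (Lt P α a c) (Lt Q β c b))
    (a b : Idx n) (w : M ⊗[K] N) : γ (L a b ⊗ₜ w) = superAct P α β (coL a b ⊗ₜ w) := by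
  rw [h.act_L, hγ, coL]
  induction w using TensorProduct.induction_on with
  | zero => simp
  | add z₁ z₂ h₁ h₂ => simp only [TensorProduct.tmul_add, map_add, h₁, h₂]
  | tmul x y =>
    simp only [LinearMap.sum_apply, TensorProduct.sum_tmul, map_sum, ← TensorProduct.smul_tmul',
      map_smul]
    refine Finset.sum_congr rfl fun c _ => ?_
    rw [superAct_tmul hM.par_par (parU_L c b), TensorProduct.map_tmul, TensorProduct.map_pow,
      TensorProduct.map_tmul, ← hN.act_L, Lt_apply, ← Module.End.mul_apply, ← pow_add,
      hM.par_pow_act, ← TensorProduct.smul_tmul', add_comm (pr b), mul_comm (pr c + pr b)]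

/-- The action comes from the matrix product and does not presuppose a comultiplication, so it can
be used to construct one. -/
theorem exists_tensor_act (hM : IsSMod P α) (hN : IsSMod Q β) :
    ∃ γ : U n ⊗[K] (M ⊗[K] N) →ₗ[K] M ⊗[K] N, IsSMod (TensorProduct.map P Q) γ ∧
      Lt (TensorProduct.map P Q) γ =
        (fun a b => ∑ c, TensorProduct.map (Lt P α a c) (Lt Q β c b)) ∧
      ∀ a b w, γ (L a b ⊗ₜ w) = superAct P α β (coL a b ⊗ₜ w) := by
  obtain ⟨γ, h, hγ⟩ := (hM.isFRT.tensorProduct hN.isFRT).exists_act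
  exact ⟨γ, h, hγ, act_L_eq_superAct hM hN h hγ⟩

end

variable {n : ℕ}

theorem isComul_iff (Δ : U n →ₗ[K] U n ⊗[K] U n) : IsComul n Δ ↔ Δ 1 = 1 ⊗ₜ 1 ∧
    (∀ u v : U n, Δ (u * v) = superAct (parU n).toLinearMap (LinearMap.mul' K (U n))
      (LinearMap.mul' K (U n)) (Δ u ⊗ₜ Δ v)) ∧
    ∀ i j : Idx n, Δ (L i j) = coL i j := Iff.rfl

theorem existsUnique_comul (n : ℕ) : ∃! Δ : U n →ₗ[K] U n ⊗[K] U n, IsComul n Δ := by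
  refine existsUnique_of_exists_of_unique ?_ ?_
  -- Let U act on U ⊗ U by two copies of the regular representation and put Δ(u) = u.(1 ⊗ 1). Then
  -- `key` says that u acts as left multiplication by Δ(u), whence Δ is multiplicative.
  · obtain ⟨γ, h, -, hγ⟩ := exists_tensor_act (isSMod_self (n := n)) (isSMod_self (n := n))
    have key : ∀ u w, γ (u ⊗ₜ w) = superAct (parU n).toLinearMap (LinearMap.mul' K (U n))
      (LinearMap.mul' K (U n)) (γ (u ⊗ₜ (1 ⊗ₜ 1)) ⊗ₜ w) := by
      intro u
      induction u using U.induction with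
      | one => exact fun w => by rw [h.one_act, h.one_act, superAct_one isSMod_self isSMod_self]
      | add x y hx hy =>
        exact fun w => by simp only [TensorProduct.add_tmul, map_add, hx w, hy w]
      | smul c x hx =>
        exact fun w => by simp only [← TensorProduct.smul_tmul', map_smul, hx w]
      | mul i j x hx =>
        intro w
        rw [h.mul_act, h.mul_act, hγ, hγ, superAct_superAct isSMod_self isSMod_self, ← hx]
    refine ⟨γ ∘ₗ (TensorProduct.mk K (U n) (U n ⊗[K] U n)).flip (1 ⊗ₜ 1),
      (isComul_iff _).2 ⟨h.one_act _, fun u v => ?_, fun i j => ?_⟩⟩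
    · exact (h.mul_act u v _).trans (key u _)
    · refine (hγ i j _).trans ?_
      rw [coL]
      simp only [TensorProduct.sum_tmul, map_sum, ← TensorProduct.smul_tmul', map_smul]
      refine Finset.sum_congr rfl fun k _ => ?_
      rw [superAct_tmul parU_parU (parU_L k j), LinearMap.mul'_apply, LinearMap.mul'_apply,
        mul_one]
      have : (((parU n).toLinearMap : Module.End K (U n)) ^ (pr k + pr j)) 1 = 1 := by
        generalize pr k + pr j = e
        induction e with
        | zero => rfl
        | succ e ih => rw [pow_succ', Module.End.mul_apply, ih]; exact map_one (parU n)
      rw [this, mul_one]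
  · intro Δ Δ' h h'
    rw [isComul_iff] at h h'
    ext u
    induction u using U.induction with
    | one => rw [h.1, h'.1]
    | add x y hx hy => rw [map_add, map_add, hx, hy]
    | smul c x hx => rw [map_smul, map_smul, hx]
    | mul i j x hx => rw [h.2.1, h'.2.1, h.2.2, h'.2.2, hx]

theorem existsUnique_counit (n : ℕ) : ∃! ε : U n →ₐ[K] K, IsCounit n ε := by
  refine existsUnique_of_exists_of_unique ?_ ?_
  · refine exists_lift_U (fun i j => if i = j then (1 : K) else 0)
      (fun i j hij => if_neg hij.ne') (fun i => by simp) (fun i j k l => ?_)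
    simp only [mul_ite, mul_one, mul_zero, smul_eq_mul,
      Finset.sum_ite_eq, Finset.sum_ite_eq', Finset.mem_univ, if_true, Finset.sum_ite_irrel,
      Finset.sum_const_zero]
    -- For L replaced by the identity matrix both sides collapse to the same entry of `S` with
    -- signs; these agree because `S` is even.
    have := S_even i j k l
    rcases pr_cases i with h5 | h5 <;> rcases pr_cases k with h6 | h6 <;>
    rcases pr_cases j with h3 | h3 <;> rcases pr_cases l with h4 | h4 <;>
    simp [h3, h4, h5, h6, sg] at this ⊢ <;> norm_num
  · intro ε ε' h h'
    exact U.algHom_ext fun i j => by rw [h, h']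

/-- The underlying supermodule of `B` is a supermodule. -/
theorem SMAlg.IsSupermoduleSuperalgebra.isSMod {Δ : U n →ₗ[K] U n ⊗[K] U n} {ε : U n →ₐ[K] K}
    {B : SMAlg n} (h : B.IsSupermoduleSuperalgebra Δ ε) : IsSMod B.par B.act :=
  ⟨h.par_par, h.one_act, h.mul_act, h.par_act⟩

/-- An action is determined by the generators, so the action through Δ is the one given by the
matrix product. Later equivariance proofs can thus avoid Δ and its signs. -/
theorem tensorAct_isSMod {Δ : U n →ₗ[K] U n ⊗[K] U n} (hΔ : IsComul n Δ) {B C : SMAlg n}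
    (hB : IsSMod B.par B.act) (hC : IsSMod C.par C.act) :
    IsSMod (TensorProduct.map B.par C.par) (tensorAct Δ B C) ∧
      ∀ a b, Lt (TensorProduct.map B.par C.par) (tensorAct Δ B C) a b =
        ∑ c, TensorProduct.map (Lt B.par B.act a c) (Lt C.par C.act c b) := by
  obtain ⟨γ, h, hγ, hγL⟩ := exists_tensor_act hB hC
  rw [isComul_iff] at hΔ
  have key : tensorAct Δ B C = γ := by
    refine TensorProduct.ext' fun u w => ?_
    change superAct B.par B.act C.act (Δ u ⊗ₜ w) = γ (u ⊗ₜ w)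
    induction u using U.induction generalizing w with
    | one => rw [hΔ.1, superAct_one hB hC, h.one_act]
    | add x y hx hy => simp only [TensorProduct.add_tmul, map_add, hx w, hy w]
    | smul c x hx => simp only [← TensorProduct.smul_tmul', map_smul, hx w]
    | mul i j x hx =>
      rw [hΔ.2.1, hΔ.2.2, superAct_superAct hB hC, hx, h.mul_act, hγL]
  rw [key]
  exact ⟨h, fun a b => by rw [hγ]⟩

end

/-! ### The operators of `L` on `A_{r,n}` -/

section

variable {n r : ℕ}

theorem parA_tp (i : Fin r) (a : Idx n) : parA r n (tp i a) = sg (pr a) • tp i a := by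
  refine (quotPar_mk tPar (ARel r n) (ARel_homogeneous r n)
    (FreeAlgebra.ι K (posIdx i, a))).trans ?_
  have : freePar tPar (FreeAlgebra.ι K (posIdx i, a)) =
      sg (pr a) • FreeAlgebra.ι K (posIdx i, a) := by
    simp [freePar, tPar, pr_of_pos (posIdx_pos i)]
  rw [this]
  exact map_smul (RingQuot.mkAlgHom K (ARel r n)) _ _

theorem parA_parA (x : A r n) : parA r n (parA r n x) = x := by
  induction x using A.induction with
  | one => rw [map_one, map_one]
  | add x y hx hy => rw [map_add, map_add, hx, hy]
  | smul c x hx => rw [map_smul, map_smul, hx]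
  | mul i a x hx =>
    rw [map_mul, map_mul, hx, parA_tp, map_smul, parA_tp, smul_smul, sg_mul_self, one_smul]

theorem sum_comm_single_pair {α β γ M : Type*} [Fintype α] [Fintype β] [Fintype γ]
    [AddCommMonoid M] (f : α → β → γ → M) :
    ∑ a, ∑ b, ∑ c, f a b c = ∑ b, ∑ c, ∑ a, f a b c := by
  rw [Finset.sum_comm]
  exact Finset.sum_congr rfl fun b _ => Finset.sum_comm

/-- The matrix of the operators of `L` on `A_{r,n}`. -/
theorem exists_coord_matrix (r n : ℕ) : ∃ f : A r n →ₐ[K] Matrix (Idx n) (Idx n) (A r n),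
    ∀ i e a b, f (tp i e) a b = ∑ c, R e b a c • tp i c := by
  obtain ⟨f, hf⟩ := exists_lift (B := Matrix (Idx n) (Idx n) (A r n))
    (fun (i : Fin r) e => Matrix.of fun a b => ∑ c, R e b a c • (tp i c : A r n)) (by
    intro i j hij a b
    ext p s
    simp only [Matrix.smul_apply, Matrix.mul_apply, Matrix.of_apply, Matrix.sum_apply]
    -- Both sides are expanded in the ordered products of row i with row j. Their coefficients are
    -- the two sides of the braid relation.
    have lhs : (if i = j then q else 1) • ∑ m, (∑ x, R a m p x • (tp j x : A r n)) *
        (∑ y, R b s m y • tp i y) = ∑ g, ∑ h, (∑ m, ∑ y, ∑ x, R b s m y * R a m p x * R x y g h) •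
          (tp i g * tp j h) := by
      simp only [Finset.sum_mul_sum, smul_mul_smul_comm, Finset.smul_sum]
      have : ∀ m x y, (if i = j then q else 1) • (R a m p x * R b s m y) • (tp j x * tp i y : A r n) =
          ∑ g, ∑ h, (R b s m y * R a m p x * R x y g h) • (tp i g * tp j h) := by
        intro m x y
        rw [smul_comm, tp_relation hij]
        simp only [Finset.smul_sum, smul_smul, mul_comm (R a m p x)]
      simp only [this, Finset.sum_smul]
      rw [Finset.sum_congr rfl fun m _ => sum_comm_pairs _, Finset.sum_comm]
      refine Finset.sum_congr rfl fun g _ => ?_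
      rw [Finset.sum_comm]
      exact Finset.sum_congr rfl fun h _ => Finset.sum_congr rfl fun m _ => Finset.sum_comm
    have rhs : ∑ d, ∑ c, R a b d c • ∑ m, (∑ g, R d m p g • (tp i g : A r n)) *
        (∑ h, R c s m h • tp j h) =
        ∑ g, ∑ h, (∑ d, ∑ c, ∑ m, R a b d c * R c s m h * R d m p g) • (tp i g * tp j h) := by
      simp only [Finset.sum_mul_sum, smul_mul_smul_comm, Finset.smul_sum, smul_smul,
        Finset.sum_smul]
      rw [Finset.sum_congr rfl fun d _ => Finset.sum_congr rfl fun c _ => sum_comm_single_pair _,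
        sum_comm_pairs]
      refine Finset.sum_congr rfl fun g _ => Finset.sum_congr rfl fun h _ =>
        Finset.sum_congr rfl fun d _ => Finset.sum_congr rfl fun c _ =>
        Finset.sum_congr rfl fun m _ => ?_
      rw [mul_assoc, mul_comm (R d m p g)]
    rw [lhs, rhs]
    simp only [R_braid])
  exact ⟨f, fun i e a b => by rw [hf]; rfl⟩

/-- Since `f` is multiplicative, its double entries on a product are convolutions of those on the
factors. Hence `rll_convolution` propagates the relation from generators to words. -/
theorem rll_coord (f : A r n →ₐ[K] Matrix (Idx n) (Idx n) (A r n))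
    (hf : ∀ m e i j k l, ∑ a, ∑ b, R j l b a • f (f (tp m e) k b) i a =
      ∑ a, ∑ b, R a b k i • f (f (tp m e) a j) b l) (x : A r n) (i j k l : Idx n) :
    ∑ a, ∑ b, R j l b a • f (f x k b) i a = ∑ a, ∑ b, R a b k i • f (f x a j) b l := by
  have f_mul : ∀ x y a b, f (x * y) a b = ∑ c, f x a c * f y c b := fun x y a b => by
    rw [map_mul, Matrix.mul_apply]
  have f_one : ∀ a b, f 1 a b = if a = b then 1 else 0 := fun a b => by
    rw [map_one, Matrix.one_apply]
  have f_ite : ∀ (p : Prop) [Decidable p] a b,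
      f (if p then 1 else 0) a b = if p then (if a = b then 1 else 0) else 0 := fun p _ a b => by
    by_cases h : p
    · rw [if_pos h, if_pos h, f_one]
    · rw [if_neg h, if_neg h, map_zero, Matrix.zero_apply]
  induction x using A.induction generalizing i j k l with
  | one =>
    simp only [f_one, f_ite, smul_ite, smul_zero, Finset.sum_ite_eq, Finset.sum_ite_eq',
      Finset.mem_univ, if_true, Finset.sum_ite_irrel, Finset.sum_const_zero]
  | add x y hx hy =>
    simp only [map_add, Matrix.add_apply, smul_add, Finset.sum_add_distrib, hx, hy]
  | smul c x hx =>
    have h2 : ∀ (s : K) i a k b, s • f (f (c • x) k b) i a = c • s • f (f x k b) i a :=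
      fun s i a k b => by
        rw [map_smul, Matrix.smul_apply, map_smul, Matrix.smul_apply, smul_comm]
    simp only [h2]
    simp only [← Finset.smul_sum, hx]
  | mul m e x hx =>
    have h2 : ∀ i a k b, f (f (tp m e * x) k b) i a =
        ∑ c, ∑ d, LinearMap.mul K (A r n) (f (f (tp m e) k d) i c) (f (f x d b) c a) := by
      intro i a k b
      rw [f_mul, map_sum, Matrix.sum_apply, Finset.sum_comm]
      exact Finset.sum_congr rfl fun d _ => f_mul _ _ _ _
    simp only [h2]
    exact rll_convolution (X := fun i a k b => f (f (tp m e) k b) i a)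
      (Y := fun i a k b => f (f x k b) i a) (LinearMap.mul K (A r n)) (hf m e) hx i j k l

/-- On a generator RΛΛ = ΛΛR is once more the braid relation, triangularity is that of `R`, and the
diagonal condition is `R_diag_mul_R_diag_neg`. Each property then extends to words by
multiplicativity of `f`. -/
theorem isFRT_coord {f : A r n →ₐ[K] Matrix (Idx n) (Idx n) (A r n)}
    (hf : ∀ i e a b, f (tp i e) a b = ∑ c, R e b a c • tp i c) :
    IsFRT (E := Module.End K (A r n)) (parA r n).toLinearMap
      fun a b => Matrix.entryLinearMap K (A r n) a b ∘ₗ f.toLinearMap := by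
  have f_mul : ∀ x y a b, f (x * y) a b = ∑ c, f x a c * f y c b := fun x y a b => by
    rw [map_mul, Matrix.mul_apply]
  have f_one : ∀ a b, f 1 a b = if a = b then 1 else 0 := fun a b => by
    rw [map_one, Matrix.one_apply]
  have f_f : ∀ k e i a j b, f (f (tp k e) j b) i a =
      ∑ g, (∑ d, R e b j d * R d a i g) • (tp k g : A r n) := fun k e i a j b => by
    simp only [hf, map_sum, map_smul, Matrix.sum_apply, Matrix.smul_apply, Finset.smul_sum,
      smul_smul, Finset.sum_smul]
    rw [Finset.sum_comm]
  have rll_gen : ∀ m e i j k l, ∑ a, ∑ b, R j l b a • f (f (tp m e) k b) i a =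
      ∑ a, ∑ b, R a b k i • f (f (tp m e) a j) b l := fun m e i j k l => by
    simp only [f_f, Finset.smul_sum, smul_smul]
    have e1 : ∑ a, ∑ b, ∑ g, (R j l b a * ∑ d, R e b k d * R d a i g) • (tp m g : A r n) =
        ∑ g, (∑ b, ∑ a, ∑ d, R j l b a * R e b k d * R d a i g) • tp m g := by
      simp only [Finset.mul_sum, Finset.sum_smul, ← mul_assoc]
      rw [Finset.sum_comm, Finset.sum_congr rfl fun b _ => Finset.sum_comm, Finset.sum_comm]
    have e2 : ∑ a, ∑ b, ∑ g, (R a b k i * ∑ d, R e j a d * R d l b g) • (tp m g : A r n) =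
        ∑ g, (∑ a, ∑ d, ∑ b, R e j a d * R d l b g * R a b k i) • tp m g := by
      simp only [Finset.mul_sum, Finset.sum_smul]
      rw [Finset.sum_congr rfl fun a _ => Finset.sum_comm, Finset.sum_comm]
      refine Finset.sum_congr rfl fun g _ => Finset.sum_congr rfl fun a _ => ?_
      rw [Finset.sum_comm]
      refine Finset.sum_congr rfl fun d _ => Finset.sum_congr rfl fun b _ => ?_
      rw [mul_comm]
    rw [e1, e2]
    simp only [R_braid]
  have tri : ∀ x i j, j < i → f x i j = 0 := by
    intro x
    induction x using A.induction with
    | one => exact fun i j h => by rw [f_one, if_neg h.ne']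
    | add x y hx hy =>
      intro i j h
      rw [map_add, Matrix.add_apply, hx i j h, hy i j h, add_zero]
    | smul c x hx => exact fun i j h => by rw [map_smul, Matrix.smul_apply, hx i j h, smul_zero]
    | mul k e x hx =>
      intro i j h
      rw [f_mul]
      refine Finset.sum_eq_zero fun c _ => ?_
      rcases lt_or_ge c i with hc | hc
      · rw [hf, Finset.sum_eq_zero, zero_mul]
        exact fun d _ => by rw [R_eq_zero_of_lt hc, zero_smul]
      · rw [hx c j (h.trans_le hc), mul_zero]
  have diag : ∀ k e x i, f (tp k e * x) i i =
      (sg (pr e * pr i) * q ^ phi e i) • (tp k e * f x i i) := by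
    intro k e x i
    rw [f_mul, Finset.sum_eq_single i]
    · simp only [hf, R_diag, ite_smul, zero_smul, Finset.sum_ite_eq', Finset.mem_univ, if_true,
        smul_mul_assoc]
    · intro c _ hc
      rcases lt_or_gt_of_ne hc with hc | hc
      · rw [tri _ _ _ hc, zero_mul]
      · rw [tri x _ _ hc, mul_zero]
    · simp
  have par_gen : ∀ k e i j, parA r n (f (tp k e) i j) =
      sg (pr i + pr j) • f (parA r n (tp k e)) i j := by
    intro k e i j
    rw [parA_tp, map_smul, Matrix.smul_apply, hf, map_sum, Finset.smul_sum, Finset.smul_sum]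
    refine Finset.sum_congr rfl fun c _ => ?_
    rw [map_smul, parA_tp, smul_smul, smul_smul, smul_smul]
    congr 1
    have h := R_even e j i c
    simp only [sg_add] at h ⊢
    have h1 := sg_mul_self (pr i)
    linear_combination (sg (pr i)) * h - sg (pr c) * R e j i c * h1
  refine ⟨LinearMap.ext parA_parA, fun i j hij => LinearMap.ext fun x => tri x i j hij, fun i => ?_,
    fun i j => ?_, fun i j k l => ?_⟩
  · refine LinearMap.ext fun x => ?_
    change f (f x (-i) (-i)) i i = parA r n x
    induction x using A.induction with
    | one => rw [f_one, if_pos rfl, f_one, if_pos rfl, map_one]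
    | add x y hx hy => simp only [map_add, Matrix.add_apply, hx, hy]
    | smul c x hx => simp only [map_smul, Matrix.smul_apply, hx]
    | mul k e x hx =>
      rw [diag, map_smul, Matrix.smul_apply, diag, hx, smul_smul, mul_comm,
        R_diag_mul_R_diag_neg, map_mul, parA_tp, smul_mul_assoc]
  · refine LinearMap.ext fun x => ?_
    change parA r n (f x i j) = sg (pr i + pr j) • f (parA r n x) i j
    induction x using A.induction generalizing i j with
    | one =>
      rw [map_one (parA r n), f_one]
      split_ifs with h
      · rw [h, sg_add, sg_mul_self, one_smul, map_one]
      · rw [map_zero, smul_zero]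
    | add x y hx hy => simp only [map_add, Matrix.add_apply, hx, hy, smul_add]
    | smul c x hx =>
      rw [map_smul, map_smul, Matrix.smul_apply, map_smul, map_smul, Matrix.smul_apply, hx,
        smul_comm]
    | mul k e x hx =>
      rw [f_mul, map_sum, map_mul, f_mul, Finset.smul_sum]
      refine Finset.sum_congr rfl fun c _ => ?_
      rw [map_mul, par_gen, hx, smul_mul_smul_comm]
      congr 1
      simp only [sg_add]
      linear_combination (sg (pr i) * sg (pr j)) * sg_mul_self (pr c)
  · refine LinearMap.ext fun x => ?_
    simp only [LinearMap.sum_apply, LinearMap.smul_apply]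
    exact rll_coord f rll_gen x i j k l

end

/-! ### The action on `A_{r,n}` -/

section

variable {n r : ℕ} {Δ : U n →ₗ[K] U n ⊗[K] U n} {ε : U n →ₐ[K] K}

theorem pow_apply_of_fixed {M : Type*} [AddCommGroup M] [Module K M] {P : Module.End K M} {m : M}
    (h : P m = m) (e : ℕ) : (P ^ e) m = m := by
  induction e with
  | zero => rfl
  | succ e ih => rw [pow_succ', Module.End.mul_apply, ih, h]

namespace SMAlg

variable {B : SMAlg n}

theorem IsSupermoduleSuperalgebra.Lt_one (hε : IsCounit n ε)
    (h : B.IsSupermoduleSuperalgebra Δ ε) (a b : Idx n) :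
    Lt B.par B.act a b B.one = if a = b then B.one else 0 := by
  rw [Lt_apply, h.act_one, hε, map_smul, pow_apply_of_fixed h.par_one, ite_smul, one_smul,
    zero_smul]

/-- The parity twist in `Lt` absorbs the signs of the Leibniz rule, leaving a matrix product. -/
theorem IsSupermoduleSuperalgebra.Lt_mul (hΔ : IsComul n Δ)
    (h : B.IsSupermoduleSuperalgebra Δ ε) (a b : Idx n) (x y : B) :
    Lt B.par B.act a b (B.mul (x ⊗ₜ y)) =
      ∑ c, B.mul (Lt B.par B.act a c x ⊗ₜ Lt B.par B.act c b y) := by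
  have hp : ∀ z, B.mul (TensorProduct.map B.par B.par z) = B.par (B.mul z) := fun z => by
    induction z using TensorProduct.induction_on with
    | zero => simp
    | tmul x y => rw [TensorProduct.map_tmul, h.par_mul]
    | add x y hx hy => simp only [map_add, hx, hy]
  rw [Lt_apply, h.act_mul, ← map_pow_apply hp, ← Lt_apply,
    (tensorAct_isSMod hΔ h.isSMod h.isSMod).2]
  simp only [LinearMap.sum_apply, TensorProduct.map_tmul, map_sum]

/-- The compatibility of the action with unit and multiplication can be checked on `L`. -/
theorem isSupermoduleSuperalgebra_of_Lt (hΔ : IsComul n Δ) (hε : IsCounit n ε)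
    (h : IsSMod B.par B.act)
    (mul_assoc : ∀ a b c : B, B.mul (B.mul (a ⊗ₜ b) ⊗ₜ c) = B.mul (a ⊗ₜ B.mul (b ⊗ₜ c)))
    (one_mul : ∀ a : B, B.mul (B.one ⊗ₜ a) = a)
    (mul_one : ∀ a : B, B.mul (a ⊗ₜ B.one) = a)
    (par_one : B.par B.one = B.one)
    (par_mul : ∀ a b : B, B.par (B.mul (a ⊗ₜ b)) = B.mul (B.par a ⊗ₜ B.par b))
    (Lt_one : ∀ a b, Lt B.par B.act a b B.one = if a = b then B.one else 0)
    (Lt_mul : ∀ a b (x y : B), Lt B.par B.act a b (B.mul (x ⊗ₜ y)) =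
      ∑ c, B.mul (Lt B.par B.act a c x ⊗ₜ Lt B.par B.act c b y)) :
    B.IsSupermoduleSuperalgebra Δ ε := by
  have hT := tensorAct_isSMod hΔ h h
  refine ⟨h.par_par, mul_assoc, one_mul, mul_one, par_one, par_mul, h.one_act, h.mul_act,
    h.par_act, fun u a b => (hT.1.map_act h (fun z => ?_) (fun a b z => ?_) u (a ⊗ₜ b)).symm,
    fun u => ?_⟩
  · induction z using TensorProduct.induction_on with
    | zero => simp
    | tmul x y => rw [TensorProduct.map_tmul, par_mul]
    | add x y hx hy => simp only [map_add, hx, hy]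
  · rw [hT.2]
    induction z using TensorProduct.induction_on with
    | zero => simp
    | tmul x y => simp only [LinearMap.sum_apply, TensorProduct.map_tmul, map_sum, Lt_mul]
    | add x y hx hy => rw [map_add, map_add, hx, hy, map_add, map_add]
  · induction u using U.induction with
    | one => rw [h.one_act, map_one, one_smul]
    | add x y hx hy => rw [TensorProduct.add_tmul, map_add, hx, hy, map_add, add_smul]
    | smul c x hx => rw [← TensorProduct.smul_tmul', map_smul, hx, map_smul, smul_assoc]
    | mul i j x hx =>
      rw [h.mul_act, hx, TensorProduct.tmul_smul, map_smul, h.act_L, Lt_one, map_mul, hε, mul_comm,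
        mul_smul]
      split_ifs
      · rw [pow_apply_of_fixed par_one, one_smul]
      · rw [map_zero, zero_smul]

end SMAlg

/-- This reconciles the signs in the normalization T S^{13} with those of `R`; they agree only where
the entry of `S` is nonzero, by evenness. -/
theorem coord_coefficient (a b c d : Idx n) :
    sg ((pr a + pr b) * pr c) * (sg (pr d * (pr d + pr c)) * S d c a b) * sg (pr b * pr d) =
      R c b a d := by
  unfold R
  by_cases hS : S d c a b = 0
  · simp only [hS, mul_zero, zero_mul]
  have h := mul_right_cancel₀ hS (S_even d c a b)
  rcases pr_cases c with hk | hk <;> rcases pr_cases d with hl | hl <;>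
  rcases pr_cases a with ha | ha <;> rcases pr_cases b with hb | hb <;>
  rw [hk, hl, ha, hb] at h ⊢ <;> norm_num [sg] at h <;> norm_num [sg]

theorem parA_pow_tp (e : ℕ) (i : Fin r) (d : Idx n) :
    (((parA r n).toLinearMap : Module.End K (A r n)) ^ e) (tp i d) = sg (e * pr d) • tp i d := by
  induction e with
  | zero => simp [sg]
  | succ e ih =>
    rw [pow_succ', Module.End.mul_apply, ih, map_smul, AlgHom.toLinearMap_apply, parA_tp, smul_smul,
      ← sg_add, add_mul, one_mul]

theorem Lt_tp_iff (Φ : U n ⊗[K] A r n →ₗ[K] A r n) (h : IsSMod (parA r n).toLinearMap Φ)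
    (i : Fin r) (a b c : Idx n) :
    (sg ((pr a + pr b) * (pr (posIdx i) + pr c)) • Φ (L a b ⊗ₜ t (posIdx i) c) =
      ∑ d : Idx n, (sg ((pr (posIdx i) + pr d) * (pr d + pr c)) * S d c a b) •
        (t (posIdx i) d : A r n)) ↔
    Lt (parA r n).toLinearMap Φ a b (tp i c) = ∑ d, R c b a d • tp i d := by
  change (_ • Φ (L a b ⊗ₜ tp i c) = ∑ d, _ • tp i d) ↔ _
  rw [pr_of_pos (posIdx_pos i)]
  simp only [zero_add]
  have h1 := h.act_L a b (tp i c)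
  constructor
  · intro H
    rw [Lt_apply]
    have H' := congrArg (sg ((pr a + pr b) * pr c) • ·) H
    simp only [smul_smul, sg_mul_self, one_smul, Finset.smul_sum] at H'
    rw [H', map_sum]
    refine Finset.sum_congr rfl fun d _ => ?_
    rw [map_smul, parA_pow_tp, smul_smul, coord_coefficient]
  · intro H
    rw [h1, H, map_sum, Finset.smul_sum]
    refine Finset.sum_congr rfl fun d _ => ?_
    rw [map_smul, parA_pow_tp, smul_smul, smul_smul, ← coord_coefficient]
    congr 1
    have e1 := sg_mul_self ((pr a + pr b) * pr c)
    have e2 := sg_mul_self (pr b * pr d)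
    linear_combination sg (pr d * (pr d + pr c)) * S d c a b * e1 +
      sg ((pr a + pr b) * pr c) * sg ((pr a + pr b) * pr c) * sg (pr d * (pr d + pr c)) *
        S d c a b * e2

theorem IsCoordAction.isSMod {Φ : U n ⊗[K] A r n →ₗ[K] A r n} (h : IsCoordAction Δ ε r Φ) :
    IsSMod (parA r n).toLinearMap Φ := h.1.isSMod

theorem IsCoordAction.Lt_tp {Φ : U n ⊗[K] A r n →ₗ[K] A r n} (h : IsCoordAction Δ ε r Φ)
    (i : Fin r) (a b c : Idx n) :
    Lt (parA r n).toLinearMap Φ a b (tp i c) = ∑ d, R c b a d • tp i d :=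
  (Lt_tp_iff Φ h.isSMod i a b c).1 (h.2 (posIdx i) a b c)

theorem IsCoordAction.Lt_one {Φ : U n ⊗[K] A r n →ₗ[K] A r n} (hε : IsCounit n ε)
    (h : IsCoordAction Δ ε r Φ) (a b : Idx n) :
    Lt (parA r n).toLinearMap Φ a b 1 = if a = b then 1 else 0 := h.1.Lt_one hε a b

theorem IsCoordAction.Lt_mul {Φ : U n ⊗[K] A r n →ₗ[K] A r n} (hΔ : IsComul n Δ)
    (h : IsCoordAction Δ ε r Φ) (a b : Idx n) (x y : A r n) :
    Lt (parA r n).toLinearMap Φ a b (x * y) =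
      ∑ c, Lt (parA r n).toLinearMap Φ a c x * Lt (parA r n).toLinearMap Φ c b y :=
  h.1.Lt_mul hΔ a b x y

theorem existsUnique_coordAction (hΔ : IsComul n Δ) (hε : IsCounit n ε) (r : ℕ) :
    ∃! Φ : U n ⊗[K] A r n →ₗ[K] A r n, IsCoordAction Δ ε r Φ := by
  refine existsUnique_of_exists_of_unique ?_ ?_
  · obtain ⟨f, hf⟩ := exists_coord_matrix r n
    obtain ⟨Φ, hΦ, hL⟩ := (isFRT_coord hf).exists_act
    have hL' : ∀ a b x, Lt (parA r n).toLinearMap Φ a b x = f x a b := fun a b x => by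
      rw [hL]; rfl
    refine ⟨Φ, SMAlg.isSupermoduleSuperalgebra_of_Lt hΔ hε hΦ (fun a b c => ?_) (fun a => ?_)
      (fun a => ?_) (map_one (parA r n)) (fun a b => ?_) (fun a b => ?_) (fun a b x y => ?_), ?_⟩
    · simp [mul_assoc]
    · simp
    · simp
    · simp
    · change Lt (parA r n).toLinearMap Φ a b 1 = _
      rw [hL', map_one, Matrix.one_apply]
    · change Lt (parA r n).toLinearMap Φ a b (x * y) =
        ∑ c, Lt (parA r n).toLinearMap Φ a c x * Lt (parA r n).toLinearMap Φ c b y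
      simp only [hL', map_mul, Matrix.mul_apply]
    · have hpos : ∀ (i : Idx r), 0 < i.1 → ∀ a b c : Idx n,
        sg ((pr a + pr b) * (pr i + pr c)) • Φ (L a b ⊗ₜ t i c) =
          ∑ d : Idx n, (sg ((pr i + pr d) * (pr d + pr c)) * S d c a b) • (t i d : A r n) := by
        intro i hi a b c
        obtain ⟨i, rfl⟩ := exists_posIdx hi
        rw [Lt_tp_iff Φ hΦ, hL', hf]
      intro i a b c
      -- The normalization on a negative row is the one on the opposite positive row, by t_{-i,-a} =
      -- t_{ia} and `S_neg_left`.
      rcases i.pos_or with hi | ⟨i, hi, rfl⟩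
      · exact hpos i hi a b c
      · obtain ⟨c, rfl⟩ : ∃ c', c = -c' := ⟨-c, (Idx.neg_neg c).symm⟩
        rw [t_neg, ← sum_neg]
        simp only [t_neg, S_neg_left]
        have e1 : sg ((pr a + pr b) * (pr (-i) + pr (-c))) =
            sg ((pr a + pr b) * (pr i + pr c)) := by
          rw [pr_neg, pr_neg]
          rcases pr_cases i with hi | hi <;> rcases pr_cases c with hk | hk <;>
            rcases pr_cases a with ha | ha <;> rcases pr_cases b with hb | hb <;>
            norm_num [hk, hi, ha, hb, sg]
        have e2 : ∀ d : Idx n, sg ((pr (-i) + pr (-d)) * (pr (-d) + pr (-c))) =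
            sg ((pr i + pr d) * (pr d + pr c)) := fun d => by
          rw [pr_neg, pr_neg, pr_neg]
          rcases pr_cases i with hi | hi <;> rcases pr_cases c with hk | hk <;>
            rcases pr_cases d with hd | hd <;> norm_num [hk, hd, hi, sg]
        simp only [e1, e2]
        exact hpos i hi a b c
  · intro Φ Φ' h h'
    have : ∀ a b x, Lt (parA r n).toLinearMap Φ a b x = Lt (parA r n).toLinearMap Φ' a b x := by
      intro a b x
      induction x using A.induction generalizing a b with
      | one => rw [h.Lt_one hε, h'.Lt_one hε]
      | add x y hx hy => rw [map_add, map_add, hx, hy]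
      | smul c x hx => rw [map_smul, map_smul, hx]
      | mul i c x hx => simp only [h.Lt_mul hΔ, h'.Lt_mul hΔ, hx, h.Lt_tp, h'.Lt_tp]
    exact TensorProduct.ext' fun u x =>
      h.isSMod.map_act h'.isSMod (f := LinearMap.id) (fun _ => rfl) this u x

end

/-! ### Moving vectors past elements of `A_{r,n}` -/

section

section Hexagon
variable {V W X : Type} [AddCommGroup V] [AddCommGroup W] [AddCommGroup X]
  [Module K V] [Module K W] [Module K X]

/-- Insert `x` to the right of `w` in `w ⊗ v`, moving `v` past it. -/
def moveRight (θ : V ⊗[K] X →ₗ[K] X ⊗[K] V) (x : X) : W ⊗[K] V →ₗ[K] (W ⊗[K] X) ⊗[K] V :=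
  (TensorProduct.assoc K W X V).symm.toLinearMap ∘ₗ
    LinearMap.lTensor W (θ ∘ₗ (TensorProduct.mk K V X).flip x)

/-- Insert `v` to the left of `w` in `x ⊗ w`, moving it past `x`. -/
def moveLeft (θ : V ⊗[K] X →ₗ[K] X ⊗[K] V) (v : V) : X ⊗[K] W →ₗ[K] X ⊗[K] (V ⊗[K] W) :=
  (TensorProduct.assoc K X V W).toLinearMap ∘ₗ LinearMap.rTensor W (θ ∘ₗ TensorProduct.mk K V X v)

theorem moveRight_tmul (θ : V ⊗[K] X →ₗ[K] X ⊗[K] V) (x : X) (w : W) (v : V) :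
    moveRight θ x (w ⊗ₜ v) = LinearMap.rTensor V (TensorProduct.mk K W X w) (θ (v ⊗ₜ x)) := by
  simp only [moveRight, LinearMap.comp_apply, LinearMap.lTensor_tmul, LinearMap.flip_apply,
    TensorProduct.mk_apply, LinearEquiv.coe_coe]
  induction θ (v ⊗ₜ x) using TensorProduct.induction_on with
  | zero => simp
  | tmul x v => simp
  | add a b ha hb => simp only [TensorProduct.tmul_add, map_add, ha, hb]

theorem moveLeft_tmul (θ : V ⊗[K] X →ₗ[K] X ⊗[K] V) (v : V) (x : X) (w : W) :
    moveLeft θ v (x ⊗ₜ w) =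
      LinearMap.lTensor X ((TensorProduct.mk K V W).flip w) (θ (v ⊗ₜ x)) := by
  simp only [moveLeft, LinearMap.comp_apply, LinearMap.rTensor_tmul,
    TensorProduct.mk_apply, LinearEquiv.coe_coe]
  induction θ (v ⊗ₜ x) using TensorProduct.induction_on with
  | zero => simp
  | tmul x v => simp
  | add a b ha hb => simp only [TensorProduct.add_tmul, map_add, ha, hb]

theorem hexL_tmul (θ : V ⊗[K] W →ₗ[K] W ⊗[K] V) (θ' : V ⊗[K] X →ₗ[K] X ⊗[K] V) (v : V) (w : W)
    (x : X) : hexL θ θ' (v ⊗ₜ (w ⊗ₜ x)) = moveRight θ' x (θ (v ⊗ₜ w)) := by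
  simp only [hexL, LinearMap.comp_apply, LinearEquiv.coe_coe, TensorProduct.assoc_symm_tmul,
    LinearMap.rTensor_tmul]
  induction θ (v ⊗ₜ w) using TensorProduct.induction_on with
  | zero => simp
  | tmul w v => rfl
  | add a b ha hb => simp only [TensorProduct.add_tmul, map_add, ha, hb]

theorem hexR_tmul (θ : V ⊗[K] X →ₗ[K] X ⊗[K] V) (θ' : W ⊗[K] X →ₗ[K] X ⊗[K] W) (v : V) (w : W)
    (x : X) : hexR θ θ' ((v ⊗ₜ w) ⊗ₜ x) = moveLeft θ v (θ' (w ⊗ₜ x)) := by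
  simp only [hexR, LinearMap.comp_apply, LinearEquiv.coe_coe, TensorProduct.assoc_tmul,
    LinearMap.lTensor_tmul]
  induction θ' (w ⊗ₜ x) using TensorProduct.induction_on with
  | zero => simp
  | tmul x w => rfl
  | add a b ha hb => simp only [TensorProduct.tmul_add, map_add, ha, hb]

end Hexagon

variable {n r : ℕ}

theorem sum_comm_outer {α β γ δ M : Type*} [Fintype α] [Fintype β] [Fintype γ] [Fintype δ]
    [AddCommMonoid M] (f : α → β → γ → δ → M) :
    ∑ a, ∑ b, ∑ c, ∑ d, f a b c d = ∑ d, ∑ b, ∑ c, ∑ a, f a b c d := by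
  rw [Finset.sum_congr rfl fun a _ => (sum_comm_single_pair fun d b c => f a b c d).symm,
    Finset.sum_comm]
  exact Finset.sum_congr rfl fun d _ => sum_comm_single_pair _

section Transport
variable {M : Type} [AddCommGroup M] [Module K M]

/-- `θ` moves vectors of a module past elements of `A_{r,n}` by letting `L` act on them. -/
structure IsTransport (Λ : Idx n → Idx n → Module.End K M)
    (θ : M ⊗[K] A r n →ₗ[K] A r n ⊗[K] M) : Prop where
  one : ∀ y, θ (y ⊗ₜ 1) = 1 ⊗ₜ y
  cons : ∀ y i a x, θ (y ⊗ₜ (tp i a * x)) =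
    ∑ d, LinearMap.rTensor M (LinearMap.mulLeft K (tp i d : A r n)) (θ (Λ d a y ⊗ₜ x))

/-- Send t_{ia} to ∑ t_{id} ⊗ Λ_{da} in A ⊗ End(M)^op. The opposite algebra appears because the
vector meets the leftmost generator first. The relations of A_{r,n} are respected exactly by RΛΛ =
ΛΛR. -/
theorem IsFRT.exists_transport {P : Module.End K M} {Λ : Idx n → Idx n → Module.End K M}
    (h : IsFRT P Λ) (r : ℕ) : ∃ θ : M ⊗[K] A r n →ₗ[K] A r n ⊗[K] M, IsTransport Λ θ := by
  obtain ⟨F, hF⟩ := QueerBraid.exists_lift (r := r) (B := A r n ⊗[K] (Module.End K M)ᵐᵒᵖ)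
    (fun i a => ∑ d, tp i d ⊗ₜ MulOpposite.op (Λ d a)) (by
    intro i j hij a b
    have lhs : (if i = j then q else 1) • ((∑ f, (tp j f : A r n) ⊗ₜ[K] MulOpposite.op (Λ f a)) *
        ∑ e, tp i e ⊗ₜ MulOpposite.op (Λ e b)) =
        ∑ g, ∑ h, (tp i g * tp j h : A r n) ⊗ₜ[K]
          MulOpposite.op (∑ f, ∑ e, R f e g h • (Λ e b * Λ f a)) := by
      simp only [Finset.sum_mul_sum, Algebra.TensorProduct.tmul_mul_tmul, Finset.smul_sum,
        TensorProduct.smul_tmul', tp_relation hij, ← MulOpposite.op_mul, Finset.op_sum,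
        MulOpposite.op_smul, TensorProduct.tmul_sum, TensorProduct.sum_tmul,
        TensorProduct.tmul_smul]
      exact sum_comm_pairs _
    have rhs : ∑ d, ∑ c, R a b d c • ((∑ g, (tp i g : A r n) ⊗ₜ[K] MulOpposite.op (Λ g d)) *
        ∑ h, tp j h ⊗ₜ MulOpposite.op (Λ h c)) =
        ∑ g, ∑ h, (tp i g * tp j h : A r n) ⊗ₜ[K]
          MulOpposite.op (∑ c, ∑ d, R a b d c • (Λ h c * Λ g d)) := by
      simp only [Finset.sum_mul_sum, Algebra.TensorProduct.tmul_mul_tmul, Finset.smul_sum,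
        ← MulOpposite.op_mul, Finset.op_sum,
        MulOpposite.op_smul, TensorProduct.tmul_sum,
        TensorProduct.tmul_smul]
      rw [sum_comm_pairs]
      exact Finset.sum_congr rfl fun _ _ => Finset.sum_congr rfl fun _ _ => Finset.sum_comm
    rw [lhs, rhs]
    simp only [h.rll])
  let ev : M →ₗ[K] (Module.End K M)ᵐᵒᵖ →ₗ[K] M :=
    (LinearMap.id.comp (MulOpposite.opLinearEquiv K).symm.toLinearMap).flip
  let θ : M ⊗[K] A r n →ₗ[K] A r n ⊗[K] M := TensorProduct.lift
    ((LinearMap.lTensorHom (A r n) ∘ₗ ev).compl₂ F.toLinearMap)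
  have hθ : ∀ y x, θ (y ⊗ₜ x) = LinearMap.lTensor (A r n) (ev y) (F x) := fun y x => rfl
  refine ⟨θ, fun y => ?_, fun y i a x => ?_⟩
  · rw [hθ, show F 1 = 1 from F.map_one', Algebra.TensorProduct.one_def, LinearMap.lTensor_tmul]
    rfl
  · simp only [hθ, map_mul, hF, Finset.sum_mul, map_sum]
    refine Finset.sum_congr rfl fun d _ => ?_
    induction F x using TensorProduct.induction_on with
    | zero => simp
    | tmul x v => rw [Algebra.TensorProduct.tmul_mul_tmul]; rfl
    | add a b ha hb => simp only [mul_add, map_add, ha, hb]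

variable {Λ : Idx n → Idx n → Module.End K M} {θ θ' : M ⊗[K] A r n →ₗ[K] A r n ⊗[K] M}

theorem IsTransport.unique (h : IsTransport Λ θ) (h' : IsTransport Λ θ') : θ = θ' := by
  refine TensorProduct.ext' fun y x => ?_
  induction x using A.induction generalizing y with
  | one => rw [h.one, h'.one]
  | add x x' hx hx' => rw [TensorProduct.tmul_add, map_add, map_add, hx, hx']
  | smul c x hx => rw [TensorProduct.tmul_smul, map_smul, map_smul, hx]
  | mul i a x hx => simp only [h.cons, h'.cons, hx]

/-- Compatibility with the multiplication of A_{r,n} is built into the recursion and uses no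
relation between the operators Λ. -/
theorem IsTransport.tmul_mul (h : IsTransport Λ θ) (y : M) (x x' : A r n) :
    θ (y ⊗ₜ (x * x')) =
      LinearMap.rTensor M (LinearMap.mul' K (A r n)) (moveRight θ x' (θ (y ⊗ₜ x))) := by
  induction x using A.induction generalizing y with
  | one =>
    rw [one_mul, h.one, moveRight_tmul]
    induction θ (y ⊗ₜ x') using TensorProduct.induction_on with
    | zero => simp
    | tmul x v => simp
    | add a b ha hb => rw [map_add, map_add, ← ha, ← hb]
  | add x y hx hy => simp only [add_mul, TensorProduct.tmul_add, map_add, hx, hy]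
  | smul c x hx => simp only [smul_mul_assoc, TensorProduct.tmul_smul, map_smul, hx]
  | mul i a x hx =>
    rw [mul_assoc, h.cons, h.cons]
    simp only [map_sum, hx]
    refine Finset.sum_congr rfl fun d _ => ?_
    induction θ (Λ d a y ⊗ₜ x) using TensorProduct.induction_on with
    | zero => simp
    | add a b ha hb => simp only [map_add, ha, hb]
    | tmul z v =>
      rw [LinearMap.rTensor_tmul, moveRight_tmul, moveRight_tmul]
      induction θ (v ⊗ₜ x') using TensorProduct.induction_on with
      | zero => simp
      | add a b ha hb => simp only [map_add, ha, hb]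
      | tmul z v => simp [mul_assoc]

theorem IsTransport.moveLeft_mulLeft {N : Type} [AddCommGroup N] [Module K N]
    (h : IsTransport Λ θ) (y : M) (i : Fin r) (c : Idx n) (z : A r n ⊗[K] N) :
    moveLeft θ y (LinearMap.rTensor N (LinearMap.mulLeft K (tp i c)) z) =
      ∑ d, LinearMap.rTensor (M ⊗[K] N) (LinearMap.mulLeft K (tp i d))
        (moveLeft θ (Λ d c y) z) := by
  induction z using TensorProduct.induction_on with
  | zero => simp
  | add a b ha hb => simp only [map_add, ha, hb, Finset.sum_add_distrib]
  | tmul x w =>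
    rw [LinearMap.rTensor_tmul, moveLeft_tmul, LinearMap.mulLeft_apply, h.cons, map_sum]
    refine Finset.sum_congr rfl fun d _ => ?_
    rw [moveLeft_tmul]
    induction θ (Λ d c y ⊗ₜ x) using TensorProduct.induction_on with
    | zero => simp
    | add a b ha hb => simp only [map_add, ha, hb]
    | tmul z v => simp

variable {P : Module.End K M}

theorem IsTransport.par_comm (h : IsTransport Λ θ) (hF : IsFRT P Λ) (y : M) (x : A r n) :
    θ (P y ⊗ₜ parA r n x) = TensorProduct.map (parA r n).toLinearMap P (θ (y ⊗ₜ x)) := by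
  induction x using A.induction generalizing y with
  | one => rw [map_one (parA r n), h.one, h.one, TensorProduct.map_tmul, AlgHom.toLinearMap_apply,
      map_one (parA r n)]
  | add x y hx hy => simp only [map_add, TensorProduct.tmul_add, hx, hy]
  | smul c x hx => simp only [map_smul, TensorProduct.tmul_smul, hx]
  | mul i a x hx =>
    rw [map_mul, parA_tp, smul_mul_assoc, TensorProduct.tmul_smul, map_smul, h.cons, h.cons,
      map_sum, Finset.smul_sum]
    refine Finset.sum_congr rfl fun d _ => ?_
    have h1 : Λ d a (P y) = sg (pr d + pr a) • P (Λ d a y) := by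
      have := LinearMap.congr_fun (hF.par d a) y
      rw [LinearMap.smul_apply, Module.End.mul_apply, Module.End.mul_apply] at this
      rw [this, smul_smul, sg_mul_self, one_smul]
    rw [h1, ← TensorProduct.smul_tmul', map_smul, hx, map_smul, smul_smul, sg_add, mul_comm,
      mul_assoc, sg_mul_self, mul_one]
    induction θ (Λ d a y ⊗ₜ x) using TensorProduct.induction_on with
    | zero => simp
    | add a b ha hb => simp only [map_add, smul_add, ha, hb]
    | tmul z v =>
      simp [parA_tp, TensorProduct.smul_tmul']

variable {Φ : U n ⊗[K] A r n →ₗ[K] A r n} {Δ : U n →ₗ[K] U n ⊗[K] U n} {ε : U n →ₐ[K] K}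

theorem map_Lt_mulLeft (hΔ : IsComul n Δ) (hΦ : IsCoordAction Δ ε r Φ) (a c : Idx n)
    (f : Module.End K M) (i : Fin r) (g : Idx n)
    (z : A r n ⊗[K] M) :
    TensorProduct.map (Lt (parA r n).toLinearMap Φ a c) f
        (LinearMap.rTensor M (LinearMap.mulLeft K (tp i g)) z) =
      ∑ m, ∑ d, R g m a d • LinearMap.rTensor M (LinearMap.mulLeft K (tp i d))
        (TensorProduct.map (Lt (parA r n).toLinearMap Φ m c) f z) := by
  induction z using TensorProduct.induction_on with
  | zero => simp
  | add a b ha hb => simp only [map_add, ha, hb, smul_add, Finset.sum_add_distrib]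
  | tmul x v =>
    simp [hΦ.Lt_mul hΔ, hΦ.Lt_tp, Finset.sum_mul, TensorProduct.sum_tmul,
      TensorProduct.smul_tmul']

/-- In the inductive step each side contains two operators Λ on M, one from the action and one from
passing the generator. They occur in opposite orders, and RΛΛ = ΛΛR exchanges them. -/
theorem IsTransport.Lt_comm (hΔ : IsComul n Δ) (hε : IsCounit n ε) (hΦ : IsCoordAction Δ ε r Φ)
    (h : IsTransport Λ θ) (hF : IsFRT P Λ) (a b : Idx n) (y : M) (x : A r n) :
    ∑ c, θ (Λ a c y ⊗ₜ Lt (parA r n).toLinearMap Φ c b x) =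
      ∑ c, TensorProduct.map (Lt (parA r n).toLinearMap Φ a c) (Λ c b) (θ (y ⊗ₜ x)) := by
  induction x using A.induction generalizing y a b with
  | one =>
    rw [Finset.sum_eq_single b (fun c _ hc => by
        rw [hΦ.Lt_one hε, if_neg hc, TensorProduct.tmul_zero, map_zero]) (by simp),
      Finset.sum_eq_single a (fun c _ hc => by
        rw [h.one, TensorProduct.map_tmul, hΦ.Lt_one hε, if_neg hc.symm, TensorProduct.zero_tmul])
        (by simp), h.one, TensorProduct.map_tmul, hΦ.Lt_one hε, if_pos rfl, hΦ.Lt_one hε,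
      if_pos rfl, h.one]
  | add x y hx hy =>
    simp only [map_add, TensorProduct.tmul_add, Finset.sum_add_distrib, hx, hy]
  | smul c x hx =>
    simp only [map_smul, TensorProduct.tmul_smul, ← Finset.smul_sum, hx]
  | mul i e x hx =>
    have lhs : ∑ c, θ (Λ a c y ⊗ₜ Lt (parA r n).toLinearMap Φ c b (tp i e * x)) =
        ∑ d, ∑ m, LinearMap.rTensor M (LinearMap.mulLeft K (tp i d))
          (θ ((∑ f, ∑ c, R e m c f • (Λ d f * Λ a c)) y ⊗ₜ Lt (parA r n).toLinearMap Φ m b x)) := by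
      simp only [hΦ.Lt_mul hΔ, hΦ.Lt_tp, Finset.sum_mul, smul_mul_assoc, TensorProduct.tmul_sum,
        TensorProduct.tmul_smul, map_sum, map_smul, h.cons, LinearMap.sum_apply,
        LinearMap.smul_apply, TensorProduct.sum_tmul, ← TensorProduct.smul_tmul',
        Module.End.mul_apply, Finset.smul_sum]
      exact sum_comm_outer _
    have rhs : ∑ c, TensorProduct.map (Lt (parA r n).toLinearMap Φ a c) (Λ c b)
          (θ (y ⊗ₜ (tp i e * x))) =
        ∑ d, ∑ m, LinearMap.rTensor M (LinearMap.mulLeft K (tp i d))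
          (θ ((∑ g, ∑ c, R g c a d • (Λ c m * Λ g e)) y ⊗ₜ Lt (parA r n).toLinearMap Φ m b x)) := by
      have : ∀ m g d, ∑ c, R g m a d • LinearMap.rTensor M (LinearMap.mulLeft K (tp i d))
          (TensorProduct.map (Lt (parA r n).toLinearMap Φ m c) (Λ c b) (θ (Λ g e y ⊗ₜ x))) =
          ∑ c, R g m a d • LinearMap.rTensor M (LinearMap.mulLeft K (tp i d))
            (θ (Λ m c (Λ g e y) ⊗ₜ Lt (parA r n).toLinearMap Φ c b x)) := fun m g d => by
        rw [← Finset.smul_sum, ← map_sum, ← hx, map_sum, Finset.smul_sum]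
      simp only [h.cons, map_sum, map_Lt_mulLeft hΔ hΦ]
      rw [Finset.sum_comm, Finset.sum_congr rfl fun _ _ => sum_comm_single_pair _]
      simp only [this, LinearMap.sum_apply, LinearMap.smul_apply, TensorProduct.sum_tmul,
        ← TensorProduct.smul_tmul', Module.End.mul_apply, map_sum, map_smul]
      exact sum_comm_pairs _
    rw [lhs, rhs]
    simp only [hF.rll]

end Transport

end

/-! ### The braiding operators `Θ` -/

section

variable {n r k : ℕ} {Δ : U n →ₗ[K] U n ⊗[K] U n} {ε : U n →ₐ[K] K}

theorem ext_tmul_tmul {V W X Y : Type} [AddCommGroup V] [AddCommGroup W] [AddCommGroup X]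
    [AddCommGroup Y] [Module K V] [Module K W] [Module K X] [Module K Y]
    {f g : V ⊗[K] (W ⊗[K] X) →ₗ[K] Y} (h : ∀ v w x, f (v ⊗ₜ (w ⊗ₜ x)) = g (v ⊗ₜ (w ⊗ₜ x))) :
    f = g :=
  TensorProduct.ext' fun v z => LinearMap.congr_fun
    (TensorProduct.ext' (g := f ∘ₗ TensorProduct.mk K V (W ⊗[K] X) v)
      (h := g ∘ₗ TensorProduct.mk K V (W ⊗[K] X) v) (h v)) z

theorem IsBraidingOp.tmul_mul {B C : SMAlg n} {θ : C ⊗[K] B →ₗ[K] B ⊗[K] C}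
    (h : IsBraidingOp Δ B C θ) (y : C) (x x' : B) :
    θ (y ⊗ₜ B.mul (x ⊗ₜ x')) = LinearMap.rTensor C B.mul (moveRight θ x' (θ (y ⊗ₜ x))) := by
  have := LinearMap.congr_fun h.mul_left (y ⊗ₜ (x ⊗ₜ x'))
  rwa [LinearMap.comp_apply, LinearMap.comp_apply, hexL_tmul, LinearMap.lTensor_tmul] at this

theorem IsBraidingOp.mul_tmul {B C : SMAlg n} {θ : C ⊗[K] B →ₗ[K] B ⊗[K] C}
    (h : IsBraidingOp Δ B C θ) (y y' : C) (x : B) :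
    θ (C.mul (y ⊗ₜ y') ⊗ₜ x) = LinearMap.lTensor B C.mul (moveLeft θ y (θ (y' ⊗ₜ x))) := by
  have := LinearMap.congr_fun h.mul_right ((y ⊗ₜ y') ⊗ₜ x)
  rwa [LinearMap.comp_apply, LinearMap.comp_apply, hexR_tmul, LinearMap.rTensor_tmul] at this

section Transport

variable {B : SMAlg n} {θ : B ⊗[K] A r n →ₗ[K] A r n ⊗[K] B}

/-- Passing a product of B across a generator applies Λ to that product. The matrix Leibniz rule
`Lt_mul` splits this into passing the two factors in turn. -/
theorem IsTransport.mul_tmul (hΔ : IsComul n Δ) (hB : B.IsSupermoduleSuperalgebra Δ ε)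
    (h : IsTransport (Lt B.par B.act) θ) (y y' : B) (x : A r n) :
    θ (B.mul (y ⊗ₜ y') ⊗ₜ x) = LinearMap.lTensor (A r n) B.mul (moveLeft θ y (θ (y' ⊗ₜ x))) := by
  induction x using A.induction generalizing y y' with
  | one => rw [h.one, h.one, moveLeft_tmul, h.one]; rfl
  | add x x' hx hx' => simp only [TensorProduct.tmul_add, map_add, hx, hx']
  | smul c x hx => simp only [TensorProduct.tmul_smul, map_smul, hx]
  | mul i a x hx =>
    simp only [h.cons, hB.Lt_mul hΔ, TensorProduct.sum_tmul, map_sum, hx, h.moveLeft_mulLeft]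
    rw [Finset.sum_comm]
    refine Finset.sum_congr rfl fun c _ => Finset.sum_congr rfl fun d _ => ?_
    induction moveLeft θ (Lt B.par B.act d c y) (θ (Lt B.par B.act c a y' ⊗ₜ x))
      using TensorProduct.induction_on with
    | zero => simp
    | add a b ha hb => simp only [map_add, ha, hb]
    | tmul z v => simp

theorem IsTransport.one_tmul (hε : IsCounit n ε) (hB : B.IsSupermoduleSuperalgebra Δ ε)
    (h : IsTransport (Lt B.par B.act) θ) (x : A r n) : θ (B.one ⊗ₜ x) = x ⊗ₜ B.one := by
  induction x using A.induction with
  | one => rw [h.one]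
  | add x y hx hy => rw [TensorProduct.tmul_add, map_add, hx, hy, TensorProduct.add_tmul]
  | smul c x hx => rw [TensorProduct.tmul_smul, map_smul, hx, TensorProduct.smul_tmul']
  | mul i a x hx =>
    rw [h.cons, Finset.sum_eq_single a]
    · rw [hB.Lt_one hε, if_pos rfl, hx, LinearMap.rTensor_tmul, LinearMap.mulLeft_apply]
    · intro d _ hd
      rw [hB.Lt_one hε, if_neg hd, TensorProduct.zero_tmul, map_zero, map_zero]
    · simp

theorem IsTransport.isBraidingOp (hΔ : IsComul n Δ) (hε : IsCounit n ε)
    {Φ : U n ⊗[K] A r n →ₗ[K] A r n} (hΦ : IsCoordAction Δ ε r Φ)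
    (hB : B.IsSupermoduleSuperalgebra Δ ε) (h : IsTransport (Lt B.par B.act) θ) :
    IsBraidingOp Δ (coord r Φ) B θ where
  par_comm := TensorProduct.ext' fun y x => h.par_comm hB.isSMod.isFRT y x
  act_comm := by
    have h1 := tensorAct_isSMod hΔ (B := B) (C := coord r Φ) hB.isSMod hΦ.isSMod
    have h2 := tensorAct_isSMod hΔ (B := coord r Φ) (C := B) hΦ.isSMod hB.isSMod
    refine TensorProduct.ext' fun u z => h1.1.map_act h2.1 (f := θ) (fun m => ?_)
      (fun a b m => ?_) u z
    · induction m using TensorProduct.induction_on with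
      | zero => simp
      | tmul y x => exact h.par_comm hB.isSMod.isFRT y x
      | add a b ha hb => simp only [map_add, ha, hb]
    · rw [h1.2, h2.2]
      induction m using TensorProduct.induction_on with
      | zero => simp
      | tmul y x =>
        simp only [LinearMap.sum_apply, TensorProduct.map_tmul, map_sum]
        exact h.Lt_comm hΔ hε hΦ hB.isSMod.isFRT a b y x
      | add a b ha hb => simp only [map_add, ha, hb]
  mul_left := ext_tmul_tmul fun y x x' => by
    rw [LinearMap.comp_apply, LinearMap.comp_apply, hexL_tmul]
    exact h.tmul_mul y x x'
  mul_right := TensorProduct.ext_threefold fun y y' x => by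
    rw [LinearMap.comp_apply, LinearMap.comp_apply, hexR_tmul]
    exact h.mul_tmul hΔ hB y y' x
  one_left := h.one_tmul hε hB
  one_right := h.one

/-- By the hexagon for multiplication in A_{r,n}, a braiding operator is determined by how it passes
single generators. -/
theorem IsTransport.of_isBraidingOp {Φ : U n ⊗[K] A r n →ₗ[K] A r n}
    (hθ : IsBraidingOp Δ (coord r Φ) B θ)
    (h : ∀ y i a, θ (y ⊗ₜ tp i a) = ∑ d, tp i d ⊗ₜ Lt B.par B.act d a y) :
    IsTransport (Lt B.par B.act) θ where
  one := hθ.one_right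
  cons y i a x := by
    refine (hθ.tmul_mul y (tp i a) x).trans ?_
    rw [h, map_sum, map_sum]
    refine Finset.sum_congr rfl fun d _ => ?_
    rw [moveRight_tmul]
    induction θ (Lt B.par B.act d a y ⊗ₜ x) using TensorProduct.induction_on with
    | zero => simp
    | tmul z v => simp
    | add a b ha hb => simp only [map_add, ha, hb]

end Transport

/-! ### Existence and uniqueness of `Θ` -/

variable {Φ : ∀ r : ℕ, U n ⊗[K] A r n →ₗ[K] A r n}

/-- The matrix S^{12} in the normalization of Θ is also the matrix by which L acts on T_k, so the
normalization is the transport rule for one generator on each side. -/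
theorem isTheta_tp_iff (hk : IsCoordAction Δ ε k (Φ k))
    {θ : A k n ⊗[K] A r n →ₗ[K] A r n ⊗[K] A k n}
    (j : Fin k) (i : Fin r) (b a : Idx n) :
    sg ((pr (posIdx j) + pr b) * (pr (posIdx i) + pr a)) • θ (t (posIdx j) b ⊗ₜ t (posIdx i) a) =
      ∑ c : Idx n, ∑ d : Idx n, (sg ((pr (posIdx i) + pr d) * (pr c + pr b)) * S c b d a) •
        (t (posIdx i) d ⊗ₜ[K] t (posIdx j) c) ↔
    θ (tp j b ⊗ₜ tp i a) =
      ∑ d, tp i d ⊗ₜ Lt (parA k n).toLinearMap (Φ k) d a (tp j b) := by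
  change (_ • θ (tp j b ⊗ₜ tp i a) = ∑ c, ∑ d, _ • tp i d ⊗ₜ[K] tp j c) ↔ _
  rw [pr_of_pos (posIdx_pos i), pr_of_pos (posIdx_pos j)]
  have e : ∑ c, ∑ d, (sg ((0 + pr d) * (pr c + pr b)) * S c b d a) •
      ((tp i d : A r n) ⊗ₜ[K] (tp j c : A k n)) = sg ((0 + pr b) * (0 + pr a)) •
      ∑ d, tp i d ⊗ₜ Lt (parA k n).toLinearMap (Φ k) d a (tp j b) := by
    simp only [hk.Lt_tp, TensorProduct.tmul_sum, TensorProduct.tmul_smul, Finset.smul_sum,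
      smul_smul]
    rw [Finset.sum_comm]
    refine Finset.sum_congr rfl fun d _ => Finset.sum_congr rfl fun c _ => ?_
    congr 1
    simp only [R, zero_add]
    linear_combination -sg (pr d * (pr c + pr b)) * S c b d a * sg_mul_self (pr b * pr a)
  rw [e]
  constructor
  · intro h
    have := congrArg (sg ((0 + pr b) * (0 + pr a)) • ·) h
    simpa only [smul_smul, sg_mul_self, one_smul] using this
  · intro h
    rw [h]

/-- The other hexagon extends the rule from generators y = t_{jb} to all y. Thus Θ is a transport,
which gives both its uniqueness and its recursion. -/
theorem IsTheta.isTransport (hΔ : IsComul n Δ) (hε : IsCounit n ε)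
    (hk : IsCoordAction Δ ε k (Φ k)) {θ : A k n ⊗[K] A r n →ₗ[K] A r n ⊗[K] A k n}
    (h : IsTheta Δ Φ k r θ) : IsTransport (Lt (parA k n).toLinearMap (Φ k)) θ := by
  refine IsTransport.of_isBraidingOp (B := coord k (Φ k)) h.1 fun y i a => ?_
  change θ (y ⊗ₜ tp i a) = ∑ d, tp i d ⊗ₜ Lt (parA k n).toLinearMap (Φ k) d a y
  induction y using A.induction generalizing a with
  | one =>
    refine (h.1.one_left (tp i a)).trans ?_
    rw [Finset.sum_eq_single a (fun d _ hd => by rw [hk.Lt_one hε, if_neg hd,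
      TensorProduct.tmul_zero]) (by simp), hk.Lt_one hε, if_pos rfl]
  | add x y hx hy =>
    simp only [TensorProduct.add_tmul, map_add, hx, hy, TensorProduct.tmul_add,
      Finset.sum_add_distrib]
  | smul c x hx =>
    simp only [← TensorProduct.smul_tmul', map_smul, hx, TensorProduct.tmul_smul, Finset.smul_sum]
  | mul j b y hy =>
    refine (h.1.mul_tmul (tp j b) y (tp i a)).trans ?_
    have key : ∀ d, θ (tp j b ⊗ₜ tp i d) =
        ∑ e, tp i e ⊗ₜ Lt (parA k n).toLinearMap (Φ k) e d (tp j b) := fun d =>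
      (isTheta_tp_iff hk j i b d).1 (h.2 (posIdx j) (posIdx i) (posIdx_pos j) (posIdx_pos i) b d)
    simp only [hy, map_sum, moveLeft_tmul, key, LinearMap.lTensor_tmul, LinearMap.flip_apply,
      TensorProduct.mk_apply, hk.Lt_mul hΔ, TensorProduct.tmul_sum, LinearMap.mul'_apply]
    exact Finset.sum_comm

theorem IsTransport.isTheta (hΔ : IsComul n Δ) (hε : IsCounit n ε)
    (hk : IsCoordAction Δ ε k (Φ k)) (hr : IsCoordAction Δ ε r (Φ r))
    {θ : A k n ⊗[K] A r n →ₗ[K] A r n ⊗[K] A k n}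
    (h : IsTransport (Lt (parA k n).toLinearMap (Φ k)) θ) : IsTheta Δ Φ k r θ := by
  refine ⟨IsTransport.isBraidingOp (B := coord k (Φ k)) hΔ hε hr hk.1 h, fun j i hj hi b a => ?_⟩
  obtain ⟨i, rfl⟩ := exists_posIdx hi
  obtain ⟨j, rfl⟩ := exists_posIdx hj
  rw [isTheta_tp_iff hk, ← mul_one (tp i a), h.cons]
  simp only [h.one, LinearMap.rTensor_tmul, LinearMap.mulLeft_apply, mul_one]

theorem existsUnique_theta (hΔ : IsComul n Δ) (hε : IsCounit n ε)
    (hΦ : ∀ r, IsCoordAction Δ ε r (Φ r)) (k r : ℕ) :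
    ∃! θ : A k n ⊗[K] A r n →ₗ[K] A r n ⊗[K] A k n, IsTheta Δ Φ k r θ := by
  obtain ⟨θ, hθ⟩ := (hΦ k).isSMod.isFRT.exists_transport r
  exact ⟨θ, hθ.isTheta hΔ hε (hΦ k) (hΦ r), fun θ' h' =>
    (h'.isTransport hΔ hε (hΦ k)).unique hθ⟩

end

/-! ### Braided tensor products -/

section

variable {n : ℕ} {Δ : U n →ₗ[K] U n ⊗[K] U n} {ε : U n →ₐ[K] K}

namespace SMAlg

/-- Left multiplication. -/
def lmul (B : SMAlg n) (x : B) : B →ₗ[K] B := B.mul ∘ₗ TensorProduct.mk K B B x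

/-- Right multiplication. -/
def rmul (B : SMAlg n) (y : B) : B →ₗ[K] B := B.mul ∘ₗ (TensorProduct.mk K B B).flip y

theorem lmul_apply (B : SMAlg n) (x y : B) : B.lmul x y = B.mul (x ⊗ₜ y) := rfl

theorem rmul_apply (B : SMAlg n) (x y : B) : B.rmul y x = B.mul (x ⊗ₜ y) := rfl

end SMAlg

variable {B C : SMAlg n} {θ : C ⊗[K] B →ₗ[K] B ⊗[K] C}

theorem braided_mul_tmul (θ : C ⊗[K] B →ₗ[K] B ⊗[K] C) (x x' : B) (y y' : C) :
    TensorProduct.map B.mul C.mul (midMap θ ((x ⊗ₜ y) ⊗ₜ (x' ⊗ₜ y'))) =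
      TensorProduct.map (B.lmul x) (C.rmul y') (θ (y ⊗ₜ x')) := by
  rw [midMap_tmul, ← LinearMap.comp_apply, ← TensorProduct.map_comp]
  rfl

theorem IsBraidingOp.Lt_comm (hΔ : IsComul n Δ) (h : IsBraidingOp Δ B C θ)
    (hB : IsSMod B.par B.act) (hC : IsSMod C.par C.act) (a b : Idx n) (y : C) (x : B) :
    ∑ c, θ (Lt C.par C.act a c y ⊗ₜ Lt B.par B.act c b x) =
      ∑ c, TensorProduct.map (Lt B.par B.act a c) (Lt C.par C.act c b) (θ (y ⊗ₜ x)) := by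
  have h1 := (tensorAct_isSMod hΔ hC hB).2 a b
  have h2 := (tensorAct_isSMod hΔ hB hC).2 a b
  have h3 := map_pow_apply (P := TensorProduct.map C.par B.par)
    (Q := TensorProduct.map B.par C.par) (f := θ) (LinearMap.congr_fun h.par_comm) (pr b)
    (tensorAct Δ C B (L a b ⊗ₜ (y ⊗ₜ x)))
  have h4 := LinearMap.congr_fun h.act_comm (L a b ⊗ₜ (y ⊗ₜ x))
  rw [LinearMap.comp_apply, LinearMap.comp_apply, LinearMap.lTensor_tmul] at h4
  rw [h4, ← Lt_apply, ← Lt_apply, h1, h2] at h3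
  simpa only [LinearMap.sum_apply, map_sum, TensorProduct.map_tmul] using h3

/-- Associativity is proved by bringing both bracketings to one form, in which y has passed x' and
y' has passed x'' before the last multiplication. This lemma uses the hexagon for C, and
`braided_mul_eq_right` uses the one for B. -/
theorem braided_mul_eq_left (hC : C.IsSupermoduleSuperalgebra Δ ε) (h : IsBraidingOp Δ B C θ)
    (x x'' : B) (y' y'' : C) (z : B ⊗[K] C) :
    TensorProduct.map B.mul C.mul
      (midMap θ (TensorProduct.map (B.lmul x) (C.rmul y') z ⊗ₜ (x'' ⊗ₜ y''))) =
    TensorProduct.map B.mul C.mul (midMap θ (LinearMap.rTensor C (B.lmul x) z ⊗ₜ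
      LinearMap.lTensor B (C.rmul y'') (θ (y' ⊗ₜ x'')))) := by
  induction z using TensorProduct.induction_on with
  | zero => simp
  | add a b ha hb => simp only [TensorProduct.add_tmul, map_add, ha, hb]
  | tmul a b =>
  rw [TensorProduct.map_tmul, LinearMap.rTensor_tmul, braided_mul_tmul, C.rmul_apply, h.mul_tmul]
  induction θ (y' ⊗ₜ x'') using TensorProduct.induction_on with
  | zero => simp
  | add a b ha hb => simp only [TensorProduct.tmul_add, map_add, ha, hb]
  | tmul c d =>
  rw [LinearMap.lTensor_tmul, braided_mul_tmul, moveLeft_tmul]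
  induction θ (b ⊗ₜ c) using TensorProduct.induction_on with
  | zero => simp
  | add a b ha hb => simp only [map_add, ha, hb]
  | tmul u v => simp [SMAlg.rmul_apply, hC.mul_assoc]

theorem braided_mul_eq_right (hB : B.IsSupermoduleSuperalgebra Δ ε) (h : IsBraidingOp Δ B C θ)
    (x x' : B) (y y'' : C) (z : B ⊗[K] C) :
    TensorProduct.map B.mul C.mul
      (midMap θ ((x ⊗ₜ y) ⊗ₜ TensorProduct.map (B.lmul x') (C.rmul y'') z)) =
    TensorProduct.map B.mul C.mul (midMap θ (LinearMap.rTensor C (B.lmul x) (θ (y ⊗ₜ x')) ⊗ₜ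
      LinearMap.lTensor B (C.rmul y'') z)) := by
  induction z using TensorProduct.induction_on with
  | zero => simp
  | add a b ha hb => simp only [TensorProduct.tmul_add, map_add, ha, hb]
  | tmul c d =>
  rw [TensorProduct.map_tmul, LinearMap.lTensor_tmul, braided_mul_tmul, B.lmul_apply, h.tmul_mul]
  induction θ (y ⊗ₜ x') using TensorProduct.induction_on with
  | zero => simp
  | add a b ha hb => simp only [TensorProduct.add_tmul, map_add, ha, hb]
  | tmul a b =>
  rw [LinearMap.rTensor_tmul, braided_mul_tmul, moveRight_tmul]
  induction θ (b ⊗ₜ c) using TensorProduct.induction_on with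
  | zero => simp
  | add a b ha hb => simp only [map_add, ha, hb]
  | tmul u v => simp [SMAlg.lmul_apply, hB.mul_assoc]

theorem braided_mul_assoc (hB : B.IsSupermoduleSuperalgebra Δ ε)
    (hC : C.IsSupermoduleSuperalgebra Δ ε) (h : IsBraidingOp Δ B C θ) (a b c : B ⊗[K] C) :
    (braided Δ B C θ).mul ((braided Δ B C θ).mul (a ⊗ₜ b) ⊗ₜ c) =
      (braided Δ B C θ).mul (a ⊗ₜ (braided Δ B C θ).mul (b ⊗ₜ c)) := by
  simp only [LinearMap.comp_apply]
  induction a using TensorProduct.induction_on with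
  | zero => simp
  | add a b ha hb => simp only [TensorProduct.add_tmul, map_add, ha, hb]
  | tmul x y =>
  induction b using TensorProduct.induction_on with
  | zero => simp
  | add a b ha hb => simp only [TensorProduct.add_tmul, TensorProduct.tmul_add, map_add, ha, hb]
  | tmul x' y' =>
  induction c using TensorProduct.induction_on with
  | zero => simp
  | add a b ha hb => simp only [TensorProduct.tmul_add, map_add, ha, hb]
  | tmul x'' y'' =>
  rw [braided_mul_tmul, braided_mul_tmul, braided_mul_eq_left hC h, braided_mul_eq_right hB h]

theorem braided_par_mul (hB : B.IsSupermoduleSuperalgebra Δ ε)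
    (hC : C.IsSupermoduleSuperalgebra Δ ε) (h : IsBraidingOp Δ B C θ) (a b : B ⊗[K] C) :
    (braided Δ B C θ).par ((braided Δ B C θ).mul (a ⊗ₜ b)) =
      (braided Δ B C θ).mul ((braided Δ B C θ).par a ⊗ₜ (braided Δ B C θ).par b) := by
  simp only [LinearMap.comp_apply]
  induction a using TensorProduct.induction_on with
  | zero => simp
  | add a b ha hb => simp only [TensorProduct.add_tmul, map_add, ha, hb]
  | tmul x y =>
  induction b using TensorProduct.induction_on with
  | zero => simp
  | add a b ha hb => simp only [TensorProduct.tmul_add, map_add, ha, hb]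
  | tmul x' y' =>
  have hp := LinearMap.congr_fun h.par_comm (y ⊗ₜ x')
  rw [LinearMap.comp_apply, LinearMap.comp_apply, TensorProduct.map_tmul] at hp
  rw [TensorProduct.map_tmul, TensorProduct.map_tmul, braided_mul_tmul, braided_mul_tmul, hp]
  induction θ (y ⊗ₜ x') using TensorProduct.induction_on with
  | zero => simp
  | add a b ha hb => simp only [map_add, ha, hb]
  | tmul u v => simp [SMAlg.lmul_apply, SMAlg.rmul_apply, hB.par_mul, hC.par_mul]

/-- Applying L to x u ⊗ v y', where u ⊗ v runs through θ(y ⊗ x'), gives a fourfold matrix product.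
Its middle two factors are moved through θ by equivariance. -/
theorem braided_Lt_mul (hΔ : IsComul n Δ) (hB : B.IsSupermoduleSuperalgebra Δ ε)
    (hC : C.IsSupermoduleSuperalgebra Δ ε) (h : IsBraidingOp Δ B C θ) (a b : Idx n)
    (z w : B ⊗[K] C) :
    Lt (TensorProduct.map B.par C.par) (tensorAct Δ B C) a b
        (TensorProduct.map B.mul C.mul (midMap θ (z ⊗ₜ w))) =
      ∑ c, TensorProduct.map B.mul C.mul (midMap θ
        (Lt (TensorProduct.map B.par C.par) (tensorAct Δ B C) a c z ⊗ₜ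
          Lt (TensorProduct.map B.par C.par) (tensorAct Δ B C) c b w)) := by
  simp only [(tensorAct_isSMod hΔ hB.isSMod hC.isSMod).2]
  induction z using TensorProduct.induction_on with
  | zero => simp
  | add a b ha hb => simp only [TensorProduct.add_tmul, map_add, ha, hb, Finset.sum_add_distrib]
  | tmul x y =>
  induction w using TensorProduct.induction_on with
  | zero => simp
  | add a b ha hb => simp only [TensorProduct.tmul_add, map_add, ha, hb, Finset.sum_add_distrib]
  | tmul x' y' =>
  simp only [LinearMap.sum_apply, TensorProduct.map_tmul, TensorProduct.sum_tmul,
    TensorProduct.tmul_sum, map_sum, braided_mul_tmul]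
  have key : ∀ d e, ∑ c, TensorProduct.map (B.lmul (Lt B.par B.act a d x))
      (C.rmul (Lt C.par C.act e b y')) (θ (Lt C.par C.act d c y ⊗ₜ Lt B.par B.act c e x')) =
      ∑ c, TensorProduct.map (B.lmul (Lt B.par B.act a d x)) (C.rmul (Lt C.par C.act e b y'))
        (TensorProduct.map (Lt B.par B.act d c) (Lt C.par C.act c e) (θ (y ⊗ₜ x'))) := fun d e => by
    rw [← map_sum, h.Lt_comm hΔ hB.isSMod hC.isSMod, map_sum]
  have : ∀ z : B ⊗[K] C, ∑ c, TensorProduct.map (Lt B.par B.act a c) (Lt C.par C.act c b)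
      (TensorProduct.map (B.lmul x) (C.rmul y') z) =
      ∑ d, ∑ e, ∑ c, TensorProduct.map (B.lmul (Lt B.par B.act a d x))
        (C.rmul (Lt C.par C.act e b y'))
        (TensorProduct.map (Lt B.par B.act d c) (Lt C.par C.act c e) z) := fun z => by
    induction z using TensorProduct.induction_on with
    | zero => simp
    | add a b ha hb => simp only [map_add, ha, hb, Finset.sum_add_distrib]
    | tmul u v =>
      simp only [TensorProduct.map_tmul, SMAlg.lmul_apply, SMAlg.rmul_apply, hB.Lt_mul hΔ,
        hC.Lt_mul hΔ, TensorProduct.tmul_sum, TensorProduct.sum_tmul]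
      rw [← sum_comm_single_pair]
      exact Finset.sum_congr rfl fun _ _ => Finset.sum_comm
  rw [this]
  simp only [← key]
  exact (Finset.sum_congr rfl fun _ _ => Finset.sum_comm).trans (sum_comm_single_pair _)

/-- The braided tensor product is a supermodule superalgebra. -/
theorem braided_isSupermoduleSuperalgebra (hΔ : IsComul n Δ) (hε : IsCounit n ε)
    (hB : B.IsSupermoduleSuperalgebra Δ ε) (hC : C.IsSupermoduleSuperalgebra Δ ε)
    (h : IsBraidingOp Δ B C θ) : (braided Δ B C θ).IsSupermoduleSuperalgebra Δ ε := by
  have hT := tensorAct_isSMod hΔ hB.isSMod hC.isSMod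
  refine SMAlg.isSupermoduleSuperalgebra_of_Lt hΔ hε hT.1 (braided_mul_assoc hB hC h)
    (fun z => ?_) (fun z => ?_) ?_ (braided_par_mul hB hC h) (fun a b => ?_)
    (braided_Lt_mul hΔ hB hC h)
  · rw [LinearMap.comp_apply]
    induction z using TensorProduct.induction_on with
    | zero => simp
    | add a b ha hb => simp only [TensorProduct.tmul_add, map_add, ha, hb]
    | tmul x y =>
      rw [braided_mul_tmul, h.one_left, TensorProduct.map_tmul, B.lmul_apply, C.rmul_apply,
        hB.one_mul, hC.one_mul]
  · rw [LinearMap.comp_apply]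
    induction z using TensorProduct.induction_on with
    | zero => simp
    | add a b ha hb => simp only [TensorProduct.add_tmul, map_add, ha, hb]
    | tmul x y =>
      rw [braided_mul_tmul, h.one_right, TensorProduct.map_tmul, B.lmul_apply, C.rmul_apply,
        hB.mul_one, hC.mul_one]
  · rw [TensorProduct.map_tmul, hB.par_one, hC.par_one]
  · rw [hT.2, LinearMap.sum_apply, Finset.sum_eq_single a (fun c _ hc => by
      rw [TensorProduct.map_tmul, hB.Lt_one hε, if_neg hc.symm, TensorProduct.zero_tmul]) (by simp),
      TensorProduct.map_tmul, hB.Lt_one hε, if_pos rfl, hC.Lt_one hε]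
    split_ifs
    · rfl
    · rw [TensorProduct.tmul_zero]

end

/-! ### Embeddings of quantum coordinate superalgebras -/

section

variable {n r k p : ℕ} {Δ : U n →ₗ[K] U n ⊗[K] U n} {ε : U n →ₐ[K] K}

/-! ### Functoriality of the transport -/

theorem IsTransport.map_left {M N : Type} [AddCommGroup M] [Module K M] [AddCommGroup N]
    [Module K N] {Λ : Idx n → Idx n → Module.End K M} {Γ : Idx n → Idx n → Module.End K N}
    {θ : M ⊗[K] A r n →ₗ[K] A r n ⊗[K] M} {θ' : N ⊗[K] A r n →ₗ[K] A r n ⊗[K] N}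
    (h : IsTransport Λ θ) (h' : IsTransport Γ θ') {f : M →ₗ[K] N}
    (hf : ∀ a b m, f (Λ a b m) = Γ a b (f m)) (y : M) (x : A r n) :
    θ' (f y ⊗ₜ x) = LinearMap.lTensor (A r n) f (θ (y ⊗ₜ x)) := by
  induction x using A.induction generalizing y with
  | one => rw [h.one, h'.one, LinearMap.lTensor_tmul]
  | add x y hx hy => simp only [TensorProduct.tmul_add, map_add, hx, hy]
  | smul c x hx => simp only [TensorProduct.tmul_smul, map_smul, hx]
  | mul i a x hx =>
    simp only [h.cons, h'.cons, map_sum, ← hf, hx]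
    refine Finset.sum_congr rfl fun d _ => ?_
    induction θ (Λ d a y ⊗ₜ x) using TensorProduct.induction_on with
    | zero => simp
    | add a b ha hb => simp only [map_add, ha, hb]
    | tmul u v => simp

/-- The recursion alters only the column index, so it commutes with any homomorphism that relabels
rows. -/
theorem IsTransport.map_right {M : Type} [AddCommGroup M] [Module K M]
    {Λ : Idx n → Idx n → Module.End K M}
    {θ : M ⊗[K] A r n →ₗ[K] A r n ⊗[K] M} {θ' : M ⊗[K] A k n →ₗ[K] A k n ⊗[K] M}
    (h : IsTransport Λ θ) (h' : IsTransport Λ θ') {f : A r n →ₐ[K] A k n} {s : Fin r → Fin k}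
    (hf : ∀ i a, f (tp i a) = tp (s i) a) (y : M) (x : A r n) :
    θ' (y ⊗ₜ f x) = LinearMap.rTensor M f.toLinearMap (θ (y ⊗ₜ x)) := by
  induction x using A.induction generalizing y with
  | one => rw [map_one f, h.one, h'.one, LinearMap.rTensor_tmul, AlgHom.toLinearMap_apply,
      map_one f]
  | add x y hx hy => simp only [TensorProduct.tmul_add, map_add, hx, hy]
  | smul c x hx => simp only [TensorProduct.tmul_smul, map_smul, hx]
  | mul i a x hx =>
    simp only [map_mul, hf, h.cons, h'.cons, map_sum, hx]
    refine Finset.sum_congr rfl fun d _ => ?_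
    induction θ (Λ d a y ⊗ₜ x) using TensorProduct.induction_on with
    | zero => simp
    | add a b ha hb => simp only [map_add, ha, hb]
    | tmul u v => simp [hf]

/-! ### The two embeddings -/

/-- The relations depend only on the relative order of the rows, which both block inclusions
preserve. -/
theorem exists_castAdd_hom (r k n : ℕ) :
    ∃ f : A r n →ₐ[K] A (r + k) n, ∀ i a, f (tp i a) = tp (Fin.castAdd k i) a :=
  exists_lift (fun i a => tp (Fin.castAdd k i) a) fun i j hij a b => by
    have := tp_relation (n := n) (i := Fin.castAdd k i) (j := Fin.castAdd k j)
      (Fin.le_def.2 (Fin.le_def.1 hij)) a b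
    simpa only [Fin.castAdd_inj] using this

theorem exists_natAdd_hom (r k n : ℕ) :
    ∃ f : A k n →ₐ[K] A (r + k) n, ∀ i a, f (tp i a) = tp (Fin.natAdd r i) a :=
  exists_lift (fun i a => tp (Fin.natAdd r i) a) fun i j hij a b => by
    have := tp_relation (n := n) (i := Fin.natAdd r i) (j := Fin.natAdd r j)
      (Fin.le_def.2 (Nat.add_le_add_left (Fin.le_def.1 hij) r)) a b
    simpa only [Fin.natAdd_inj] using this

theorem parA_comp {f : A r n →ₐ[K] A k n} {s : Fin r → Fin k}
    (hf : ∀ i a, f (tp i a) = tp (s i) a) (x : A r n) : f (parA r n x) = parA k n (f x) := by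
  have : f.comp (parA r n) = (parA k n).comp f := A.algHom_ext fun i a => by
    simp only [AlgHom.comp_apply, parA_tp, hf, map_smul]
  exact DFunLike.congr_fun this x

theorem Lt_comp (hΔ : IsComul n Δ) (hε : IsCounit n ε) {Φ : U n ⊗[K] A r n →ₗ[K] A r n}
    {Φ' : U n ⊗[K] A k n →ₗ[K] A k n} (hΦ : IsCoordAction Δ ε r Φ)
    (hΦ' : IsCoordAction Δ ε k Φ') {f : A r n →ₐ[K] A k n} {s : Fin r → Fin k}
    (hf : ∀ i a, f (tp i a) = tp (s i) a) (a b : Idx n) (x : A r n) :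
    f (Lt (parA r n).toLinearMap Φ a b x) = Lt (parA k n).toLinearMap Φ' a b (f x) := by
  induction x using A.induction generalizing a b with
  | one => rw [map_one f, hΦ.Lt_one hε, hΦ'.Lt_one hε]; split_ifs <;> simp
  | add x y hx hy => simp only [map_add, hx, hy]
  | smul c x hx => simp only [map_smul, hx]
  | mul i c x hx =>
    simp only [map_mul, hΦ.Lt_mul hΔ, hΦ'.Lt_mul hΔ, map_sum, hf, hx, hΦ.Lt_tp, hΦ'.Lt_tp, map_smul]

/-! ### The factorization of `A_{r+k,n}` -/

/-- Elements of the second factor move past the first one by means of `θ`. -/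
theorem natAdd_mul_castAdd (hΔ : IsComul n Δ) (hε : IsCounit n ε)
    {Φ : U n ⊗[K] A k n →ₗ[K] A k n} (hΦ : IsCoordAction Δ ε k Φ)
    {θ : A k n ⊗[K] A r n →ₗ[K] A r n ⊗[K] A k n}
    (hθ : IsTransport (Lt (parA k n).toLinearMap Φ) θ)
    {f : A r n →ₐ[K] A (r + k) n} (hf : ∀ i a, f (tp i a) = tp (Fin.castAdd k i) a)
    {g : A k n →ₐ[K] A (r + k) n} (hg : ∀ i a, g (tp i a) = tp (Fin.natAdd r i) a)
    (y : A k n) (x : A r n) :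
    LinearMap.mul' K (A (r + k) n) (TensorProduct.map f.toLinearMap g.toLinearMap (θ (y ⊗ₜ x))) =
      g y * f x := by
  -- First the case of a single generator on the right, by induction on y.
  have h1 : ∀ y i a, ∑ d, f (tp i d) * g (Lt (parA k n).toLinearMap Φ d a y) =
      g y * f (tp i a) := by
    intro y i a
    induction y using A.induction generalizing a with
    | one =>
      rw [Finset.sum_eq_single a (fun d _ hd => by rw [hΦ.Lt_one hε, if_neg hd, map_zero g,
        mul_zero]) (by simp), hΦ.Lt_one hε, if_pos rfl, map_one g, mul_one, one_mul]
    | add x y hx hy => simp only [map_add, mul_add, add_mul, Finset.sum_add_distrib, hx, hy]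
    | smul c x hx => simp only [map_smul, mul_smul_comm, smul_mul_assoc, ← Finset.smul_sum, hx]
    | mul j b y hy =>
      -- Rows of the first block come strictly before those of the second, so the exchange relation
      -- has coefficient 1 instead of q.
      have hlt : Fin.castAdd k i < Fin.natAdd r j := by
        simp only [Fin.lt_def, Fin.val_castAdd, Fin.val_natAdd]; omega
      have hrel : ∀ d, g (tp j b) * f (tp i d) = ∑ e, ∑ c, R b d e c • (f (tp i e) * g (tp j c)) :=
        fun d => by
          have := tp_relation (n := n) hlt.le b d
          rw [if_neg hlt.ne, one_smul] at this
          simpa only [hf, hg] using this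
      rw [map_mul, mul_assoc, ← hy, Finset.mul_sum]
      simp only [← mul_assoc, hrel, hΦ.Lt_mul hΔ, hΦ.Lt_tp, map_sum, map_mul, map_smul,
        Finset.sum_mul, Finset.mul_sum, smul_mul_assoc, mul_smul_comm]
      rw [Finset.sum_comm]
  induction x using A.induction generalizing y with
  | one => rw [hθ.one]; simp
  | add x x' hx hx' => simp only [TensorProduct.tmul_add, map_add, mul_add, hx, hx']
  | smul c x hx => simp only [TensorProduct.tmul_smul, map_smul, mul_smul_comm, hx]
  | mul i a x hx =>
    have h2 : ∀ d (z : A r n ⊗[K] A k n), LinearMap.mul' K (A (r + k) n)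
        (TensorProduct.map f.toLinearMap g.toLinearMap
          (LinearMap.rTensor (A k n) (LinearMap.mulLeft K (tp i d)) z)) =
        f (tp i d) * LinearMap.mul' K (A (r + k) n)
          (TensorProduct.map f.toLinearMap g.toLinearMap z) := by
      intro d z
      induction z using TensorProduct.induction_on with
      | zero => simp
      | add a b ha hb => simp only [map_add, mul_add, ha, hb]
      | tmul u v => simp [mul_assoc]
    simp only [hθ.cons, map_sum, h2, hx, map_mul, ← mul_assoc, ← h1, Finset.sum_mul]

end

/-! ### The factorization of `A_{r+k,n}` -/

section

variable {n r k p : ℕ} {Δ : U n →ₗ[K] U n ⊗[K] U n} {ε : U n →ₐ[K] K}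

theorem braided_mul_apply (Δ : U n →ₗ[K] U n ⊗[K] U n) {B C : SMAlg n}
    (θ : C ⊗[K] B →ₗ[K] B ⊗[K] C) (x x' : B) (y y' : C) :
    (braided Δ B C θ).mul ((x ⊗ₜ y) ⊗ₜ (x' ⊗ₜ y')) =
      TensorProduct.map (B.lmul x) (C.rmul y') (θ (y ⊗ₜ x')) :=
  braided_mul_tmul θ x x' y y'

theorem braided_mul_one_tmul {B C : SMAlg n} {θ : C ⊗[K] B →ₗ[K] B ⊗[K] C}
    (hB : B.IsSupermoduleSuperalgebra Δ ε) (h : IsBraidingOp Δ B C θ) (x : B) (y y' : C) :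
    (braided Δ B C θ).mul ((x ⊗ₜ y) ⊗ₜ (B.one ⊗ₜ y')) = x ⊗ₜ C.mul (y ⊗ₜ y') := by
  rw [braided_mul_apply, h.one_right, TensorProduct.map_tmul, B.lmul_apply,
    C.rmul_apply, hB.mul_one]

theorem braided_mul_tmul_one {B C : SMAlg n} {θ : C ⊗[K] B →ₗ[K] B ⊗[K] C}
    (hC : C.IsSupermoduleSuperalgebra Δ ε) (h : IsBraidingOp Δ B C θ) (x x' : B) (y' : C) :
    (braided Δ B C θ).mul ((x ⊗ₜ C.one) ⊗ₜ (x' ⊗ₜ y')) = B.mul (x ⊗ₜ x') ⊗ₜ y' := by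
  rw [braided_mul_apply, h.one_left, TensorProduct.map_tmul, B.lmul_apply,
    C.rmul_apply, hC.one_mul]

theorem braided_mul_one_one {B C : SMAlg n} {θ : C ⊗[K] B →ₗ[K] B ⊗[K] C}
    (hB : B.IsSupermoduleSuperalgebra Δ ε) (hC : C.IsSupermoduleSuperalgebra Δ ε) (y : C) (x : B) :
    (braided Δ B C θ).mul ((B.one ⊗ₜ y) ⊗ₜ (x ⊗ₜ C.one)) = θ (y ⊗ₜ x) := by
  rw [braided_mul_apply]
  induction θ (y ⊗ₜ x) using TensorProduct.induction_on with
  | zero => simp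
  | add a b ha hb => rw [map_add, ha, hb]
  | tmul u v =>
    rw [TensorProduct.map_tmul, B.lmul_apply, C.rmul_apply, hC.mul_one, hB.one_mul]

/-- The universal property of `A_{r,n}` with values in a supermodule superalgebra. -/
theorem SMAlg.IsSupermoduleSuperalgebra.exists_lift {B : SMAlg n}
    (hB : B.IsSupermoduleSuperalgebra Δ ε) (y : Fin r → Idx n → B)
    (h : ∀ i j, i ≤ j → ∀ a b, (if i = j then q else 1) • B.mul (y j a ⊗ₜ y i b) =
      ∑ d, ∑ c, R a b d c • B.mul (y i d ⊗ₜ y j c)) :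
    ∃ f : A r n →ₗ[K] B, f 1 = B.one ∧ ∀ i a x, f (tp i a * x) = B.mul (y i a ⊗ₜ f x) := by
  -- By associativity the left multiplications by the y satisfy the same relations, so A_{r,n} acts
  -- on B; evaluating at the unit recovers the required map.
  obtain ⟨F, hF⟩ := QueerBraid.exists_lift (B := Module.End K B) (fun i a => B.lmul (y i a))
    fun i j hij a b => LinearMap.ext fun z => by
      have h1 : ∀ x x', (B.lmul x * B.lmul x' : Module.End K B) z = B.rmul z (B.mul (x ⊗ₜ x')) :=
        fun x x' => (hB.mul_assoc x x' z).symm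
      simp only [LinearMap.smul_apply, LinearMap.sum_apply, h1]
      rw [← map_smul, h i j hij a b]
      simp only [map_sum, map_smul]
  refine ⟨LinearMap.applyₗ B.one ∘ₗ F.toLinearMap, ?_, fun i a x => ?_⟩
  · change F 1 B.one = B.one
    rw [map_one F]; rfl
  · change F (tp i a * x) B.one = B.mul (y i a ⊗ₜ F x B.one)
    rw [map_mul, hF]; rfl

section
variable {Φ : ∀ r : ℕ, U n ⊗[K] A r n →ₗ[K] A r n}

/-- The generators of the braided tensor product of `A_{r,n}` and `A_{k,n}`. -/
def tpTensor (i : Fin (r + k)) (a : Idx n) : A r n ⊗[K] A k n :=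
  Fin.addCases (fun i => tp i a ⊗ₜ 1) (fun j => 1 ⊗ₜ tp j a) i

theorem tpTensor_left (i : Fin r) (a : Idx n) :
    tpTensor (Fin.castAdd k i) a = tp i a ⊗ₜ[K] (1 : A k n) := Fin.addCases_left i

theorem tpTensor_right (i : Fin k) (a : Idx n) :
    tpTensor (Fin.natAdd r i) a = (1 : A r n) ⊗ₜ[K] tp i a := Fin.addCases_right i

/-- Within a block these are the relations of that factor. Across blocks, the product in order is a
pure tensor and the product out of order is θ of generators, whose coefficients are those of `R`. -/
theorem braided_relation (hΔ : IsComul n Δ) (hε : IsCounit n ε)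
    (hΦ : ∀ r, IsCoordAction Δ ε r (Φ r)) {θ : A k n ⊗[K] A r n →ₗ[K] A r n ⊗[K] A k n}
    (hθ : IsTheta Δ Φ k r θ) (i j : Fin (r + k)) (hij : i ≤ j) (a b : Idx n) :
    (if i = j then q else 1) • (braided Δ (coord r (Φ r)) (coord k (Φ k)) θ).mul
      (tpTensor j a ⊗ₜ
        tpTensor i b) =
    ∑ d, ∑ c, R a b d c • (braided Δ (coord r (Φ r)) (coord k (Φ k)) θ).mul
      (tpTensor i d ⊗ₜ
        tpTensor j c) := by
  have hll : ∀ x x' : A r n, (braided Δ (coord r (Φ r)) (coord k (Φ k)) θ).mul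
      ((x ⊗ₜ 1) ⊗ₜ (x' ⊗ₜ 1)) = (x * x') ⊗ₜ 1 := fun x x' =>
    braided_mul_tmul_one (hΦ k).1 hθ.1 x x' 1
  have hrr : ∀ y y' : A k n, (braided Δ (coord r (Φ r)) (coord k (Φ k)) θ).mul
      ((1 ⊗ₜ y) ⊗ₜ (1 ⊗ₜ y')) = 1 ⊗ₜ (y * y') := fun y y' =>
    braided_mul_one_tmul (hΦ r).1 hθ.1 1 y y'
  have hlr : ∀ (x : A r n) (y : A k n), (braided Δ (coord r (Φ r)) (coord k (Φ k)) θ).mul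
      ((x ⊗ₜ 1) ⊗ₜ (1 ⊗ₜ y)) = x ⊗ₜ y := fun x y =>
    (braided_mul_one_tmul (hΦ r).1 hθ.1 x 1 y).trans (by rw [LinearMap.mul'_apply, one_mul])
  have hrl : ∀ (x : A r n) (y : A k n), (braided Δ (coord r (Φ r)) (coord k (Φ k)) θ).mul
      ((1 ⊗ₜ y) ⊗ₜ (x ⊗ₜ 1)) = θ (y ⊗ₜ x) := fun x y => braided_mul_one_one (hΦ r).1 (hΦ k).1 y x
  induction i using Fin.addCases with
  | left i =>
    induction j using Fin.addCases with
    | left j =>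
      have := congrArg (· ⊗ₜ[K] (1 : A k n)) (tp_relation (n := n)
        (i := i) (j := j) (Fin.le_def.2 (Fin.le_def.1 hij)) a b)
      simp only [TensorProduct.sum_tmul, ← TensorProduct.smul_tmul'] at this
      simpa only [tpTensor_left, hll, Fin.castAdd_inj] using this
    | right j =>
      have hne : Fin.castAdd k i ≠ Fin.natAdd r j := by
        simp only [ne_eq, Fin.ext_iff, Fin.val_castAdd, Fin.val_natAdd]; omega
      simp only [tpTensor_left, tpTensor_right, hlr, hrl, if_neg hne, one_smul]
      have := (hθ.isTransport hΔ hε (hΦ k)).cons (tp j a) i b 1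
      simp only [mul_one, (hθ.isTransport hΔ hε (hΦ k)).one, LinearMap.rTensor_tmul,
        LinearMap.mulLeft_apply, (hΦ k).Lt_tp, TensorProduct.tmul_sum,
        TensorProduct.tmul_smul, map_sum, map_smul] at this
      exact this
  | right i =>
    induction j using Fin.addCases with
    | left j =>
      rw [Fin.le_def, Fin.val_castAdd, Fin.val_natAdd] at hij
      omega
    | right j =>
      have := congrArg ((1 : A r n) ⊗ₜ[K] ·) (tp_relation (n := n)
        (i := i) (j := j) (Fin.le_def.2 (Nat.le_of_add_le_add_left (Fin.le_def.1 hij))) a b)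
      simp only [TensorProduct.tmul_sum, TensorProduct.tmul_smul] at this
      simpa only [tpTensor_right, hrr, Fin.natAdd_inj] using this

/-- The product of the images of `A_{r,n}` and `A_{k,n}` in `A_{r+k,n}`. -/
def mulMap (f : A r n →ₐ[K] A p n) (g : A k n →ₐ[K] A p n) : A r n ⊗[K] A k n →ₗ[K] A p n :=
  LinearMap.mul' K (A p n) ∘ₗ TensorProduct.map f.toLinearMap g.toLinearMap

theorem mulMap_tmul (f : A r n →ₐ[K] A p n) (g : A k n →ₐ[K] A p n) (x : A r n) (y : A k n) :
    mulMap f g (x ⊗ₜ y) = f x * g y := rfl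

theorem mulMap_mul {f : A r n →ₐ[K] A p n} {g : A k n →ₐ[K] A p n}
    {θ : A k n ⊗[K] A r n →ₗ[K] A r n ⊗[K] A k n}
    (h : ∀ y x, mulMap f g (θ (y ⊗ₜ x)) = g y * f x) (z w : A r n ⊗[K] A k n) :
    mulMap f g ((braided Δ (coord r (Φ r)) (coord k (Φ k)) θ).mul (z ⊗ₜ w)) =
      mulMap f g z * mulMap f g w := by
  induction z using TensorProduct.induction_on with
  | zero => rw [TensorProduct.zero_tmul, map_zero, map_zero, zero_mul]
  | add a b ha hb => rw [TensorProduct.add_tmul, map_add, map_add, map_add, add_mul, ha, hb]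
  | tmul x y =>
  induction w using TensorProduct.induction_on with
  | zero => rw [TensorProduct.tmul_zero, map_zero, map_zero, mul_zero]
  | add a b ha hb => rw [TensorProduct.tmul_add, map_add, map_add, map_add, mul_add, ha, hb]
  | tmul x' y' =>
  refine (congrArg (mulMap f g) (braided_mul_apply Δ (B := coord r (Φ r)) (C := coord k (Φ k))
    θ x x' y y')).trans ?_
  rw [mulMap_tmul, mulMap_tmul, mul_assoc, ← mul_assoc (g y), ← h]
  induction θ (y ⊗ₜ x') using TensorProduct.induction_on with
  | zero => rw [map_zero, map_zero, zero_mul, mul_zero]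
  | add a b ha hb => rw [map_add, map_add, map_add, add_mul, mul_add, ha, hb]
  | tmul u v =>
    change f (x * u) * g (v * y') = f x * (f u * g v * g y')
    simp only [map_mul, mul_assoc]

theorem mulMap_par {f : A r n →ₐ[K] A p n} {s : Fin r → Fin p} (hf : ∀ i a, f (tp i a) = tp (s i) a)
    {g : A k n →ₐ[K] A p n} {s' : Fin k → Fin p} (hg : ∀ i a, g (tp i a) = tp (s' i) a)
    (z : A r n ⊗[K] A k n) :
    mulMap f g (TensorProduct.map (parA r n).toLinearMap (parA k n).toLinearMap z) =
      parA p n (mulMap f g z) := by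
  induction z using TensorProduct.induction_on with
  | zero => simp only [map_zero]
  | add a b ha hb => simp only [map_add, ha, hb]
  | tmul x y =>
    rw [TensorProduct.map_tmul, mulMap_tmul, mulMap_tmul, map_mul, ← parA_comp hf,
      ← parA_comp hg]; rfl

theorem mulMap_act (hΔ : IsComul n Δ) (hε : IsCounit n ε) (hΦ : ∀ r, IsCoordAction Δ ε r (Φ r))
    {f : A r n →ₐ[K] A p n} {s : Fin r → Fin p} (hf : ∀ i a, f (tp i a) = tp (s i) a)
    {g : A k n →ₐ[K] A p n} {s' : Fin k → Fin p} (hg : ∀ i a, g (tp i a) = tp (s' i) a)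
    (u : U n) (z : A r n ⊗[K] A k n) :
    mulMap f g (tensorAct Δ (coord r (Φ r)) (coord k (Φ k)) (u ⊗ₜ z)) =
      Φ p (u ⊗ₜ mulMap f g z) := by
  have h1 := tensorAct_isSMod hΔ (B := coord r (Φ r)) (C := coord k (Φ k)) (hΦ r).isSMod
    (hΦ k).isSMod
  refine h1.1.map_act (hΦ p).isSMod (f := mulMap f g) (mulMap_par hf hg) (fun a b z => ?_) u z
  rw [h1.2, LinearMap.sum_apply, map_sum]
  induction z using TensorProduct.induction_on with
  | zero => simp only [map_zero, Finset.sum_const_zero]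
  | add a b ha hb => simp only [map_add, Finset.sum_add_distrib, ha, hb]
  | tmul x y =>
    rw [mulMap_tmul, (hΦ p).Lt_mul hΔ]
    refine Finset.sum_congr rfl fun c _ => ?_
    rw [← Lt_comp hΔ hε (hΦ r) (hΦ p) hf, ← Lt_comp hΔ hε (hΦ k) (hΦ p) hg]
    rfl

/-- The universal property of A_{r+k,n} supplies τ. It is left linear over A_{r,n} and sends g(y) to
1 ⊗ y, hence inverts `mulMap` on pure tensors; the other composite is checked on words. -/
theorem exists_mulMap_inverse (hΔ : IsComul n Δ) (hε : IsCounit n ε)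
    (hΦ : ∀ r, IsCoordAction Δ ε r (Φ r)) {θ : A k n ⊗[K] A r n →ₗ[K] A r n ⊗[K] A k n}
    (hθ : IsTheta Δ Φ k r θ)
    {f : A r n →ₐ[K] A (r + k) n} (hf : ∀ i a, f (tp i a) = tp (Fin.castAdd k i) a)
    {g : A k n →ₐ[K] A (r + k) n} (hg : ∀ i a, g (tp i a) = tp (Fin.natAdd r i) a)
    (hσ : ∀ z w, mulMap f g ((braided Δ (coord r (Φ r)) (coord k (Φ k)) θ).mul (z ⊗ₜ w)) =
      mulMap f g z * mulMap f g w) :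
    ∃ τ : A (r + k) n →ₗ[K] A r n ⊗[K] A k n,
      (∀ x, mulMap f g (τ x) = x) ∧ ∀ z, τ (mulMap f g z) = z := by
  have hB := braided_isSupermoduleSuperalgebra hΔ hε (hΦ r).1 (hΦ k).1 hθ.1
  obtain ⟨τ, hτ1, hτ⟩ := hB.exists_lift (r := r + k)
    tpTensor
    (braided_relation hΔ hε hΦ hθ)
  have hτf : ∀ x w, τ (f x * w) =
      (braided Δ (coord r (Φ r)) (coord k (Φ k)) θ).mul ((x ⊗ₜ 1) ⊗ₜ τ w) := by
    intro x w
    induction x using A.induction with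
    | one => rw [map_one f, one_mul]; exact (hB.one_mul _).symm
    | add x y hx hy =>
      rw [map_add, add_mul, map_add, TensorProduct.add_tmul, TensorProduct.add_tmul, map_add,
        hx, hy]
    | smul c x hx =>
      rw [map_smul, smul_mul_assoc, map_smul, ← TensorProduct.smul_tmul',
        ← TensorProduct.smul_tmul', map_smul, hx]
    | mul i a x hx =>
      rw [map_mul f, hf, mul_assoc, hτ, hx, tpTensor_left, ← hB.mul_assoc]
      congr 2
      exact braided_mul_tmul_one (hΦ k).1 hθ.1 (tp i a) x 1
  have hτg : ∀ y, τ (g y) = 1 ⊗ₜ y := by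
    intro y
    induction y using A.induction with
    | one => rw [map_one g, hτ1]
    | add x y hx hy => rw [map_add, map_add, TensorProduct.tmul_add, hx, hy]
    | smul c x hx => rw [map_smul, map_smul, TensorProduct.tmul_smul, hx]
    | mul i a x hx =>
      rw [map_mul g, hg, hτ, hx, tpTensor_right]
      exact braided_mul_one_tmul (hΦ r).1 hθ.1 1 (tp i a) x
  refine ⟨τ, fun x => ?_, fun z => ?_⟩
  · induction x using A.induction with
    | one =>
      rw [hτ1]
      exact (mulMap_tmul f g 1 1).trans (by rw [map_one f, map_one g, mul_one])
    | add x y hx hy => rw [map_add, map_add, hx, hy]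
    | smul c x hx => rw [map_smul, map_smul, hx]
    | mul i a x hx =>
      rw [hτ, hσ, hx]
      congr 1
      refine Fin.addCases (fun i => ?_) (fun i => ?_) i
      · rw [tpTensor_left, mulMap_tmul, hf, map_one g, mul_one]
      · rw [tpTensor_right, mulMap_tmul, hg, map_one f, one_mul]
  · induction z using TensorProduct.induction_on with
    | zero => rw [map_zero, map_zero]
    | add a b ha hb => rw [map_add, map_add, ha, hb]
    | tmul x y =>
      rw [mulMap_tmul, hτf, hτg]
      exact (braided_mul_one_tmul (hΦ r).1 hθ.1 x 1 y).trans
        (by rw [LinearMap.mul'_apply, one_mul])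

theorem exists_coord_equiv (hΔ : IsComul n Δ) (hε : IsCounit n ε)
    (hΦ : ∀ r, IsCoordAction Δ ε r (Φ r)) {θ : A k n ⊗[K] A r n →ₗ[K] A r n ⊗[K] A k n}
    (hθ : IsTheta Δ Φ k r θ)
    {f : A r n →ₐ[K] A (r + k) n} (hf : ∀ i a, f (tp i a) = tp (Fin.castAdd k i) a)
    {g : A k n →ₐ[K] A (r + k) n} (hg : ∀ i a, g (tp i a) = tp (Fin.natAdd r i) a) :
    ∃ σ : braided Δ (coord r (Φ r)) (coord k (Φ k)) θ ≃ₗ[K] coord (r + k) (Φ (r + k)),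
      SMAlg.IsHom σ.toLinearMap ∧ σ.toLinearMap = mulMap f g := by
  have hT := hθ.isTransport hΔ hε (hΦ k)
  have hmul : ∀ z w, mulMap f g ((braided Δ (coord r (Φ r)) (coord k (Φ k)) θ).mul (z ⊗ₜ w)) =
      mulMap f g z * mulMap f g w :=
    mulMap_mul (natAdd_mul_castAdd hΔ hε (hΦ k) hT hf hg)
  obtain ⟨τ, h1, h2⟩ := exists_mulMap_inverse hΔ hε hΦ hθ hf hg hmul
  refine ⟨LinearEquiv.ofLinearMap (mulMap f g) τ (LinearMap.ext h1) (LinearMap.ext h2),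
    ⟨?_, hmul, mulMap_par hf hg, mulMap_act hΔ hε hΦ hf hg⟩, rfl⟩
  exact (mulMap_tmul f g 1 1).trans (by rw [map_one f, map_one g, mul_one])

end

end

/-! ### Compatibility of the factorization with `Θ` -/

section

variable {n r k p m : ℕ} {Δ : U n →ₗ[K] U n ⊗[K] U n} {ε : U n →ₐ[K] K}
variable {Φ : ∀ r : ℕ, U n ⊗[K] A r n →ₗ[K] A r n}

/-- Moving past f(x) g(x') means moving past the two factors in turn, and each embedding commutes
with transport because it only relabels rows. -/
theorem rTensor_mulMap_hexL {M : Type} [AddCommGroup M] [Module K M]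
    {Λ : Idx n → Idx n → Module.End K M} {θr : M ⊗[K] A r n →ₗ[K] A r n ⊗[K] M}
    {θk : M ⊗[K] A k n →ₗ[K] A k n ⊗[K] M} {θm : M ⊗[K] A m n →ₗ[K] A m n ⊗[K] M}
    (hr : IsTransport Λ θr) (hk : IsTransport Λ θk) (hm : IsTransport Λ θm)
    {f : A r n →ₐ[K] A m n} {s : Fin r → Fin m} (hf : ∀ i a, f (tp i a) = tp (s i) a)
    {g : A k n →ₐ[K] A m n} {s' : Fin k → Fin m} (hg : ∀ i a, g (tp i a) = tp (s' i) a) :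
    LinearMap.rTensor M (mulMap f g) ∘ₗ hexL θr θk =
      θm ∘ₗ LinearMap.lTensor M (mulMap f g) := ext_tmul_tmul fun y x x' => by
  rw [LinearMap.comp_apply, LinearMap.comp_apply, hexL_tmul, LinearMap.lTensor_tmul, mulMap_tmul,
    hm.tmul_mul, hr.map_right hm hf]
  induction θr (y ⊗ₜ x) using TensorProduct.induction_on with
  | zero => simp only [map_zero]
  | add a b ha hb => simp only [map_add, ha, hb]
  | tmul u v =>
    rw [LinearMap.rTensor_tmul, moveRight_tmul, moveRight_tmul, hk.map_right hm hg]
    induction θk (v ⊗ₜ x') using TensorProduct.induction_on with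
    | zero => simp only [map_zero]
    | add a b ha hb => simp only [map_add, ha, hb]
    | tmul u' v' => rfl

/-- The mirror statement: here the product f(x) g(x') itself moves, which uses the second hexagon
and naturality of transport in equivariant maps. -/
theorem lTensor_mulMap_hexR (hΔ : IsComul n Δ) (hε : IsCounit n ε)
    (hΦ : ∀ r, IsCoordAction Δ ε r (Φ r)) {θr : A r n ⊗[K] A p n →ₗ[K] A p n ⊗[K] A r n}
    {θk : A k n ⊗[K] A p n →ₗ[K] A p n ⊗[K] A k n} {θm : A m n ⊗[K] A p n →ₗ[K] A p n ⊗[K] A m n}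
    (hr : IsTheta Δ Φ r p θr) (hk : IsTheta Δ Φ k p θk) (hm : IsTheta Δ Φ m p θm)
    {f : A r n →ₐ[K] A m n} {s : Fin r → Fin m} (hf : ∀ i a, f (tp i a) = tp (s i) a)
    {g : A k n →ₐ[K] A m n} {s' : Fin k → Fin m} (hg : ∀ i a, g (tp i a) = tp (s' i) a) :
    LinearMap.lTensor (A p n) (mulMap f g) ∘ₗ hexR θr θk =
      θm ∘ₗ LinearMap.rTensor (A p n) (mulMap f g) := TensorProduct.ext_threefold fun x x' y => by
  have hmT := hm.isTransport hΔ hε (hΦ m)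
  have hfT := (hr.isTransport hΔ hε (hΦ r)).map_left hmT (f := f.toLinearMap)
    (Lt_comp hΔ hε (hΦ r) (hΦ m) hf)
  have hgT := (hk.isTransport hΔ hε (hΦ k)).map_left hmT (f := g.toLinearMap)
    (Lt_comp hΔ hε (hΦ k) (hΦ m) hg)
  rw [LinearMap.comp_apply, LinearMap.comp_apply, hexR_tmul, LinearMap.rTensor_tmul, mulMap_tmul]
  refine Eq.trans ?_ (hm.1.mul_tmul (f x) (g x') y).symm
  rw [← AlgHom.toLinearMap_apply g, hgT]
  induction θk (x' ⊗ₜ y) using TensorProduct.induction_on with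
  | zero => simp only [map_zero]
  | add a b ha hb => simp only [map_add, ha, hb]
  | tmul u v =>
    rw [LinearMap.lTensor_tmul, moveLeft_tmul, moveLeft_tmul, ← AlgHom.toLinearMap_apply f, hfT]
    induction θr (x ⊗ₜ u) using TensorProduct.induction_on with
    | zero => simp only [map_zero]
    | add a b ha hb => simp only [map_add, ha, hb]
    | tmul u' v' => rfl

/-- The braided tensor product of `A_{r,n}` and `A_{k,n}` is `A_{r+k,n}`. -/
theorem exists_coord_add_equiv (hΔ : IsComul n Δ) (hε : IsCounit n ε)
    (hΦ : ∀ r, IsCoordAction Δ ε r (Φ r))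
    {Θ : ∀ k r : ℕ, A k n ⊗[K] A r n →ₗ[K] A r n ⊗[K] A k n}
    (hΘ : ∀ k r : ℕ, IsTheta Δ Φ k r (Θ k r)) (r k : ℕ) :
    ∃ σ : braided Δ (coord r (Φ r)) (coord k (Φ k)) (Θ k r) ≃ₗ[K] coord (r + k) (Φ (r + k)),
      SMAlg.IsHom σ.toLinearMap ∧ ∀ p : ℕ,
        LinearMap.rTensor (A p n) σ.toLinearMap ∘ₗ hexL (Θ p r) (Θ p k) =
          Θ p (r + k) ∘ₗ LinearMap.lTensor (A p n) σ.toLinearMap ∧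
        LinearMap.lTensor (A p n) σ.toLinearMap ∘ₗ hexR (Θ r p) (Θ k p) =
          Θ (r + k) p ∘ₗ LinearMap.rTensor (A p n) σ.toLinearMap := by
  obtain ⟨f, hf⟩ := exists_castAdd_hom r k n
  obtain ⟨g, hg⟩ := exists_natAdd_hom r k n
  obtain ⟨σ, hσ, hσe⟩ := exists_coord_equiv hΔ hε hΦ (hΘ k r) hf hg
  refine ⟨σ, hσ, fun p => ⟨?_, ?_⟩⟩
  · rw [hσe]
    exact rTensor_mulMap_hexL ((hΘ p r).isTransport hΔ hε (hΦ p))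
      ((hΘ p k).isTransport hΔ hε (hΦ p)) ((hΘ p (r + k)).isTransport hΔ hε (hΦ p)) hf hg
  · rw [hσe]
    exact lTensor_mulMap_hexR hΔ hε hΦ (hΘ r p) (hΘ k p) (hΘ (r + k) p) hf hg

end

/-! ### Functoriality and associativity of braided tensor products -/

section

variable {n : ℕ} {Δ : U n →ₗ[K] U n ⊗[K] U n} {ε : U n →ₐ[K] K}

namespace SMAlg

variable {B C D : SMAlg n}

theorem IsHom.map_Lt {f : B →ₗ[K] C} (h : IsHom f) (a b : Idx n) (x : B) :
    f (Lt B.par B.act a b x) = Lt C.par C.act a b (f x) := by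
  rw [Lt_apply, Lt_apply, map_pow_apply h.map_par, h.map_act]

/-- The axioms of a supermodule superalgebra can be pulled back along an isomorphism. -/
theorem IsHom.isSupermoduleSuperalgebra (hΔ : IsComul n Δ) (hε : IsCounit n ε) {f : B ≃ₗ[K] C}
    (h : IsHom f.toLinearMap) (hC : C.IsSupermoduleSuperalgebra Δ ε) :
    B.IsSupermoduleSuperalgebra Δ ε := by
  have h1 : f B.one = C.one := h.map_one
  have hm : ∀ a b, f (B.mul (a ⊗ₜ b)) = C.mul (f a ⊗ₜ f b) := h.map_mul
  have hp : ∀ a, f (B.par a) = C.par (f a) := h.map_par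
  have ha : ∀ u a, f (B.act (u ⊗ₜ a)) = C.act (u ⊗ₜ f a) := h.map_act
  have hL : ∀ a b x, f (Lt B.par B.act a b x) = Lt C.par C.act a b (f x) := h.map_Lt
  refine isSupermoduleSuperalgebra_of_Lt hΔ hε ⟨fun m => ?_, fun m => ?_, fun u v m => ?_,
    fun u m => ?_⟩ (fun a b c => ?_) (fun a => ?_) (fun a => ?_) ?_ (fun a b => ?_) (fun a b => ?_)
    (fun a b x y => ?_) <;> apply f.injective
  · rw [hp, hp, hC.par_par]
  · rw [ha, hC.one_act]
  · rw [ha, ha, ha, hC.mul_act]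
  · rw [hp, ha, ha, hp, hC.par_act]
  · rw [hm, hm, hm, hm, hC.mul_assoc]
  · rw [hm, h1, hC.one_mul]
  · rw [hm, h1, hC.mul_one]
  · rw [hp, h1, hC.par_one]
  · rw [hp, hm, hm, hp, hp, hC.par_mul]
  · rw [hL, h1, hC.Lt_one hε]
    split_ifs
    · exact h1.symm
    · exact (map_zero f).symm
  · rw [hL, hm, hC.Lt_mul hΔ, map_sum]
    exact Finset.sum_congr rfl fun c _ => by rw [hm, hL, hL]

theorem IsHom.comp {f : B →ₗ[K] C} {g : C →ₗ[K] D} (hg : IsHom g) (hf : IsHom f) :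
    IsHom (g ∘ₗ f) where
  map_one := by rw [LinearMap.comp_apply, hf.map_one, hg.map_one]
  map_mul a b := by simp only [LinearMap.comp_apply, hf.map_mul, hg.map_mul]
  map_par a := by simp only [LinearMap.comp_apply, hf.map_par, hg.map_par]
  map_act u a := by simp only [LinearMap.comp_apply, hf.map_act, hg.map_act]

/-- Functoriality of the braided tensor product in the first factor. -/
theorem IsHom.braided_left (hΔ : IsComul n Δ) (hB : IsSMod B.par B.act) (hC : IsSMod C.par C.act)
    (hD : IsSMod D.par D.act) {f : B →ₗ[K] C} (hf : IsHom f)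
    {θ : D ⊗[K] B →ₗ[K] B ⊗[K] D} {θ' : D ⊗[K] C →ₗ[K] C ⊗[K] D}
    (hθ : LinearMap.rTensor D f ∘ₗ θ = θ' ∘ₗ LinearMap.lTensor D f) :
    IsHom (B := braided Δ B D θ) (C := braided Δ C D θ') (LinearMap.rTensor D f) := by
  have hpar : ∀ z, LinearMap.rTensor D f (TensorProduct.map B.par D.par z) =
      TensorProduct.map C.par D.par (LinearMap.rTensor D f z) := fun z => by
    induction z using TensorProduct.induction_on with
    | zero => simp only [map_zero]
    | add a b ha hb => simp only [map_add, ha, hb]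
    | tmul x y =>
      rw [TensorProduct.map_tmul, LinearMap.rTensor_tmul, LinearMap.rTensor_tmul,
        TensorProduct.map_tmul, hf.map_par]
  refine ⟨?_, fun z w => ?_, hpar, fun u z => ?_⟩
  · rw [LinearMap.rTensor_tmul, hf.map_one]
  · induction z using TensorProduct.induction_on with
    | zero => simp only [TensorProduct.zero_tmul, map_zero]
    | add a b ha hb => simp only [TensorProduct.add_tmul, map_add, ha, hb]
    | tmul x y =>
    induction w using TensorProduct.induction_on with
    | zero => simp only [TensorProduct.tmul_zero, map_zero]
    | add a b ha hb => simp only [TensorProduct.tmul_add, map_add, ha, hb]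
    | tmul x' y' =>
    have h := LinearMap.congr_fun hθ (y ⊗ₜ x')
    rw [LinearMap.comp_apply, LinearMap.comp_apply, LinearMap.lTensor_tmul] at h
    rw [LinearMap.rTensor_tmul, LinearMap.rTensor_tmul, braided_mul_apply, braided_mul_apply, ← h]
    induction θ (y ⊗ₜ x') using TensorProduct.induction_on with
    | zero => simp only [map_zero]
    | add a b ha hb => simp only [map_add, ha, hb]
    | tmul a b =>
      rw [TensorProduct.map_tmul, LinearMap.rTensor_tmul, LinearMap.rTensor_tmul,
        TensorProduct.map_tmul, lmul_apply, lmul_apply, hf.map_mul]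
  · have h1 := tensorAct_isSMod hΔ hB hD
    have h2 := tensorAct_isSMod hΔ hC hD
    refine h1.1.map_act h2.1 (f := LinearMap.rTensor D f) hpar (fun a b z => ?_) u z
    rw [h1.2, h2.2]
    induction z using TensorProduct.induction_on with
    | zero => simp only [map_zero]
    | add a b ha hb => simp only [map_add, ha, hb]
    | tmul x y =>
      simp only [LinearMap.sum_apply, TensorProduct.map_tmul, map_sum, LinearMap.rTensor_tmul,
        hf.map_Lt]

/-- The associativity constraint is a homomorphism of braided tensor products. -/
theorem isHom_assoc (hΔ : IsComul n Δ) (hB : IsSMod B.par B.act) (hC : IsSMod C.par C.act)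
    (hD : IsSMod D.par D.act) (θ : C ⊗[K] B →ₗ[K] B ⊗[K] C) (θ' : D ⊗[K] B →ₗ[K] B ⊗[K] D)
    (θ'' : D ⊗[K] C →ₗ[K] C ⊗[K] D) :
    IsHom (B := braided Δ (braided Δ B C θ) D (hexL θ' θ''))
      (C := braided Δ B (braided Δ C D θ'') (hexR θ θ'))
      (TensorProduct.assoc K B C D).toLinearMap := by
  have hpar : ∀ z, (TensorProduct.assoc K B C D)
      (TensorProduct.map (TensorProduct.map B.par C.par) D.par z) =
      TensorProduct.map B.par (TensorProduct.map C.par D.par)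
        (TensorProduct.assoc K B C D z) := fun z => by
    have : (TensorProduct.assoc K B C D).toLinearMap ∘ₗ
        TensorProduct.map (TensorProduct.map B.par C.par) D.par =
        TensorProduct.map B.par (TensorProduct.map C.par D.par) ∘ₗ
          (TensorProduct.assoc K B C D).toLinearMap := TensorProduct.ext_threefold fun _ _ _ => rfl
    exact LinearMap.congr_fun this z
  refine ⟨rfl, fun z w => ?_, hpar, fun u z => ?_⟩
  · change TensorProduct.assoc K B C D
        ((braided Δ (braided Δ B C θ) D (hexL θ' θ'')).mul (z ⊗ₜ w)) =
      (braided Δ B (braided Δ C D θ'') (hexR θ θ')).mul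
        (TensorProduct.assoc K B C D z ⊗ₜ TensorProduct.assoc K B C D w)
    induction z using TensorProduct.induction_on with
    | zero => simp only [TensorProduct.zero_tmul, map_zero]
    | add a b ha hb => simp only [TensorProduct.add_tmul, map_add, ha, hb]
    | tmul s z =>
    induction s using TensorProduct.induction_on with
    | zero => simp only [TensorProduct.zero_tmul, map_zero]
    | add a b ha hb => simp only [TensorProduct.add_tmul, map_add, ha, hb]
    | tmul x y =>
    induction w using TensorProduct.induction_on with
    | zero => simp only [TensorProduct.tmul_zero, map_zero]
    | add a b ha hb => simp only [TensorProduct.tmul_add, map_add, ha, hb]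
    | tmul s z' =>
    induction s using TensorProduct.induction_on with
    | zero => simp only [TensorProduct.tmul_zero, TensorProduct.zero_tmul, map_zero]
    | add a b ha hb => simp only [TensorProduct.tmul_add, TensorProduct.add_tmul, map_add, ha, hb]
    | tmul x' y' =>
    rw [braided_mul_apply, TensorProduct.assoc_tmul, TensorProduct.assoc_tmul, braided_mul_apply,
      hexL_tmul, hexR_tmul]
    induction θ' (z ⊗ₜ x') using TensorProduct.induction_on with
    | zero => simp only [map_zero]
    | add a b ha hb => simp only [map_add, ha, hb]
    | tmul a b =>
    rw [moveRight_tmul, moveLeft_tmul]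
    -- Once z has passed x', giving a ⊗ b, the two remaining moves θ(y ⊗ a) and θ''(b ⊗ y') involve
    -- disjoint factors. Both products equal F of their tensor product, so no compatibility among
    -- the three operators is needed.
    let F : (B ⊗[K] C) ⊗[K] (C ⊗[K] D) →ₗ[K] B ⊗[K] (C ⊗[K] D) :=
      TensorProduct.map (B.lmul x) (TensorProduct.map C.mul (D.rmul z') ∘ₗ
        (TensorProduct.assoc K C C D).symm.toLinearMap) ∘ₗ
        (TensorProduct.assoc K B C (C ⊗[K] D)).toLinearMap
    have hl : ∀ w : C ⊗[K] D, TensorProduct.assoc K B C D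
        (TensorProduct.map ((braided Δ B C θ).lmul (x ⊗ₜ y)) (D.rmul z')
          (LinearMap.rTensor D (TensorProduct.mk K B C a) w)) = F (θ (y ⊗ₜ a) ⊗ₜ w) := fun w => by
      induction w using TensorProduct.induction_on with
      | zero => simp only [TensorProduct.tmul_zero, map_zero]
      | add a b ha hb => simp only [TensorProduct.tmul_add, map_add, ha, hb]
      | tmul c d =>
      rw [LinearMap.rTensor_tmul, TensorProduct.map_tmul, lmul_apply, TensorProduct.mk_apply,
        braided_mul_apply]
      induction θ (y ⊗ₜ a) using TensorProduct.induction_on with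
      | zero => simp only [TensorProduct.zero_tmul, map_zero]
      | add a b ha hb => simp only [TensorProduct.add_tmul, map_add, ha, hb]
      | tmul u v => rfl
    have hr : ∀ t : B ⊗[K] C, TensorProduct.map (B.lmul x)
        ((braided Δ C D θ'').rmul (y' ⊗ₜ z'))
          (LinearMap.lTensor B ((TensorProduct.mk K C D).flip b) t) =
        F (t ⊗ₜ θ'' (b ⊗ₜ y')) := fun t => by
      induction t using TensorProduct.induction_on with
      | zero => simp only [TensorProduct.zero_tmul, map_zero]
      | add a b ha hb => simp only [TensorProduct.add_tmul, map_add, ha, hb]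
      | tmul u v =>
      rw [LinearMap.lTensor_tmul, TensorProduct.map_tmul, rmul_apply, LinearMap.flip_apply,
        TensorProduct.mk_apply, braided_mul_apply]
      induction θ'' (b ⊗ₜ y') using TensorProduct.induction_on with
      | zero => simp only [TensorProduct.tmul_zero, map_zero]
      | add a b ha hb => simp only [TensorProduct.tmul_add, map_add, ha, hb]
      | tmul c d => rfl
    exact (hl _).trans (hr _).symm
  · have h1 := tensorAct_isSMod hΔ hB hC
    have h2 := tensorAct_isSMod hΔ hC hD
    have h3 := tensorAct_isSMod hΔ (B := braided Δ B C θ) (C := D) h1.1 hD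
    have h4 := tensorAct_isSMod hΔ (B := B) (C := braided Δ C D θ'') hB h2.1
    refine h3.1.map_act h4.1 (f := (TensorProduct.assoc K B C D).toLinearMap) hpar
      (fun a b z => ?_) u z
    rw [h3.2, h4.2]
    simp only [h1.2, h2.2, LinearEquiv.coe_coe]
    induction z using TensorProduct.induction_on with
    | zero => simp only [map_zero]
    | add a b ha hb => simp only [map_add, ha, hb]
    | tmul s z =>
    induction s using TensorProduct.induction_on with
    | zero => simp only [TensorProduct.zero_tmul, map_zero]
    | add a b ha hb => simp only [TensorProduct.add_tmul, map_add, ha, hb]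
    | tmul x y =>
      simp only [LinearMap.sum_apply, TensorProduct.map_tmul, map_sum, TensorProduct.assoc_tmul,
        TensorProduct.sum_tmul, TensorProduct.tmul_sum]
      exact Finset.sum_comm

end SMAlg

/-- Composite braidings are natural in the factor that is passed first; this carries the
intertwining property through the induction on the number of factors. -/
theorem hexL_congr {V W W' X : Type} [AddCommGroup V] [AddCommGroup W] [AddCommGroup W']
    [AddCommGroup X] [Module K V] [Module K W] [Module K W'] [Module K X] {f : W →ₗ[K] W'}
    {θ : V ⊗[K] W →ₗ[K] W ⊗[K] V} {θ' : V ⊗[K] W' →ₗ[K] W' ⊗[K] V}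
    (hθ : LinearMap.rTensor V f ∘ₗ θ = θ' ∘ₗ LinearMap.lTensor V f)
    (θ'' : V ⊗[K] X →ₗ[K] X ⊗[K] V) :
    LinearMap.rTensor V (LinearMap.rTensor X f) ∘ₗ hexL θ θ'' =
      hexL θ' θ'' ∘ₗ LinearMap.lTensor V (LinearMap.rTensor X f) := ext_tmul_tmul fun v w x => by
  have h := LinearMap.congr_fun hθ (v ⊗ₜ w)
  rw [LinearMap.comp_apply, LinearMap.comp_apply, LinearMap.lTensor_tmul] at h
  rw [LinearMap.comp_apply, LinearMap.comp_apply, hexL_tmul, LinearMap.lTensor_tmul,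
    LinearMap.rTensor_tmul, hexL_tmul, ← h]
  induction θ (v ⊗ₜ w) using TensorProduct.induction_on with
  | zero => simp only [map_zero]
  | add a b ha hb => simp only [map_add, ha, hb]
  | tmul a b =>
    rw [LinearMap.rTensor_tmul, moveRight_tmul, moveRight_tmul]
    induction θ'' (b ⊗ₜ x) using TensorProduct.induction_on with
    | zero => simp only [map_zero]
    | add a b ha hb => simp only [map_add, ha, hb]
    | tmul c d => rfl

end

/-! ### Conclusion -/

section

variable {n : ℕ} {Δ : U n →ₗ[K] U n ⊗[K] U n} {ε : U n →ₐ[K] K}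

/-! ### The quantum supersymmetric algebra -/

/-- The relation of S_q(V) is the relation of a single row with itself in A_{r,n}. -/
theorem Sq.v_relation (a b : Idx n) : q • (Sq.v a * Sq.v b : Sq n) =
    ∑ d, ∑ c, R a b d c • (Sq.v d * Sq.v c) := by
  rw [sum_R_smul a b fun d c => (Sq.v d * Sq.v c : Sq n)]
  have h := RingQuot.mkAlgHom_rel K (SqRel.mk a b)
  simp only [map_add, map_smul, map_mul] at h
  rw [mul_comm (sg _)]
  exact h

theorem Sq.exists_lift {B : Type} [Ring B] [Algebra K B] (y : Idx n → B)
    (h : ∀ a b, q • (y a * y b) = ∑ d, ∑ c, R a b d c • (y d * y c)) :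
    ∃ f : Sq n →ₐ[K] B, ∀ a, f (Sq.v a) = y a := by
  refine ⟨RingQuot.liftAlgHom K ⟨FreeAlgebra.lift K y, ?_⟩, fun a => ?_⟩
  · intro x z hxz
    obtain ⟨a, b⟩ := hxz
    simp only [map_add, map_smul, map_mul, FreeAlgebra.lift_ι_apply, h]
    rw [sum_R_smul a b fun d c => y d * y c, mul_comm (sg _)]
  · refine (RingQuot.liftAlgHom_mkAlgHom_apply K _ _ _).trans ?_
    rw [FreeAlgebra.lift_ι_apply]

theorem Sq.algHom_ext {B : Type} [Ring B] [Algebra K B] {f g : Sq n →ₐ[K] B}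
    (h : ∀ a, f (Sq.v a) = g (Sq.v a)) : f = g :=
  RingQuot.ringQuot_ext' K f g (FreeAlgebra.hom_ext (funext h))

/-- The quantum supersymmetric algebra is `A_{1,n}`. -/
theorem exists_Sq_equiv (n : ℕ) :
    ∃ e : Sq n ≃ₐ[K] A 1 n, ∀ a : Idx n, e (Sq.v a) = t idxOne a := by
  obtain ⟨f, hf⟩ := Sq.exists_lift (n := n) (fun a => (tp 0 a : A 1 n)) fun a b => by
    simpa using tp_relation (n := n) (le_refl (0 : Fin 1)) a b
  obtain ⟨g, hg⟩ := exists_lift (r := 1) (n := n) (fun _ a => (Sq.v a : Sq n)) fun i j _ a b => by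
    rw [if_pos (Subsingleton.elim i j), Sq.v_relation]
  refine ⟨AlgEquiv.ofAlgHom f g (A.algHom_ext fun i a => ?_) (Sq.algHom_ext fun a => ?_), hf⟩
  · rw [AlgHom.comp_apply, hg, hf, Subsingleton.elim i 0]; rfl
  · rw [AlgHom.comp_apply, hf, hg]; rfl

/-! ### Iterated braided tensor products -/

variable {Φ : ∀ r : ℕ, U n ⊗[K] A r n →ₗ[K] A r n}
  {Θ : ∀ k r : ℕ, A k n ⊗[K] A r n →ₗ[K] A r n ⊗[K] A k n}

/-- Index m stands for m + 1 copies. The intertwining property belongs to the induction hypothesis: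
it is what makes f ⊗ 1 multiplicative on the next braided product, after which the factorization of
A_{m+2,n} is applied. -/
theorem exists_braidedPow_equiv (hΔ : IsComul n Δ) (hε : IsCounit n ε)
    (hΦ : ∀ r, IsCoordAction Δ ε r (Φ r)) (hΘ : ∀ k r : ℕ, IsTheta Δ Φ k r (Θ k r)) (m : ℕ) :
    ∃ f : (braidedPow Δ (coord 1 (Φ 1)) (Θ 1 1) m).1 ≃ₗ[K] coord (m + 1) (Φ (m + 1)),
      SMAlg.IsHom f.toLinearMap ∧
      LinearMap.rTensor (A 1 n) f.toLinearMap ∘ₗ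
          (braidedPow Δ (coord 1 (Φ 1)) (Θ 1 1) m).2 =
        Θ 1 (m + 1) ∘ₗ LinearMap.lTensor (A 1 n) f.toLinearMap := by
  induction m with
  | zero =>
    refine ⟨LinearEquiv.refl K (A 1 n), ⟨rfl, fun _ _ => rfl, fun _ => rfl, fun _ _ => rfl⟩, ?_⟩
    change LinearMap.rTensor (A 1 n) LinearMap.id ∘ₗ Θ 1 1 =
      Θ 1 1 ∘ₗ LinearMap.lTensor (A 1 n) LinearMap.id
    rw [LinearMap.rTensor_id, LinearMap.lTensor_id, LinearMap.id_comp, LinearMap.comp_id]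
  | succ m ih =>
    obtain ⟨f, hf, hfθ⟩ := ih
    obtain ⟨σ, hσ, hσp⟩ := exists_coord_add_equiv hΔ hε hΦ hΘ (m + 1) 1
    have hC := (hf.isSupermoduleSuperalgebra hΔ hε (hΦ (m + 1)).1).isSMod
    refine ⟨(TensorProduct.congr f (LinearEquiv.refl K (A 1 n))).trans σ,
      hσ.comp (hf.braided_left hΔ hC (hΦ (m + 1)).1.isSMod (D := coord 1 (Φ 1)) (hΦ 1).1.isSMod
        hfθ), ?_⟩
    have h1 := hexL_congr hfθ (Θ 1 1)
    have h2 := (hσp 1).1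
    change LinearMap.rTensor (A 1 n) (σ.toLinearMap ∘ₗ LinearMap.rTensor (A 1 n) f.toLinearMap) ∘ₗ
      hexL (braidedPow Δ (coord 1 (Φ 1)) (Θ 1 1) m).2 (Θ 1 1) =
      Θ 1 (m + 1 + 1) ∘ₗ LinearMap.lTensor (A 1 n)
        (σ.toLinearMap ∘ₗ LinearMap.rTensor (A 1 n) f.toLinearMap)
    rw [LinearMap.rTensor_comp, LinearMap.lTensor_comp, LinearMap.comp_assoc, h1,
      ← LinearMap.comp_assoc, ← LinearMap.comp_assoc, ← h2]

/-- Rather than verifying the braiding axioms for the composite operator, the structure is pulled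
back along σ ⊗ 1 from the braided product of A_{r+k,n} and A_{p,n}. -/
theorem braided_braided_isSupermoduleSuperalgebra (hΔ : IsComul n Δ) (hε : IsCounit n ε)
    (hΦ : ∀ r, IsCoordAction Δ ε r (Φ r)) (hΘ : ∀ k r : ℕ, IsTheta Δ Φ k r (Θ k r)) (r k p : ℕ) :
    (braided Δ (braided Δ (coord r (Φ r)) (coord k (Φ k)) (Θ k r)) (coord p (Φ p))
      (hexL (Θ p r) (Θ p k))).IsSupermoduleSuperalgebra Δ ε := by
  obtain ⟨σ, hσ, hσp⟩ := exists_coord_add_equiv hΔ hε hΦ hΘ r k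
  have hC := hσ.isSupermoduleSuperalgebra hΔ hε (hΦ (r + k)).1
  have hT := braided_isSupermoduleSuperalgebra hΔ hε (hΦ (r + k)).1 (hΦ p).1 (hΘ p (r + k)).1
  exact SMAlg.IsHom.isSupermoduleSuperalgebra hΔ hε
    (f := TensorProduct.congr σ (LinearEquiv.refl K (A p n)))
    (hσ.braided_left hΔ hC.isSMod (hΦ (r + k)).1.isSMod (D := coord p (Φ p)) (hΦ p).1.isSMod
      (hσp p).1) hT

end

end

end QueerBraid

theorem mainTheorem8 (n : ℕ) (hn : 0 < n) :
    -- the comultiplication and the counit of `U_q(𝔮_n)` exist and are unique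
    (∃! Δ : U n →ₗ[K] U n ⊗[K] U n, IsComul n Δ) ∧
    (∃! ε : U n →ₐ[K] K, IsCounit n ε) ∧
    ∀ (Δ : U n →ₗ[K] U n ⊗[K] U n) (ε : U n →ₐ[K] K), IsComul n Δ → IsCounit n ε →
    -- the actions on the quantum coordinate superalgebras exist and are unique
    (∀ r : ℕ, ∃! φ : U n ⊗[K] A r n →ₗ[K] A r n, IsCoordAction Δ ε r φ) ∧
    ∀ Φ : ∀ r : ℕ, U n ⊗[K] A r n →ₗ[K] A r n, (∀ r : ℕ, IsCoordAction Δ ε r (Φ r)) →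
    -- the braiding operators exist and are unique
    (∀ k r : ℕ, ∃! θ : A k n ⊗[K] A r n →ₗ[K] A r n ⊗[K] A k n, IsTheta Δ Φ k r θ) ∧
    ∀ Θ : ∀ k r : ℕ, A k n ⊗[K] A r n →ₗ[K] A r n ⊗[K] A k n,
      (∀ k r : ℕ, IsTheta Δ Φ k r (Θ k r)) →
    -- `A_{1,n}` is the quantum supersymmetric algebra
    (∃ e : Sq n ≃ₐ[K] A 1 n, ∀ a : Idx n, e (Sq.v a) = t idxOne a) ∧
    -- the braided tensor product of `r = m + 1` copies of `A_{1,n}` is isomorphic to `A_{r,n}`,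
    -- compatibly with the braiding operators
    (∀ m : ℕ,
      (braidedPow Δ (coord 1 (Φ 1)) (Θ 1 1) m).1.IsSupermoduleSuperalgebra Δ ε ∧
      ∃ f : (braidedPow Δ (coord 1 (Φ 1)) (Θ 1 1) m).1 ≃ₗ[K] coord (m + 1) (Φ (m + 1)),
        SMAlg.IsHom f.toLinearMap ∧
        LinearMap.rTensor (A 1 n) f.toLinearMap ∘ₗ
            (braidedPow Δ (coord 1 (Φ 1)) (Θ 1 1) m).2 =
          Θ 1 (m + 1) ∘ₗ LinearMap.lTensor (A 1 n) f.toLinearMap) ∧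
    -- `A_{r,n} ⊗ A_{k,n}` is isomorphic to `A_{r+k,n}`, compatibly with the braiding operators
    (∀ r k : ℕ,
      (braided Δ (coord r (Φ r)) (coord k (Φ k)) (Θ k r)).IsSupermoduleSuperalgebra Δ ε ∧
      ∃ σ : braided Δ (coord r (Φ r)) (coord k (Φ k)) (Θ k r) ≃ₗ[K] coord (r + k) (Φ (r + k)),
        SMAlg.IsHom σ.toLinearMap ∧
        ∀ p : ℕ,
          LinearMap.rTensor (A p n) σ.toLinearMap ∘ₗ hexL (Θ p r) (Θ p k) =
            Θ p (r + k) ∘ₗ LinearMap.lTensor (A p n) σ.toLinearMap ∧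
          LinearMap.lTensor (A p n) σ.toLinearMap ∘ₗ hexR (Θ r p) (Θ k p) =
            Θ (r + k) p ∘ₗ LinearMap.rTensor (A p n) σ.toLinearMap) ∧
    -- the braided tensor product is associative
    (∀ r k p : ℕ,
      (braided Δ (braided Δ (coord r (Φ r)) (coord k (Φ k)) (Θ k r)) (coord p (Φ p))
        (hexL (Θ p r) (Θ p k))).IsSupermoduleSuperalgebra Δ ε ∧
      ∃ α : braided Δ (braided Δ (coord r (Φ r)) (coord k (Φ k)) (Θ k r)) (coord p (Φ p))
            (hexL (Θ p r) (Θ p k)) ≃ₗ[K]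
          braided Δ (coord r (Φ r)) (braided Δ (coord k (Φ k)) (coord p (Φ p)) (Θ p k))
            (hexR (Θ k r) (Θ p r)),
        SMAlg.IsHom α.toLinearMap) := by
  refine ⟨existsUnique_comul n, existsUnique_counit n, fun Δ ε hΔ hε =>
    ⟨existsUnique_coordAction hΔ hε, fun Φ hΦ => ⟨existsUnique_theta hΔ hε hΦ, fun Θ hΘ =>
      ⟨exists_Sq_equiv n, fun m => ?_, fun r k => ⟨?_, exists_coord_add_equiv hΔ hε hΦ hΘ r k⟩,
        fun r k p => ⟨braided_braided_isSupermoduleSuperalgebra hΔ hε hΦ hΘ r k p,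
          TensorProduct.assoc K (A r n) (A k n) (A p n), ?_⟩⟩⟩⟩⟩
  · obtain ⟨f, hf, hfθ⟩ := exists_braidedPow_equiv hΔ hε hΦ hΘ m
    exact ⟨hf.isSupermoduleSuperalgebra hΔ hε (hΦ (m + 1)).1, f, hf, hfθ⟩
  · exact braided_isSupermoduleSuperalgebra hΔ hε (hΦ r).1 (hΦ k).1 (hΘ k r).1
  · exact SMAlg.isHom_assoc hΔ (hΦ r).1.isSMod (hΦ k).1.isSMod (hΦ p).1.isSMod _ _ _
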